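/- Let two fluid bodies $\mathcal B_1(t),\mathcal B_2(t)\subset\mathbb R^3$ of constant density $\rho>0$ and mass $M=\frac{4\pi}{3}\rho R^3$ form, for $t$ in an interval $I$ with least element $T_0$, a classical solution of the free boundary Euler-Poisson system $$\mathbf v_t+\mathbf v\cdot\nabla\mathbf v=-\nabla\mathbf p-\nabla(\psi_1+\psi_2),\quad \nabla\cdot\mathbf v=0,\quad\nabla\times\mathbf v=0\ \text{ in }\mathcal B_j(t),\qquad \mathbf p=0\ \text{ on }\partial\mathcal B_j(t),$$ where $\psi_j(t,\mathbf x)=-G\rho\int_{\mathcal B_j(t)}\frac{d\mathbf y}{|\mathbf x-\mathbf y|}$ and the free boundaries move with the fluid. (Classical: the closures of the two bodies are disjoint, $\mathbf v$ is $C^1$ in space-time up to the boundary, $\mathbf p$ is differentiable inside and continuous up to the boundary, and each body is transported by a Lagrangian flow that is $C^1$ in time and space up to the boundary.) Assume that $\mathcal B_1(T_0)$ and $\mathcal B_2(T_0)$ are the balls of radius $R$ centered at $(-b,R_0,0)$ and $(b,-R_0,0)$ with $b,R_0>0$, that $\mathcal B_2(t)=-\mathcal B_1(t)$ and $\operatorname{diam}\mathcal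 B_2(t)\le 10R$ for all $t\in I$, and that the center of mass $\mathbf x_1(t)=\frac{\rho}{M}\int_{\mathcal B_1(t)}\mathbf x\,d\mathbf x$ satisfies $\mathbf x_1'(T_0)=(0,-v_0,0)$. Put $$\beta=\tfrac bR,\quad R_1=\sqrt{b^2+R_0^2},\quad v_0=\kappa\beta^{-\alpha}\sqrt{\tfrac{GM}{R}},\quad c_0=\kappa\beta^{\frac67-\alpha},\qquad \kappa>0,\ \alpha\in[\tfrac67,1],$$ $r_1=|\mathbf x_1|$, $v_1=\mathbf x_1'$, $\eta=R/r_1$. Let $r_0$, if it exists, be the infimum of all real $\tilde r$ such that for every $T\in I$: if $r_1\ge\tilde r$ on $[T_0,T]$ then $r_1'<0$ on $[T_0,T]$. (It exists exactly when $r_1'$ does not stay negative on all of $I$.) There are universal constants $C,K>0$ (independent of $G,\rho,R,b,R_0,\kappa,\alpha,T_0$ and of the solution) such that, if $$\beta\ge K,\qquad \kappa^2\beta^{2-2\alpha}\ge K,\qquad \kappa^{-14}\beta^{14\alpha-12}\ge K,\qquad R_1\ge K\,\frac{GM}{v_0^2},$$ then $\mathbf x_1$ is twice differentiable on $I$ and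 the following holds, where $x\approx a$ means $a/C\le x\le Ca$. 1. $|v_1'|\approx \frac{GM}{r_1^2}$ at every $t\in I$ such that $r_1'<0$ on $[T_0,t)$ and, if $r_0$ exists, also at every $t\in I$ with $r_1(t)\ge r_0$. 2. If $T_0+C R_1/v_0\in I$ (in particular if the solution is global), then $r_0$ exists. Whenever $r_0$ exists, $\frac32c_0^2R\beta^{2/7}\le r_0\le\frac52c_0^2R\beta^{2/7}$, and there is $t_0\in I$ with $r_1(t_0)=r_0$, $r_1'(t_0)=0$, and $r_1>r_0$, $r_1'<0$ on $[T_0,t_0)$. 3. At every $t\in I$ such that $r_1'<0$ on $[T_0,t)$, $r_1$ is differentiable and $$|r_1'|\approx\sqrt{\tfrac{GM}{R}}\,c_0\beta^{-6/7}\ \text{ and }\ |v_1|\approx\sqrt{\tfrac{GM}{R}}\,c_0\beta^{-6/7}\quad\text{if } r_1\ge Rc_0^{-2}\beta^{12/7},$$ $$|r_1'|\approx\sqrt{\tfrac{GM}{R}}\,\eta^{1/2}\ \text{ and }\ |v_1|\approx\sqrt{\tfrac{GM}{R}}\,\eta^{1/2}\quad\text{if } 3Rc_0^2\beta^{2/7}\le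 r_1\le Rc_0^{-2}\beta^{12/7},$$ $$|v_1|\approx c_0^{-1}\sqrt{\tfrac{GM}{R}}\,\beta^{-1/7}\quad\text{if } r_1\le 4c_0^2R\beta^{2/7}.$$ If $r_0$ exists then, moreover, for $t<t_0$, $$|r_1'|\approx\frac{\sqrt{GM}}{c_0^2R}\,\beta^{-2/7}\sqrt{r_1-r_0}\quad\text{if } r_0<r_1\le4c_0^2R\beta^{2/7}.$$ -/

import Mathlib

open Set

/-- Physical space `ℝ³` with its Euclidean norm. -/
abbrev Space3 : Type := EuclideanSpace ℝ (Fin 3)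

/-- The partial derivative `∂ᵢ uⱼ` of a vector field at `x`. -/
noncomputable def partialDeriv (u : Space3 → Space3) (i j : Fin 3) (x : Space3) : ℝ :=
  (fderiv ℝ u x (EuclideanSpace.single i 1)) j

/-- The divergence `∇ · u`. -/
noncomputable def divergence3 (u : Space3 → Space3) (x : Space3) : ℝ :=
  ∑ i, partialDeriv u i i x

/-- The curl `∇ × u`. -/
noncomputable def curl3 (u : Space3 → Space3) (x : Space3) : Space3 :=
  !₂[partialDeriv u 1 2 x - partialDeriv u 2 1 x,
     partialDeriv u 2 0 x - partialDeriv u 0 2 x,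
     partialDeriv u 0 1 x - partialDeriv u 1 0 x]

/-- The Newtonian potential `-Gρ ∫_Ω dy / |x - y|` of a body `Ω` of constant density `ρ`. -/
noncomputable def newtonPotential (G ρ : ℝ) (Ω : Set Space3) (x : Space3) : ℝ :=
  -(G * ρ) * ∫ y in Ω, ‖x - y‖⁻¹

/-- The center of mass `(ρ/M) ∫_Ω x dx` of a body `Ω` of density `ρ` and mass `M`. -/
noncomputable def centerOfMass (ρ M : ℝ) (Ω : Set Space3) : Space3 :=
  (ρ / M) • ∫ x in Ω, x

/-- `X` is the Lagrangian flow, on the time interval `I` with initial time `T₀`, of the velocity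
field `v`, and it carries the body and its boundary at time `T₀` to the body and its boundary at
time `t`. That such a flow exists is the kinematic condition that the free boundary moves with
the fluid. -/
structure IsLagrangianFlow (I : Set ℝ) (T₀ : ℝ) (B : ℝ → Set Space3) (v : ℝ → Space3 → Space3)
    (X : ℝ → Space3 → Space3) : Prop where
  contDiffOn : ContDiffOn ℝ 1 (fun q : ℝ × Space3 => X q.1 q.2) (I ×ˢ closure (B T₀))
  initial : ∀ y ∈ closure (B T₀), X T₀ y = y
  injOn : ∀ t ∈ I, InjOn (X t) (closure (B T₀))
  image_body : ∀ t ∈ I, X t '' B T₀ = B t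
  image_boundary : ∀ t ∈ I, X t '' frontier (B T₀) = frontier (B t)
  velocity : ∀ t ∈ I, ∀ y ∈ closure (B T₀),
    HasDerivWithinAt (fun s => X s y) (v t (X t y)) I t

/-- Classical solutions, on the time interval `I` with initial time `T₀`, of the free boundary
Euler-Poisson system of two incompressible, irrotational fluid bodies `B 0 t` (the first body) and
`B 1 t` (the second body) of constant density `ρ`, with velocity `v` and pressure `p`. -/
structure IsTwoBodySolution (G ρ : ℝ) (I : Set ℝ) (T₀ : ℝ) (B : Fin 2 → ℝ → Set Space3)
    (v : ℝ → Space3 → Space3) (p : ℝ → Space3 → ℝ) : Prop where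
  isOpen_body : ∀ j, ∀ t ∈ I, IsOpen (B j t)
  bodies_disjoint : ∀ t ∈ I, Disjoint (closure (B 0 t)) (closure (B 1 t))
  velocity_contDiffOn : ∀ j, ContDiffOn ℝ 1 (fun q : ℝ × Space3 => v q.1 q.2)
    {q | q.1 ∈ I ∧ q.2 ∈ closure (B j q.1)}
  pressure_continuousOn : ∀ j, ∀ t ∈ I, ContinuousOn (p t) (closure (B j t))
  pressure_differentiableAt : ∀ j, ∀ t ∈ I, ∀ x ∈ B j t, DifferentiableAt ℝ (p t) x
  momentum : ∀ j, ∀ t ∈ I, ∀ x ∈ B j t,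
    derivWithin (fun s => v s x) I t + fderiv ℝ (v t) x (v t x) =
      -gradient (p t) x
        - gradient (fun z => newtonPotential G ρ (B 0 t) z + newtonPotential G ρ (B 1 t) z) x
  incompressible : ∀ j, ∀ t ∈ I, ∀ x ∈ B j t, divergence3 (v t) x = 0
  irrotational : ∀ j, ∀ t ∈ I, ∀ x ∈ B j t, curl3 (v t) x = 0
  pressure_boundary : ∀ j, ∀ t ∈ I, ∀ x ∈ frontier (B j t), p t x = 0
  kinematic : ∀ j, ∃ X, IsLagrangianFlow I T₀ (B j) v X

/-- `r₀` is the distance of first closest approach of the radius `r` on the time interval `I`: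
the infimum of the numbers `r'` such that, for each `T`, if `r ≥ r'` up to time `T`, then
`r` has negative derivative up to time `T`. If the derivative of `r` stays negative on all of `I`
then the set is not bounded below and no `r₀` exists. -/
def IsFirstClosestApproach (I : Set ℝ) (r : ℝ → ℝ) (r₀ : ℝ) : Prop :=
  IsGLB {r' : ℝ | ∀ T ∈ I, (∀ t ∈ I, t ≤ T → r' ≤ r t) →
    ∀ t ∈ I, t ≤ T → derivWithin r I t < 0} r₀

/-- The two-sided bound `a / C ≤ x ≤ C a`. -/
def ComparableWith (C x a : ℝ) : Prop :=
  a / C ≤ x ∧ x ≤ C * a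

open MeasureTheory Metric Filter Topology

/-! The center of mass of the first body moves almost like a Kepler particle. Averaging the momentum
equation over the body removes two terms: the pressure gradient integrates to zero because the
pressure vanishes on the boundary (`setIntegral_gradient_eq_zero`), and the self-attraction cancels
because the kernel is odd (`integral_integral_newtonKernel_self`). Incompressibility makes the flow
volume preserving (`det_fderiv_flow`), so integrals over the moving body become integrals over the
initial ball and can be differentiated in time. What remains is the pull of the mirror image, which
is that of a point mass at `-x₁` up to a relative error of order `R / r₁`
(`norm_integral_newtonKernel_sub_le`).

In units of length `ℓ = c₀² R β^(2/7)` and of speed `√(GM / ℓ)` the initial angular momentum is 1.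
For the unperturbed motion with energy `w`, the squared radial velocity at distance `s` is `w +
1/(2s) - 1/s²`. As `w` is small, the motion is inward until `s` is close to 2, which locates `r₀`
between `3ℓ/2` and `5ℓ/2`. The regimes of the theorem correspond to the dominant term: `w` beyond
`GM / v₀²`, then `1/(2s)`, and finally the simple zero at the turning point, which produces the
square root.

The perturbation is handled by a continuity argument (`IsPerturbedKeplerMotion.isClose`): as long as
energy and angular momentum are within `1/40` of their initial values, suitably weighted,
`IsPerturbedKeplerMotion.estimate` improves this to a strict inequality. For `s ≥ 3` the radial
velocity is bounded away from zero, so the distance serves as a clock and the perturbation is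
integrable in it. For `s ≤ 3` the radial velocity may vanish, but the centrifugal force exceeds the
attraction; the radial velocity then increases at a definite rate and becomes the clock. -/

/-! ### The Newtonian kernel and its integrals over bounded sets -/

/-- The Newtonian force kernel `z / |z|³`. -/
noncomputable def newtonKernel (z : Space3) : Space3 := (‖z‖ ^ 3)⁻¹ • z

lemma norm_newtonKernel (z : Space3) : ‖newtonKernel z‖ = (‖z‖ ^ 2)⁻¹ := by
  rcases eq_or_ne z 0 with rfl | hz
  · simp [newtonKernel]
  · have : ‖z‖ ≠ 0 := norm_ne_zero_iff.2 hz
    rw [newtonKernel, norm_smul, norm_inv, norm_pow, norm_norm]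
    field_simp

lemma newtonKernel_neg (z : Space3) : newtonKernel (-z) = -newtonKernel z := by
  simp [newtonKernel]

lemma measurable_newtonKernel : Measurable newtonKernel := by
  unfold newtonKernel
  fun_prop

/-- The segment from `w` to `z` may pass through the origin, so the mean value inequality is not
available. The difference is split into a change of the vector and a change of the scalar factor,
which contribute 1 and 3 to the constant. -/
lemma norm_newtonKernel_sub_le {z w : Space3} {r : ℝ} (hr : 0 < r) (hz : r ≤ ‖z‖) (hw : r ≤ ‖w‖) :
    ‖newtonKernel z - newtonKernel w‖ ≤ 4 / r ^ 3 * ‖z - w‖ := by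
  have hz0 : 0 < ‖z‖ := hr.trans_le hz
  have hw0 : 0 < ‖w‖ := hr.trans_le hw
  have e : newtonKernel z - newtonKernel w
      = (‖z‖ ^ 3)⁻¹ • (z - w) + ((‖z‖ ^ 3)⁻¹ - (‖w‖ ^ 3)⁻¹) • w := by
    simp only [newtonKernel, smul_sub, sub_smul]; abel
  have h1 : (‖z‖ ^ 3)⁻¹ ≤ (r ^ 3)⁻¹ := by gcongr
  have h2 : |(‖z‖ ^ 3)⁻¹ - (‖w‖ ^ 3)⁻¹| * ‖w‖ ≤ 3 / r ^ 3 * ‖z - w‖ := by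
    have e2 : (‖z‖ ^ 3)⁻¹ - (‖w‖ ^ 3)⁻¹ =
        (‖w‖ - ‖z‖) * ((‖w‖ ^ 2 + ‖w‖ * ‖z‖ + ‖z‖ ^ 2) / (‖z‖ ^ 3 * ‖w‖ ^ 3)) := by
      field_simp; ring
    have h3 : (‖w‖ ^ 2 + ‖w‖ * ‖z‖ + ‖z‖ ^ 2) / (‖z‖ ^ 3 * ‖w‖ ^ 3) * ‖w‖ ≤ 3 / r ^ 3 := by
      have e3 : (‖w‖ ^ 2 + ‖w‖ * ‖z‖ + ‖z‖ ^ 2) / (‖z‖ ^ 3 * ‖w‖ ^ 3) * ‖w‖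
          = (‖z‖ ^ 3)⁻¹ + (‖z‖ ^ 2 * ‖w‖)⁻¹ + (‖z‖ * ‖w‖ ^ 2)⁻¹ := by
        field_simp
      have h4 : (‖z‖ ^ 2 * ‖w‖)⁻¹ ≤ (r ^ 2 * r)⁻¹ := by gcongr
      have h5 : (‖z‖ * ‖w‖ ^ 2)⁻¹ ≤ (r * r ^ 2)⁻¹ := by gcongr
      rw [e3]
      have : (3 : ℝ) / r ^ 3 = (r ^ 3)⁻¹ + (r ^ 2 * r)⁻¹ + (r * r ^ 2)⁻¹ := by
        field_simp; norm_num
      linarith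
    have h6 : |‖w‖ - ‖z‖| ≤ ‖z - w‖ := by
      rw [abs_sub_comm]; exact abs_norm_sub_norm_le z w
    rw [e2, abs_mul, abs_of_nonneg (a := _ / _) (by positivity), mul_assoc, mul_comm]
    gcongr
  rw [e]
  refine (norm_add_le _ _).trans ?_
  rw [norm_smul, norm_smul, Real.norm_eq_abs, Real.norm_eq_abs, abs_of_nonneg (by positivity)]
  have : 4 / r ^ 3 * ‖z - w‖ = (r ^ 3)⁻¹ * ‖z - w‖ + 3 / r ^ 3 * ‖z - w‖ := by
    field_simp; ring
  rw [this]
  gcongr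

/-- The area of the unit sphere. -/
noncomputable def sphereArea : ℝ := 3 * volume.real (ball (0 : Space3) 1)

lemma sphereArea_nonneg : 0 ≤ sphereArea := by unfold sphereArea; positivity

lemma indicator_inv_norm_sq (δ : ℝ) : (fun z : Space3 => (Iio δ).indicator (fun s : ℝ => (s ^ 2)⁻¹) ‖z‖)
    = (ball (0 : Space3) δ).indicator fun z => (‖z‖ ^ 2)⁻¹ := by
  ext z
  simp [indicator]

/-- The weight of polar coordinates in dimension three cancels the singularity exactly.
Integrability and the linear growth in `δ` of the integral over a ball both come from this. -/
lemma eqOn_sq_mul_indicator (δ : ℝ) : EqOn (fun y : ℝ => y ^ (Module.finrank ℝ Space3 - 1) •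
    (Iio δ).indicator (fun s : ℝ => (s ^ 2)⁻¹) y) ((Iio δ).indicator fun _ => (1 : ℝ)) (Ioi 0) := by
  intro y hy
  have : y ≠ 0 := ne_of_gt hy
  by_cases h : y < δ
  · simp [h, this]
  · simp [h]

lemma integrableOn_inv_norm_sq_ball (δ : ℝ) :
    IntegrableOn (fun z : Space3 => (‖z‖ ^ 2)⁻¹) (ball 0 δ) := by
  rw [← integrable_indicator_iff measurableSet_ball, ← indicator_inv_norm_sq,
    integrable_fun_norm_addHaar, integrableOn_congr_fun (eqOn_sq_mul_indicator δ) measurableSet_Ioi,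
    IntegrableOn, integrable_indicator_iff measurableSet_Iio]
  rw [integrableOn_const_iff]
  right
  rw [Measure.restrict_apply measurableSet_Iio, inter_comm, Ioi_inter_Iio]
  simp

lemma integral_inv_norm_sq_ball {δ : ℝ} (hδ : 0 ≤ δ) :
    ∫ z in ball (0 : Space3) δ, (‖z‖ ^ 2)⁻¹ = sphereArea * δ := by
  rw [← integral_indicator measurableSet_ball, ← indicator_inv_norm_sq,
    integral_fun_norm_addHaar, setIntegral_congr_fun measurableSet_Ioi (eqOn_sq_mul_indicator δ),
    integral_indicator measurableSet_Iio, Measure.restrict_restrict measurableSet_Iio, inter_comm,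
    Ioi_inter_Iio]
  simp [sphereArea, hδ, mul_assoc]

lemma integrableOn_inv_norm_sub_sq_ball (x : Space3) (δ : ℝ) :
    IntegrableOn (fun y : Space3 => (‖x - y‖ ^ 2)⁻¹) (ball x δ) := by
  have := integrableOn_inv_norm_sq_ball δ
  rw [← integrable_indicator_iff measurableSet_ball] at this ⊢
  refine (this.comp_sub_left x).congr (Eventually.of_forall fun y => ?_)
  simp [indicator, dist_eq_norm, norm_sub_rev]

lemma integral_inv_norm_sub_sq_ball (x : Space3) {δ : ℝ} (hδ : 0 ≤ δ) :
    ∫ y in ball x δ, (‖x - y‖ ^ 2)⁻¹ = sphereArea * δ := by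
  rw [← integral_inv_norm_sq_ball hδ, ← integral_indicator measurableSet_ball,
    ← integral_indicator measurableSet_ball, ← integral_sub_left_eq_self _ _ x]
  congr 1
  ext y
  simp [indicator]

lemma exists_subset_ball {Ω : Set Space3} (hb : Bornology.IsBounded Ω) (x : Space3) :
    ∃ δ, 0 < δ ∧ Ω ⊆ ball x δ := by
  obtain ⟨r, hr⟩ := hb.subset_ball x
  exact ⟨max r 1, by positivity, hr.trans (ball_subset_ball (le_max_left _ _))⟩

lemma integrableOn_inv_norm_sub_sq {Ω : Set Space3} (hb : Bornology.IsBounded Ω) (x : Space3) :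
    IntegrableOn (fun y : Space3 => (‖x - y‖ ^ 2)⁻¹) Ω := by
  obtain ⟨δ, -, h⟩ := exists_subset_ball hb x
  exact (integrableOn_inv_norm_sub_sq_ball x δ).mono_set h

lemma setIntegral_inv_norm_sub_sq_le {Ω : Set Space3} {x : Space3} {δ : ℝ} (hδ : 0 ≤ δ)
    (h : Ω ⊆ ball x δ) : ∫ y in Ω, (‖x - y‖ ^ 2)⁻¹ ≤ sphereArea * δ := by
  rw [← integral_inv_norm_sub_sq_ball x hδ]
  refine setIntegral_mono_set (integrableOn_inv_norm_sub_sq_ball x δ) ?_ h.eventuallyLE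
  exact Eventually.of_forall fun y => by positivity

lemma integrableOn_newtonKernel_sub {Ω : Set Space3} (hb : Bornology.IsBounded Ω) (x : Space3) :
    IntegrableOn (fun y : Space3 => newtonKernel (x - y)) Ω := by
  refine (integrableOn_inv_norm_sub_sq hb x).mono' ?_ (Eventually.of_forall fun y => ?_)
  · exact (measurable_newtonKernel.comp (measurable_const.sub measurable_id)).aestronglyMeasurable
  · rw [norm_newtonKernel]

lemma inv_le_one_add_inv_sq (s : ℝ) : s⁻¹ ≤ 1 + (s ^ 2)⁻¹ := by
  have : (s ^ 2)⁻¹ = s⁻¹ ^ 2 := by simp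
  rw [this]
  nlinarith [sq_nonneg (s⁻¹ - 1)]

lemma integrableOn_inv_norm_sub {Ω : Set Space3} (hb : Bornology.IsBounded Ω) (x : Space3) :
    IntegrableOn (fun y : Space3 => ‖x - y‖⁻¹) Ω := by
  have h1 : IntegrableOn (fun _ : Space3 => (1 : ℝ)) Ω :=
    integrableOn_const hb.measure_lt_top.ne
  refine (h1.add (integrableOn_inv_norm_sub_sq hb x)).mono' ?_ (Eventually.of_forall fun y => ?_)
  · exact Measurable.aestronglyMeasurable (by fun_prop)
  · rw [norm_inv, norm_norm]
    exact inv_le_one_add_inv_sq _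

/-! ### The gradient of the Newtonian potential -/

/-- The product of the two inverses is replaced by a sum of squares, so that the two singularities
can be integrated separately. The convention `0⁻¹ = 0` keeps the bound true at zero vectors. -/
lemma abs_inv_norm_sub_inv_norm_le (a b : Space3) :
    |‖b‖⁻¹ - ‖a‖⁻¹| ≤ ‖b - a‖ * ((‖a‖ ^ 2)⁻¹ + (‖b‖ ^ 2)⁻¹) := by
  have key : ∀ c : Space3, ‖c‖⁻¹ = ‖c‖ * (‖c‖ ^ 2)⁻¹ := by
    intro c
    rcases eq_or_ne c 0 with rfl | hc
    · simp
    · have : ‖c‖ ≠ 0 := norm_ne_zero_iff.2 hc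
      field_simp
  rcases eq_or_ne a 0 with rfl | ha
  · simp [← key]
  rcases eq_or_ne b 0 with rfl | hb
  · simp [← key]
  have ha0 : 0 < ‖a‖ := norm_pos_iff.2 ha
  have hb0 : 0 < ‖b‖ := norm_pos_iff.2 hb
  have e : ‖b‖⁻¹ - ‖a‖⁻¹ = (‖a‖ - ‖b‖) * (‖a‖⁻¹ * ‖b‖⁻¹) := by field_simp
  rw [e, abs_mul, abs_of_nonneg (a := _ * _) (by positivity)]
  have h1 : |‖a‖ - ‖b‖| ≤ ‖b - a‖ := by rw [norm_sub_rev]; exact abs_norm_sub_norm_le a b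
  gcongr
  rw [← inv_pow, ← inv_pow]
  nlinarith [sq_nonneg (‖a‖⁻¹ - ‖b‖⁻¹), sq_nonneg (‖a‖⁻¹), sq_nonneg (‖b‖⁻¹)]

lemma hasFDerivAt_inv_norm {z : Space3} (hz : z ≠ 0) :
    HasFDerivAt (fun z : Space3 => ‖z‖⁻¹) (-innerSL ℝ (newtonKernel z)) z := by
  have h0 : ‖z‖ ≠ 0 := norm_ne_zero_iff.2 hz
  have h1 : HasFDerivAt (fun z : Space3 => ‖z‖ ^ 2) (2 • innerSL ℝ z) z := by
    simpa using (hasStrictFDerivAt_norm_sq z).hasFDerivAt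
  have h2 := (hasDerivAt_inv (x := √(‖z‖ ^ 2)) (by positivity)).comp_hasFDerivAt z
    (h1.sqrt (by positivity))
  simp only [Function.comp_def, Real.sqrt_sq (norm_nonneg _)] at h2
  refine h2.congr_fderiv ?_
  ext w
  simp [newtonKernel]
  field_simp

theorem hasFDerivAt_integral_inv_norm_sub_of_far {Ω : Set Space3} (hm : MeasurableSet Ω)
    (hb : Bornology.IsBounded Ω) {x : Space3} {δ : ℝ} (hδ : 0 < δ) (hfar : ∀ y ∈ Ω, δ ≤ ‖x - y‖) :
    HasFDerivAt (fun z => ∫ y in Ω, ‖z - y‖⁻¹)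
      (-innerSL ℝ (∫ y in Ω, newtonKernel (x - y))) x := by
  have hfin : volume Ω ≠ ⊤ := hb.measure_lt_top.ne
  have key := hasFDerivAt_integral_of_dominated_of_fderiv_le (μ := volume.restrict Ω) (𝕜 := ℝ)
    (F := fun z y => ‖z - y‖⁻¹) (F' := fun z y => -innerSL ℝ (newtonKernel (z - y)))
    (bound := fun _ => ((δ / 2) ^ 2)⁻¹) (x₀ := x) (s := ball x (δ / 2))
    (ball_mem_nhds _ (by positivity)) ?_ ?_ ?_ ?_ ?_ ?_
  · refine key.congr_fderiv ?_
    rw [integral_neg, (innerSL ℝ (E := Space3)).integral_comp_comm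
      (integrableOn_newtonKernel_sub hb x)]
  · exact Eventually.of_forall fun z => (integrableOn_inv_norm_sub hb z).aestronglyMeasurable
  · exact integrableOn_inv_norm_sub hb x
  · exact ((innerSL ℝ (E := Space3)).continuous.comp_aestronglyMeasurable
      (integrableOn_newtonKernel_sub hb x).aestronglyMeasurable).neg
  · refine (ae_restrict_iff' hm).2 (Eventually.of_forall fun y hy z hz => ?_)
    rw [norm_neg, innerSL_apply_norm, norm_newtonKernel]
    have := hfar y hy
    rw [mem_ball, dist_eq_norm] at hz
    have : δ / 2 ≤ ‖z - y‖ := by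
      have := norm_sub_norm_le (x - y) (x - z)
      rw [norm_sub_rev x z, sub_sub_sub_cancel_left] at this
      linarith
    gcongr
  · exact integrableOn_const hfin
  · refine (ae_restrict_iff' hm).2 (Eventually.of_forall fun y hy z hz => ?_)
    rw [mem_ball, dist_eq_norm] at hz
    have hne : z - y ≠ 0 := by
      intro h
      have := hfar y hy
      rw [sub_eq_zero] at h
      rw [← h, norm_sub_rev] at this
      linarith
    have := (hasFDerivAt_inv_norm hne).comp z ((hasFDerivAt_id z).sub_const y)
    simpa [Function.comp_def] using this

/-- When `x` lies in the body, no integrable function dominates the kernel for all nearby `z`. The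
part of the body within `δ` of `x` is therefore estimated directly: its difference quotients and its
candidate derivative are both `O(δ)`. The rest is differentiated under the integral. -/
theorem hasFDerivAt_integral_inv_norm_sub {Ω : Set Space3} (hm : MeasurableSet Ω)
    (hb : Bornology.IsBounded Ω) (x : Space3) :
    HasFDerivAt (fun z => ∫ y in Ω, ‖z - y‖⁻¹)
      (-innerSL ℝ (∫ y in Ω, newtonKernel (x - y))) x := by
  rw [hasFDerivAt_iff_isLittleO, Asymptotics.isLittleO_iff]
  intro ε hε
  -- The near part will cost `4 * sphereArea * δ`, which this choice makes at most `ε / 2`; the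
  -- added 1 avoids having to know that `sphereArea` is nonzero.
  set δ : ℝ := ε / (2 * (4 * (sphereArea + 1))) with hδdef
  have hA := sphereArea_nonneg
  have hδ : 0 < δ := by positivity
  have hδε : 4 * sphereArea * δ ≤ ε / 2 := by
    rw [hδdef, ← sub_nonneg]
    have : ε / 2 - 4 * sphereArea * (ε / (2 * (4 * (sphereArea + 1)))) =
      ε / 2 / (sphereArea + 1) := by field_simp; ring
    rw [this]; positivity
  set N := Ω ∩ ball x δ
  set F := Ω \ ball x δ
  have hN : N ⊆ ball x δ := inter_subset_right
  have hNm : MeasurableSet N := hm.inter measurableSet_ball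
  have hFm : MeasurableSet F := hm.diff measurableSet_ball
  have hNb : Bornology.IsBounded N := hb.subset inter_subset_left
  have hFb : Bornology.IsBounded F := hb.subset sdiff_subset
  have hdisj : Disjoint N F := disjoint_sdiff_inter.symm
  have hunion : N ∪ F = Ω := inter_union_sdiff _ _
  have far := hasFDerivAt_integral_inv_norm_sub_of_far hFm hFb (x := x) hδ (by
    intro y hy
    have := hy.2
    rw [mem_ball, dist_eq_norm, norm_sub_rev] at this
    exact not_lt.1 this)
  rw [hasFDerivAt_iff_isLittleO, Asymptotics.isLittleO_iff] at far
  filter_upwards [far (half_pos hε), ball_mem_nhds x hδ] with z hz hzx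
  have split1 : ∀ a : Space3, ∫ y in Ω, ‖a - y‖⁻¹ = (∫ y in N, ‖a - y‖⁻¹) + ∫ y in F, ‖a - y‖⁻¹ := by
    intro a
    rw [← hunion]
    exact setIntegral_union hdisj hFm (integrableOn_inv_norm_sub hNb a)
      (integrableOn_inv_norm_sub hFb a)
  have split2 : ∫ y in Ω, newtonKernel (x - y)
      = (∫ y in N, newtonKernel (x - y)) + ∫ y in F, newtonKernel (x - y) := by
    rw [← hunion]
    exact setIntegral_union hdisj hFm (integrableOn_newtonKernel_sub hNb x)
      (integrableOn_newtonKernel_sub hFb x)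
  have near : ‖(∫ y in N, ‖z - y‖⁻¹) - (∫ y in N, ‖x - y‖⁻¹)
      + inner ℝ (∫ y in N, newtonKernel (x - y)) (z - x)‖ ≤ ε / 2 * ‖z - x‖ := by
    have i1 : IntegrableOn (fun y => inner ℝ (newtonKernel (x - y)) (z - x)) N := by
      exact ((innerSL ℝ).flip (z - x)).integrable_comp (integrableOn_newtonKernel_sub hNb x)
    have e1 : inner ℝ (∫ y in N, newtonKernel (x - y)) (z - x)
        = ∫ y in N, inner ℝ (newtonKernel (x - y)) (z - x) := by
      exact (((innerSL ℝ).flip (z - x)).integral_comp_comm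
        (integrableOn_newtonKernel_sub hNb x)).symm
    have j1 := integrableOn_inv_norm_sub_sq hNb x
    have j2 := integrableOn_inv_norm_sub_sq hNb z
    have i0 : IntegrableOn (fun y => ‖z - y‖⁻¹ - ‖x - y‖⁻¹) N :=
      (integrableOn_inv_norm_sub hNb z).sub (integrableOn_inv_norm_sub hNb x)
    rw [e1, ← integral_sub (integrableOn_inv_norm_sub hNb z) (integrableOn_inv_norm_sub hNb x),
      ← integral_add i0 i1]
    have b : ‖∫ y in N, (‖z - y‖⁻¹ - ‖x - y‖⁻¹ + inner ℝ (newtonKernel (x - y)) (z - x))‖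
        ≤ ∫ y in N, ‖z - x‖ * (2 * (‖x - y‖ ^ 2)⁻¹ + (‖z - y‖ ^ 2)⁻¹) := by
      refine norm_integral_le_of_norm_le (((j1.const_mul 2).add j2).const_mul _)
        (Eventually.of_forall fun y => ?_)
      refine (norm_add_le _ _).trans ?_
      have b1 := abs_inv_norm_sub_inv_norm_le (x - y) (z - y)
      have b2 := norm_inner_le_norm (𝕜 := ℝ) (newtonKernel (x - y)) (z - x)
      rw [sub_sub_sub_cancel_right] at b1
      rw [norm_newtonKernel] at b2
      rw [← Real.norm_eq_abs] at b1
      linarith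
    refine b.trans ?_
    rw [integral_const_mul, integral_add (j1.const_mul 2) j2, integral_const_mul]
    have c1 := setIntegral_inv_norm_sub_sq_le hδ.le hN
    -- Since `z` is within `δ` of `x`, the near part also lies within `2δ` of `z`.
    have c2 : ∫ y in N, (‖z - y‖ ^ 2)⁻¹ ≤ sphereArea * (2 * δ) := by
      refine setIntegral_inv_norm_sub_sq_le (by positivity) (hN.trans (ball_subset_ball' ?_))
      rw [mem_ball, dist_comm] at hzx
      linarith
    rw [mul_comm]
    gcongr
    linarith
  rw [split1, split1, split2]
  have e : (∫ y in N, ‖z - y‖⁻¹) + (∫ y in F, ‖z - y‖⁻¹)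
      - ((∫ y in N, ‖x - y‖⁻¹) + ∫ y in F, ‖x - y‖⁻¹)
      - (-innerSL ℝ ((∫ y in N, newtonKernel (x - y)) + ∫ y in F, newtonKernel (x - y))) (z - x)
      = ((∫ y in N, ‖z - y‖⁻¹) - (∫ y in N, ‖x - y‖⁻¹)
        + inner ℝ (∫ y in N, newtonKernel (x - y)) (z - x))
      + ((∫ y in F, ‖z - y‖⁻¹) - (∫ y in F, ‖x - y‖⁻¹)
        - (-innerSL ℝ (∫ y in F, newtonKernel (x - y))) (z - x)) := by
    simp only [neg_apply, innerSL_apply_apply, inner_add_left]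
    ring
  rw [e]
  refine (norm_add_le _ _).trans ?_
  linarith

/-- The gradient of the Newtonian potential of a bounded body. -/
theorem hasGradientAt_newtonPotential {Ω : Set Space3} (hm : MeasurableSet Ω)
    (hb : Bornology.IsBounded Ω) (G ρ : ℝ) (x : Space3) :
    HasGradientAt (newtonPotential G ρ Ω) ((G * ρ) • ∫ y in Ω, newtonKernel (x - y)) x := by
  rw [hasGradientAt_iff_hasFDerivAt]
  have := (hasFDerivAt_integral_inv_norm_sub hm hb x).const_mul (-(G * ρ))
  unfold newtonPotential
  refine this.congr_fderiv ?_
  ext w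
  simp

/-! ### Forces between bodies -/

lemma norm_integral_newtonKernel_le {Ω : Set Space3} {x : Space3} {δ : ℝ} (hδ : 0 ≤ δ)
    (h : Ω ⊆ ball x δ) : ‖∫ y in Ω, newtonKernel (x - y)‖ ≤ sphereArea * δ := by
  refine (norm_integral_le_integral_norm _).trans ?_
  simp only [norm_newtonKernel]
  exact setIntegral_inv_norm_sub_sq_le hδ h

lemma stronglyMeasurable_integral_newtonKernel (Ω : Set Space3) :
    StronglyMeasurable fun x => ∫ y in Ω, newtonKernel (x - y) := by
  refine StronglyMeasurable.integral_prod_right (f := fun x y => newtonKernel (x - y)) ?_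
  exact (measurable_newtonKernel.comp (measurable_fst.sub measurable_snd)).stronglyMeasurable

lemma exists_norm_integral_newtonKernel_le {Ω Ω' : Set Space3} (hb : Bornology.IsBounded Ω)
    (hb' : Bornology.IsBounded Ω') : ∃ C, ∀ x ∈ Ω', ‖∫ y in Ω, newtonKernel (x - y)‖ ≤ C := by
  obtain ⟨δ, hδ, h⟩ := exists_subset_ball hb 0
  obtain ⟨δ', hδ', h'⟩ := exists_subset_ball hb' 0
  refine ⟨sphereArea * (δ + δ'), fun x hx => norm_integral_newtonKernel_le (by positivity) ?_⟩
  have := h' hx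
  rw [mem_ball, dist_comm] at this
  exact h.trans (ball_subset_ball' (by linarith))

lemma integrableOn_integral_newtonKernel {Ω Ω' : Set Space3} (hb : Bornology.IsBounded Ω)
    (hm' : MeasurableSet Ω') (hb' : Bornology.IsBounded Ω') :
    IntegrableOn (fun x => ∫ y in Ω, newtonKernel (x - y)) Ω' := by
  obtain ⟨C, hC⟩ := exists_norm_integral_newtonKernel_le hb hb'
  exact Measure.integrableOn_of_bounded hb'.measure_lt_top.ne
    (stronglyMeasurable_integral_newtonKernel Ω).aestronglyMeasurable
    ((ae_restrict_iff' hm').2 (Eventually.of_forall hC))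

/-- A body exerts no net force on itself. -/
theorem integral_integral_newtonKernel_self {Ω : Set Space3} (hm : MeasurableSet Ω)
    (hb : Bornology.IsBounded Ω) : ∫ x in Ω, ∫ y in Ω, newtonKernel (x - y) = 0 := by
  have hsm : StronglyMeasurable (Function.uncurry fun x y : Space3 => newtonKernel (x - y)) :=
    (measurable_newtonKernel.comp (measurable_fst.sub measurable_snd)).stronglyMeasurable
  have hint : Integrable (Function.uncurry fun x y : Space3 => newtonKernel (x - y))
      ((volume.restrict Ω).prod (volume.restrict Ω)) := by
    rw [integrable_prod_iff hsm.aestronglyMeasurable]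
    refine ⟨Eventually.of_forall fun x => integrableOn_newtonKernel_sub hb x, ?_⟩
    obtain ⟨δ, hδ, h⟩ := exists_subset_ball hb 0
    refine Measure.integrableOn_of_bounded (M := sphereArea * (δ + δ)) hb.measure_lt_top.ne ?_
      ((ae_restrict_iff' hm).2 (Eventually.of_forall fun x hx => ?_))
    · exact (StronglyMeasurable.integral_prod_right
        (f := fun x y => ‖newtonKernel (x - y)‖) hsm.norm).aestronglyMeasurable
    · have := h hx
      rw [mem_ball, dist_comm] at this
      simp only [Function.uncurry_apply_pair, norm_newtonKernel]
      rw [Real.norm_of_nonneg (integral_nonneg fun y => by positivity)]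
      exact setIntegral_inv_norm_sub_sq_le (by positivity)
        (h.trans (ball_subset_ball' (by linarith)))
  have h := integral_integral_swap hint
  have e : ∫ y in Ω, ∫ x in Ω, newtonKernel (x - y)
      = -∫ y in Ω, ∫ x in Ω, newtonKernel (y - x) := by
    rw [← integral_neg]
    congr 1
    ext1 y
    rw [← integral_neg]
    congr 1
    ext1 x
    rw [← newtonKernel_neg, neg_sub]
  rw [e] at h
  rw [eq_neg_iff_add_eq_zero, ← two_smul ℝ] at h
  exact (smul_eq_zero.1 h).resolve_left two_ne_zero

/-! ### Differentiation of integrals with respect to time -/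

/-- Differentiation under the integral sign, within a set of times. -/
theorem hasDerivWithinAt_setIntegral {α E : Type*} [MeasurableSpace α] {μ : Measure α}
    [NormedAddCommGroup E] [NormedSpace ℝ E] {S : Set α} (hS : MeasurableSet S) (hμ : μ S ≠ ⊤)
    {J : Set ℝ} (hJ : Convex ℝ J) {t : ℝ} (ht : t ∈ J) {f f' : ℝ → α → E}
    (hint : ∀ s ∈ J, IntegrableOn (f s) S μ)
    (hderiv : ∀ y ∈ S, ∀ s ∈ J, HasDerivWithinAt (fun s => f s y) (f' s y) J s)
    {C : ℝ} (hC : ∀ y ∈ S, ∀ s ∈ J, ‖f' s y‖ ≤ C) :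
    HasDerivWithinAt (fun s => ∫ y in S, f s y ∂μ) (∫ y in S, f' t y ∂μ) J t := by
  rw [hasDerivWithinAt_iff_tendsto_slope]
  have hmem : ∀ᶠ s in 𝓝[J \ {t}] t, s ∈ J := by
    filter_upwards [self_mem_nhdsWithin] with s hs using hs.1
  have e : ∀ᶠ s in 𝓝[J \ {t}] t, ∫ y in S, slope (fun s => f s y) t s ∂μ
      = slope (fun s => ∫ y in S, f s y ∂μ) t s := by
    filter_upwards [hmem] with s hs
    simp only [slope, vsub_eq_sub]
    rw [integral_smul, integral_sub (hint s hs) (hint t ht)]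
  refine Tendsto.congr' e ?_
  -- The mean value inequality on `J` bounds every slope by `C`; this also covers one-sided
  -- derivatives at the ends of the time interval.
  refine tendsto_integral_filter_of_dominated_convergence (fun _ => C) ?_ ?_
    (integrableOn_const hμ) ?_
  · filter_upwards [hmem] with s hs
    simp only [slope, vsub_eq_sub]
    exact (((hint s hs).sub (hint t ht)).smul _).aestronglyMeasurable
  · filter_upwards [self_mem_nhdsWithin] with s hs
    refine (ae_restrict_iff' hS).2 (Eventually.of_forall fun y hy => ?_)
    have := hJ.norm_image_sub_le_of_norm_hasDerivWithin_le (hderiv y hy) (hC y hy) ht hs.1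
    have hne : 0 < ‖s - t‖ := norm_pos_iff.2 (sub_ne_zero.2 hs.2)
    rw [slope, vsub_eq_sub, norm_smul, norm_inv, inv_mul_le_iff₀ hne, mul_comm]
    exact this
  · refine (ae_restrict_iff' hS).2 (Eventually.of_forall fun y hy => ?_)
    exact hasDerivWithinAt_iff_tendsto_slope.1 (hderiv y hy t ht)

/-- `I` need not be compact. Near `t` it can be replaced by a compact interval starting at `T₀`, on
which continuous integrands are bounded. -/
lemma exists_Icc_mem_nhdsWithin {I : Set ℝ} {T₀ : ℝ} (hI : IsLeast I T₀) (t : ℝ) (ht : t ∈ I) :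
    ∃ T ∈ I, t ≤ T ∧ Icc T₀ T ∈ 𝓝[I] t := by
  by_cases h : ∃ T ∈ I, t < T
  · obtain ⟨T, hT, htT⟩ := h
    refine ⟨T, hT, htT.le, ?_⟩
    filter_upwards [self_mem_nhdsWithin, mem_nhdsWithin_of_mem_nhds (Iio_mem_nhds htT)] with s hs hs'
    exact ⟨hI.2 hs, le_of_lt hs'⟩
  · push Not at h
    refine ⟨t, ht, le_rfl, ?_⟩
    filter_upwards [self_mem_nhdsWithin] with s hs
    exact ⟨hI.2 hs, h s hs⟩

lemma Set.OrdConnected.uniqueDiffOn_of_nontrivial {I : Set ℝ} (h : I.OrdConnected)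
    (hn : I.Nontrivial) : UniqueDiffOn ℝ I := by
  obtain ⟨a, ha, b, hb, hab⟩ := hn.exists_lt
  refine uniqueDiffOn_convex h.convex ⟨(a + b) / 2, ?_⟩
  refine interior_mono (h.out ha hb) ?_
  rw [interior_Icc]
  constructor <;> linarith

theorem hasDerivWithinAt_setIntegral_ball {I : Set ℝ} (hI : I.OrdConnected) {T₀ : ℝ}
    (hT : IsLeast I T₀) {c : Space3} {R : ℝ} {f f' : ℝ → Space3 → Space3}
    (hf : ∀ t ∈ I, ContinuousOn (f t) (closedBall c R))
    (hf' : ContinuousOn (fun q : ℝ × Space3 => f' q.1 q.2) (I ×ˢ closedBall c R))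
    (hderiv : ∀ t ∈ I, ∀ y ∈ closedBall c R, HasDerivWithinAt (fun s => f s y) (f' t y) I t)
    {t : ℝ} (ht : t ∈ I) :
    HasDerivWithinAt (fun s => ∫ y in ball c R, f s y) (∫ y in ball c R, f' t y) I t := by
  obtain ⟨T, hTI, htT, hnhds⟩ := exists_Icc_mem_nhdsWithin hT t ht
  have hsub : Icc T₀ T ⊆ I := hI.out hT.1 hTI
  obtain ⟨C, hC⟩ := (isCompact_Icc.prod (isCompact_closedBall c R)).exists_bound_of_continuousOn
    (hf'.mono (prod_mono hsub Subset.rfl))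
  refine HasDerivWithinAt.mono_of_mem_nhdsWithin (t := Icc T₀ T) ?_ hnhds
  refine hasDerivWithinAt_setIntegral measurableSet_ball measure_ball_lt_top.ne (convex_Icc _ _)
    ⟨hT.2 ht, htT⟩ (fun s hs => ?_) (fun y hy s hs => ?_) (C := C) (fun y hy s hs => ?_)
  · exact ((hf s (hsub hs)).integrableOn_compact (isCompact_closedBall c R)).mono_set
      ball_subset_closedBall
  · exact (hderiv s (hsub hs) y (ball_subset_closedBall hy)).mono hsub
  · exact hC (s, y) ⟨hs, ball_subset_closedBall hy⟩

/-! ### Volume preservation by the flow -/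

section Jacobian

lemma det_eq_det_matrix (L : Space3 →L[ℝ] Space3) :
    L.det = Matrix.det (Matrix.of fun i j => L (EuclideanSpace.single j 1) i) := by
  rw [ContinuousLinearMap.det, ← LinearMap.det_toMatrix (EuclideanSpace.basisFun (Fin 3) ℝ).toBasis]
  congr 1

/-- Liouville's formula, for a traceless generator. -/
lemma hasDerivAt_det_zero {A : ℝ → Space3 →L[ℝ] Space3} {N : Space3 →L[ℝ] Space3} {t : ℝ}
    (hA : HasDerivAt A (N.comp (A t)) t)
    (hN : ∑ i, (N (EuclideanSpace.single i 1)) i = 0) :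
    HasDerivAt (fun s => (A s).det) 0 t := by
  have hentry : ∀ i j : Fin 3, HasDerivAt (fun s => A s (EuclideanSpace.single j 1) i)
      (N (A t (EuclideanSpace.single j 1)) i) t := by
    intro i j
    have h1 := (EuclideanSpace.proj (𝕜 := ℝ) i : Space3 →L[ℝ] ℝ).hasFDerivAt.comp_hasDerivAt t
      (hA.clm_apply (hasDerivAt_const t (EuclideanSpace.single j (1 : ℝ))))
    exact h1.congr_deriv (by simp)
  have hmul : ∀ i j : Fin 3, N (A t (EuclideanSpace.single j 1)) i
      = ∑ k, A t (EuclideanSpace.single j 1) k * N (EuclideanSpace.single k 1) i := by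
    intro i j
    conv_lhs => rw [← (EuclideanSpace.basisFun (Fin 3) ℝ).sum_repr (A t (EuclideanSpace.single j 1))]
    simp [map_sum, Finset.sum_apply]
  simp only [det_eq_det_matrix, Matrix.det_fin_three, Matrix.of_apply]
  have h := (((((((hentry 0 0).mul (hentry 1 1)).mul (hentry 2 2)).sub
    (((hentry 0 0).mul (hentry 1 2)).mul (hentry 2 1))).sub
    (((hentry 0 1).mul (hentry 1 0)).mul (hentry 2 2))).add
    (((hentry 0 1).mul (hentry 1 2)).mul (hentry 2 0))).add
    (((hentry 0 2).mul (hentry 1 0)).mul (hentry 2 1))).sub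
    (((hentry 0 2).mul (hentry 1 1)).mul (hentry 2 0))
  refine HasDerivAt.congr_deriv h ?_
  simp only [hmul, Fin.sum_univ_three, Pi.mul_apply] at hN ⊢
  -- The derivative of the determinant is the trace of `N` times the determinant; the coefficient is
  -- the determinant itself.
  linear_combination (A t (EuclideanSpace.single 0 1) 0 * A t (EuclideanSpace.single 1 1) 1
      * A t (EuclideanSpace.single 2 1) 2
    - A t (EuclideanSpace.single 0 1) 0 * A t (EuclideanSpace.single 2 1) 1
      * A t (EuclideanSpace.single 1 1) 2
    - A t (EuclideanSpace.single 1 1) 0 * A t (EuclideanSpace.single 0 1) 1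
      * A t (EuclideanSpace.single 2 1) 2
    + A t (EuclideanSpace.single 2 1) 0 * A t (EuclideanSpace.single 0 1) 1
      * A t (EuclideanSpace.single 1 1) 2
    + A t (EuclideanSpace.single 1 1) 0 * A t (EuclideanSpace.single 2 1) 1
      * A t (EuclideanSpace.single 0 1) 2
    - A t (EuclideanSpace.single 2 1) 0 * A t (EuclideanSpace.single 1 1) 1
      * A t (EuclideanSpace.single 0 1) 2) * hN

end Jacobian

/-- The spatial derivative of a function of time and space, within `I × closedBall c R`. -/
lemma hasFDerivAt_slice {I : Set ℝ} {c : Space3} {R : ℝ} {Ψ : ℝ × Space3 → Space3}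
    (hΨ : ContDiffOn ℝ 1 Ψ (I ×ˢ closedBall c R)) {t : ℝ} (ht : t ∈ I) {y : Space3}
    (hy : y ∈ ball c R) :
    HasFDerivAt (fun z => Ψ (t, z)) ((fderivWithin ℝ Ψ (I ×ˢ closedBall c R) (t, y)).comp
      (ContinuousLinearMap.inr ℝ ℝ Space3)) y := by
  have h1 := (hΨ.differentiableOn one_ne_zero (t, y) ⟨ht, ball_subset_closedBall hy⟩).hasFDerivWithinAt
  have h2 : HasFDerivWithinAt (fun z : Space3 => (t, z)) (ContinuousLinearMap.inr ℝ ℝ Space3)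
      (ball c R) y := (hasFDerivAt_prodMk_right t y).hasFDerivWithinAt
  exact (h1.comp y h2 fun z hz => ⟨ht, ball_subset_closedBall hz⟩).hasFDerivAt
    (isOpen_ball.mem_nhds hy)

lemma hasDerivWithinAt_slice {I : Set ℝ} {c : Space3} {R : ℝ} {Ψ : ℝ × Space3 → Space3}
    (hΨ : ContDiffOn ℝ 1 Ψ (I ×ˢ closedBall c R)) {t : ℝ} (ht : t ∈ I) {y : Space3}
    (hy : y ∈ closedBall c R) :
    HasDerivWithinAt (fun s => Ψ (s, y)) (fderivWithin ℝ Ψ (I ×ˢ closedBall c R) (t, y) (1, 0))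
      I t := by
  have h1 := (hΨ.differentiableOn one_ne_zero (t, y) ⟨ht, hy⟩).hasFDerivWithinAt
  have h2 : HasDerivWithinAt (fun s : ℝ => (s, y)) (1, 0) I t :=
    (hasDerivWithinAt_id t I).prodMk (hasDerivWithinAt_const t I y)
  exact h1.comp_hasDerivWithinAt (t := I ×ˢ closedBall c R) t h2 fun s hs => ⟨hs, hy⟩

/-- A body that is a ball at the initial time `T₀` and is transported by the flow `X` of the
incompressible velocity field `v`. -/
structure IsTransportedBall (I : Set ℝ) (T₀ : ℝ) (B : ℝ → Set Space3) (v X : ℝ → Space3 → Space3)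
    (c : Space3) (R : ℝ) : Prop where
  ordConnected : I.OrdConnected
  nontrivial : I.Nontrivial
  isLeast : IsLeast I T₀
  radius_pos : 0 < R
  initial_body : B T₀ = ball c R
  isOpen_body : ∀ t ∈ I, IsOpen (B t)
  velocity_contDiffOn : ContDiffOn ℝ 1 (fun q : ℝ × Space3 => v q.1 q.2)
    {q | q.1 ∈ I ∧ q.2 ∈ closure (B q.1)}
  incompressible : ∀ t ∈ I, ∀ x ∈ B t, divergence3 (v t) x = 0
  flow : IsLagrangianFlow I T₀ B v X

namespace IsTransportedBall

variable {I : Set ℝ} {T₀ : ℝ} {B : ℝ → Set Space3} {v X : ℝ → Space3 → Space3}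
  {c : Space3} {R : ℝ}

lemma closure_initial (h : IsTransportedBall I T₀ B v X c R) :
    closure (B T₀) = closedBall c R := by
  rw [h.initial_body, closure_ball _ h.radius_pos.ne']

lemma frontier_initial (h : IsTransportedBall I T₀ B v X c R) :
    frontier (B T₀) = sphere c R := by
  rw [h.initial_body, frontier_ball _ h.radius_pos.ne']

lemma image_ball (h : IsTransportedBall I T₀ B v X c R) {t : ℝ} (ht : t ∈ I) :
    X t '' ball c R = B t := by
  rw [← h.initial_body]; exact h.flow.image_body t ht

lemma image_sphere (h : IsTransportedBall I T₀ B v X c R) {t : ℝ} (ht : t ∈ I) :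
    X t '' sphere c R = frontier (B t) := by
  rw [← h.frontier_initial]; exact h.flow.image_boundary t ht

lemma image_closedBall (h : IsTransportedBall I T₀ B v X c R) {t : ℝ} (ht : t ∈ I) :
    X t '' closedBall c R = closure (B t) := by
  rw [← ball_union_sphere, image_union, h.image_ball ht, h.image_sphere ht,
    closure_eq_self_union_frontier]

lemma mapsTo_ball (h : IsTransportedBall I T₀ B v X c R) {t : ℝ} (ht : t ∈ I) {y : Space3}
    (hy : y ∈ ball c R) : X t y ∈ B t := by
  rw [← h.image_ball ht]; exact mem_image_of_mem _ hy

lemma mapsTo_closedBall (h : IsTransportedBall I T₀ B v X c R) {t : ℝ} (ht : t ∈ I) {y : Space3}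
    (hy : y ∈ closedBall c R) : X t y ∈ closure (B t) := by
  rw [← h.image_closedBall ht]; exact mem_image_of_mem _ hy

lemma contDiffOn_flow (h : IsTransportedBall I T₀ B v X c R) :
    ContDiffOn ℝ 1 (fun q : ℝ × Space3 => X q.1 q.2) (I ×ˢ closedBall c R) := by
  rw [← h.closure_initial]; exact h.flow.contDiffOn

lemma contDiffOn_flow_apply (h : IsTransportedBall I T₀ B v X c R) {t : ℝ} (ht : t ∈ I) :
    ContDiffOn ℝ 1 (X t) (closedBall c R) :=
  h.contDiffOn_flow.comp (f := fun y => (t, y)) (by fun_prop) fun _ hy => ⟨ht, hy⟩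

lemma isCompact_closure (h : IsTransportedBall I T₀ B v X c R) {t : ℝ} (ht : t ∈ I) :
    IsCompact (closure (B t)) := by
  rw [← h.image_closedBall ht]
  exact (isCompact_closedBall c R).image_of_continuousOn (h.contDiffOn_flow_apply ht).continuousOn

lemma isBounded (h : IsTransportedBall I T₀ B v X c R) {t : ℝ} (ht : t ∈ I) :
    Bornology.IsBounded (B t) := (h.isCompact_closure ht).isBounded.subset subset_closure

lemma injOn (h : IsTransportedBall I T₀ B v X c R) {t : ℝ} (ht : t ∈ I) :
    InjOn (X t) (closedBall c R) := by
  rw [← h.closure_initial]; exact h.flow.injOn t ht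

lemma hasDerivWithinAt_flow (h : IsTransportedBall I T₀ B v X c R) {t : ℝ} (ht : t ∈ I)
    {y : Space3} (hy : y ∈ closedBall c R) :
    HasDerivWithinAt (fun s => X s y) (v t (X t y)) I t :=
  h.flow.velocity t ht y (by rwa [h.closure_initial])

lemma uniqueDiffOn (h : IsTransportedBall I T₀ B v X c R) : UniqueDiffOn ℝ I :=
  h.ordConnected.uniqueDiffOn_of_nontrivial h.nontrivial

lemma uniqueDiffOn_prod (h : IsTransportedBall I T₀ B v X c R) :
    UniqueDiffOn ℝ (I ×ˢ closedBall c R) := by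
  refine h.uniqueDiffOn.prod (uniqueDiffOn_convex (convex_closedBall c R) ⟨c, ?_⟩)
  rw [interior_closedBall _ h.radius_pos.ne']
  exact mem_ball_self h.radius_pos

/-- The Lagrangian velocity is continuously differentiable. -/
lemma contDiffOn_lagrangianVelocity (h : IsTransportedBall I T₀ B v X c R) :
    ContDiffOn ℝ 1 (fun q : ℝ × Space3 => v q.1 (X q.1 q.2)) (I ×ˢ closedBall c R) :=
  h.velocity_contDiffOn.comp (f := fun q : ℝ × Space3 => (q.1, X q.1 q.2))
    (contDiffOn_fst.prodMk h.contDiffOn_flow) fun _ hq => ⟨hq.1, h.mapsTo_closedBall hq.1 hq.2⟩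

lemma differentiableAt_velocity (h : IsTransportedBall I T₀ B v X c R) {t : ℝ} (ht : t ∈ I)
    {x : Space3} (hx : x ∈ B t) : DifferentiableAt ℝ (v t) x := by
  have : ContDiffOn ℝ 1 (v t) (B t) :=
    h.velocity_contDiffOn.comp (f := fun y => (t, y)) (by fun_prop)
      fun _ hy => ⟨ht, subset_closure hy⟩
  exact (this.contDiffAt ((h.isOpen_body t ht).mem_nhds hx)).differentiableAt one_ne_zero

lemma differentiableAt_flow (h : IsTransportedBall I T₀ B v X c R) {t : ℝ} (ht : t ∈ I)
    {y : Space3} (hy : y ∈ ball c R) : DifferentiableAt ℝ (X t) y := by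
  refine ((h.contDiffOn_flow_apply ht).contDiffAt ?_).differentiableAt one_ne_zero
  exact mem_of_superset (isOpen_ball.mem_nhds hy) ball_subset_closedBall

lemma flow_eq_add_integral (h : IsTransportedBall I T₀ B v X c R) {t : ℝ} (ht : t ∈ I) {y : Space3}
    (hy : y ∈ closedBall c R) : X t y = y + ∫ s in T₀..t, v s (X s y) := by
  have hle := h.isLeast.2 ht
  have hsub : Icc T₀ t ⊆ I := h.ordConnected.out h.isLeast.1 ht
  have hw : ContinuousOn (fun s => v s (X s y)) (Icc T₀ t) := by
    refine h.contDiffOn_lagrangianVelocity.continuousOn.comp (f := fun s : ℝ => (s, y))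
      (by fun_prop) fun s hs => ?_
    exact ⟨hsub hs, hy⟩
  rw [intervalIntegral.integral_eq_sub_of_hasDeriv_right (f := fun s => X s y),
    h.flow.initial y (by rwa [h.closure_initial])]
  · abel
  · rw [uIcc_of_le hle]
    intro s hs
    exact ((h.hasDerivWithinAt_flow (hsub hs) hy).continuousWithinAt).mono hsub
  · intro s hs
    rw [min_eq_left hle, max_eq_right hle] at hs
    have := (h.hasDerivWithinAt_flow (hsub (Ioo_subset_Icc_self hs)) hy).hasDerivAt
      (mem_of_superset (Icc_mem_nhds hs.1 hs.2) hsub)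
    exact this.hasDerivWithinAt
  · exact (by rwa [uIcc_of_le hle] : ContinuousOn _ (uIcc T₀ t)).intervalIntegrable

/-- The flow of an incompressible velocity field preserves volume. -/
theorem det_fderiv_flow (h : IsTransportedBall I T₀ B v X c R) {t : ℝ} (ht : t ∈ I) {y : Space3}
    (hy : y ∈ ball c R) : (fderiv ℝ (X t) y).det = 1 := by
  have hle := h.isLeast.2 ht
  have hsub : Icc T₀ t ⊆ I := h.ordConnected.out h.isLeast.1 ht
  have hw := h.contDiffOn_lagrangianVelocity
  set w : ℝ × Space3 → Space3 := fun q => v q.1 (X q.1 q.2) with hwdef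
  -- The flow is only `C¹`, so its spatial derivative is not known to be differentiable in time. But
  -- the Lagrangian velocity is also `C¹`, and integrating it in time exhibits the spatial
  -- derivative of the flow as the primitive `A`.
  set D : ℝ → Space3 → Space3 →L[ℝ] Space3 := fun s z =>
    (fderivWithin ℝ w (I ×ˢ closedBall c R) (s, z)).comp (ContinuousLinearMap.inr ℝ ℝ Space3)
    with hD
  have hDcont : ContinuousOn (fun q : ℝ × Space3 => D q.1 q.2) (I ×ˢ closedBall c R) :=
    (hw.continuousOn_fderivWithin h.uniqueDiffOn_prod le_rfl).clm_comp continuousOn_const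
  have hyc := ball_subset_closedBall hy
  have hDy : ContinuousOn (fun s => D s y) (Icc T₀ t) :=
    hDcont.comp (f := fun s => (s, y)) (by fun_prop) fun s hs => ⟨hsub hs, hyc⟩
  obtain ⟨C, hC⟩ := (isCompact_Icc.prod (isCompact_closedBall c R)).exists_bound_of_continuousOn
    (hDcont.mono (prod_mono hsub Subset.rfl))
  -- A continuous extension to the whole line, so that `A` has two-sided derivatives even at the
  -- endpoints.
  set g : ℝ → Space3 →L[ℝ] Space3 := IccExtend hle (Icc T₀ t |>.domRestrict fun s => D s y) with hg
  have hgcont : Continuous g := (continuousOn_iff_continuous_domRestrict.1 hDy).Icc_extend'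
  have hgeq : ∀ s ∈ Icc T₀ t, g s = D s y := fun s hs => by
    rw [hg, IccExtend_of_mem _ _ hs]; rfl
  set A : ℝ → Space3 →L[ℝ] Space3 := fun s =>
    ContinuousLinearMap.id ℝ Space3 + ∫ σ in T₀..s, g σ with hA
  have hAderiv : ∀ s, HasDerivAt A (g s) s := fun s =>
    (hgcont.integral_hasStrictDerivAt T₀ s).hasDerivAt.const_add _
  have hAX : ∀ s ∈ Icc T₀ t, HasFDerivAt (X s) (A s) y := by
    intro s hs
    have hsubs : uIoc T₀ s ⊆ Icc T₀ t := by
      rw [uIoc_of_le hs.1]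
      exact Ioc_subset_Icc_self.trans (Icc_subset_Icc_right hs.2)
    have hcontw : ∀ z ∈ ball c R, ContinuousOn (fun σ => w (σ, z)) (Icc T₀ t) := fun z hz =>
      hw.continuousOn.comp (f := fun s => (s, z)) (by fun_prop)
        fun s hs => ⟨hsub hs, ball_subset_closedBall hz⟩
    have hIcc : uIcc T₀ s ⊆ Icc T₀ t := by
      rw [uIcc_of_le hs.1]; exact Icc_subset_Icc_right hs.2
    have key := intervalIntegral.hasFDerivAt_integral_of_dominated_of_fderiv_le (𝕜 := ℝ)
      (μ := volume) (a := T₀) (b := s) (F := fun z σ => w (σ, z)) (F' := fun z σ => D σ z)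
      (bound := fun _ => C) (x₀ := y) (s := ball c R) (isOpen_ball.mem_nhds hy) ?_ ?_ ?_ ?_ ?_ ?_
    · have e : (fun z => z + ∫ σ in T₀..s, w (σ, z)) =ᶠ[𝓝 y] X s := by
        filter_upwards [isOpen_ball.mem_nhds hy] with z hz
        exact (h.flow_eq_add_integral (hsub hs) (ball_subset_closedBall hz)).symm
      refine (((hasFDerivAt_id y).add key).congr_of_eventuallyEq e.symm).congr_fderiv ?_
      rw [hA]
      congr 1
      refine intervalIntegral.integral_congr fun σ hσ => ?_
      exact (hgeq σ (hIcc hσ)).symm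
    · filter_upwards [isOpen_ball.mem_nhds hy] with z hz
      exact ((hcontw z hz).mono hsubs).aestronglyMeasurable measurableSet_uIoc
    · exact ((hcontw y hy).mono hIcc).intervalIntegrable
    · exact (hDy.mono hsubs).aestronglyMeasurable measurableSet_uIoc
    · exact Eventually.of_forall fun σ hσ z hz => hC (σ, z) ⟨hsubs hσ, ball_subset_closedBall hz⟩
    · exact intervalIntegrable_const
    · exact Eventually.of_forall fun σ hσ z hz => hasFDerivAt_slice hw (hsub (hsubs hσ)) hz
  have hdet : ∀ s ∈ Icc T₀ t, HasDerivAt (fun s => (A s).det) 0 s := by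
    intro s hs
    have hx := h.mapsTo_ball (hsub hs) hy
    have h1 : HasFDerivAt (fun z => w (s, z)) ((fderiv ℝ (v s) (X s y)).comp (A s)) y :=
      (h.differentiableAt_velocity (hsub hs) hx).hasFDerivAt.comp y (hAX s hs)
    -- Computing the spatial derivative of the Lagrangian velocity in two ways gives the linear
    -- equation `A' = ∇v ∘ A`, to which Liouville's formula applies.
    have h2 := h1.unique (hasFDerivAt_slice hw (hsub hs) hy)
    refine hasDerivAt_det_zero (N := fderiv ℝ (v s) (X s y)) ?_
      (h.incompressible s (hsub hs) _ hx)
    rw [h2]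
    have := hAderiv s
    rwa [hgeq s hs] at this
  have hconst := constant_of_has_deriv_right_zero (f := fun s => (A s).det) (a := T₀) (b := t)
    (fun s hs => (hdet s hs).continuousAt.continuousWithinAt)
    (fun s hs => (hdet s (Ico_subset_Icc_self hs)).hasDerivWithinAt) t ⟨hle, le_rfl⟩
  rw [(hAX t ⟨hle, le_rfl⟩).fderiv, hconst]
  simp [hA, ContinuousLinearMap.det]

end IsTransportedBall

/-! ### Integrals over the moving body and the material derivative -/

namespace IsTransportedBall

variable {I : Set ℝ} {T₀ : ℝ} {B : ℝ → Set Space3} {v X : ℝ → Space3 → Space3}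
  {c : Space3} {R : ℝ}

lemma hasFDerivWithinAt_flow (h : IsTransportedBall I T₀ B v X c R) {t : ℝ} (ht : t ∈ I) :
    ∀ y ∈ ball c R, HasFDerivWithinAt (X t) (fderiv ℝ (X t) y) (ball c R) y :=
  fun _ hy => (h.differentiableAt_flow ht hy).hasFDerivAt.hasFDerivWithinAt

theorem setIntegral_body (h : IsTransportedBall I T₀ B v X c R) {t : ℝ} (ht : t ∈ I) {F : Type*}
    [NormedAddCommGroup F] [NormedSpace ℝ F] (g : Space3 → F) :
    ∫ x in B t, g x = ∫ y in ball c R, g (X t y) := by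
  rw [← h.image_ball ht, integral_image_eq_integral_abs_det_fderiv_smul volume measurableSet_ball
    (h.hasFDerivWithinAt_flow ht) ((h.injOn ht).mono ball_subset_closedBall)]
  refine setIntegral_congr_fun measurableSet_ball fun y hy => ?_
  simp [h.det_fderiv_flow ht hy]

theorem integrableOn_body_iff (h : IsTransportedBall I T₀ B v X c R) {t : ℝ} (ht : t ∈ I)
    {F : Type*} [NormedAddCommGroup F] [NormedSpace ℝ F] (g : Space3 → F) :
    IntegrableOn g (B t) ↔ IntegrableOn (fun y => g (X t y)) (ball c R) := by
  rw [← h.image_ball ht, integrableOn_image_iff_integrableOn_abs_det_fderiv_smul volume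
    measurableSet_ball (h.hasFDerivWithinAt_flow ht) ((h.injOn ht).mono ball_subset_closedBall)]
  refine integrableOn_congr_fun (fun y hy => ?_) measurableSet_ball
  simp [h.det_fderiv_flow ht hy]

lemma volume_real_body (h : IsTransportedBall I T₀ B v X c R) {t : ℝ} (ht : t ∈ I) :
    volume.real (B t) = 4 / 3 * Real.pi * R ^ 3 := by
  have := h.setIntegral_body ht fun _ => (1 : ℝ)
  simp only [setIntegral_const, smul_eq_mul, mul_one] at this
  rw [this, measureReal_def, EuclideanSpace.volume_ball_fin_three, ENNReal.toReal_mul,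
    ENNReal.toReal_pow, ENNReal.toReal_ofReal h.radius_pos.le,
    ENNReal.toReal_ofReal (by positivity)]
  ring

/-- The boundary is a `C¹` image of a sphere. Its being null is needed because the pressure extended
by zero may fail to be differentiable there. -/
lemma volume_frontier (h : IsTransportedBall I T₀ B v X c R) {t : ℝ} (ht : t ∈ I) :
    volume (frontier (B t)) = 0 := by
  rw [← h.image_sphere ht]
  refine addHaar_image_eq_zero_of_differentiableOn_of_addHaar_eq_zero volume ?_
    (Measure.addHaar_sphere _ _ _)
  exact ((h.contDiffOn_flow_apply ht).differentiableOn one_ne_zero).mono sphere_subset_closedBall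

/-- The region of space-time that a body occupies is relatively open. -/
lemma eventually_mem_body (h : IsTransportedBall I T₀ B v X c R) {t : ℝ} (ht : t ∈ I) {x : Space3}
    (hx : x ∈ B t) : ∀ᶠ s in 𝓝[I] t, x ∈ B s := by
  obtain ⟨y, hy, rfl⟩ := (h.image_ball ht).symm ▸ hx
  obtain ⟨d, hd, hball⟩ := Metric.isOpen_iff.1 (h.isOpen_body t ht) _ hx
  obtain ⟨V, hV, hVd⟩ := (isCompact_closedBall c R).mem_uniformity_of_prod (f := X)
    h.contDiffOn_flow.continuousOn ht (dist_mem_uniformity (half_pos hd))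
  filter_upwards [hV, self_mem_nhdsWithin] with s hs hsI
  have hyc := ball_subset_closedBall hy
  -- Boundary points at time `s` are within `d / 2` of boundary points at time `t`, and the latter
  -- are at distance at least `d` from `X t y`. So this ball is connected, meets `B s` and misses
  -- its boundary.
  have key : ball (X t y) (d / 2) ⊆ B s := by
    refine (convex_ball _ _).isPreconnected.subset_of_closure_inter_subset (h.isOpen_body s hsI)
      ⟨X s y, hVd s hs y hyc, h.mapsTo_ball hsI hy⟩ ?_
    rintro z ⟨hz, hzb⟩
    rw [← h.image_closedBall hsI] at hz
    obtain ⟨y', hy', rfl⟩ := hz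
    rcases lt_or_eq_of_le (mem_closedBall.1 hy') with hlt | heq
    · exact h.mapsTo_ball hsI hlt
    · exfalso
      have hfr : X t y' ∈ frontier (B t) := by
        rw [← h.image_sphere ht]; exact mem_image_of_mem _ heq
      rw [frontier, (h.isOpen_body t ht).interior_eq] at hfr
      refine hfr.2 (hball ?_)
      have h1 : dist (X s y') (X t y') < d / 2 := hVd s hs y' hy'
      have h2 : dist (X s y') (X t y) < d / 2 := hzb
      rw [mem_ball]
      rw [dist_comm] at h1
      linarith [dist_triangle (X t y') (X s y') (X t y)]
  exact key (mem_ball_self (half_pos hd))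

/-- The Lagrangian acceleration is the material derivative of the velocity. -/
theorem derivWithin_add_fderiv_eq (h : IsTransportedBall I T₀ B v X c R) {t : ℝ} (ht : t ∈ I)
    {y : Space3} (hy : y ∈ ball c R) :
    derivWithin (fun s => v s (X t y)) I t + fderiv ℝ (v t) (X t y) (v t (X t y))
      = fderivWithin ℝ (fun q : ℝ × Space3 => v q.1 (X q.1 q.2)) (I ×ˢ closedBall c R) (t, y)
        (1, 0) := by
  have hyc := ball_subset_closedBall hy
  have hx := h.mapsTo_ball ht hy
  set x := X t y with hxdef
  set D : Set (ℝ × Space3) := {q | q.1 ∈ I ∧ q.2 ∈ closure (B q.1)} with hD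
  have hL := (h.velocity_contDiffOn.differentiableOn one_ne_zero (t, x)
    ⟨ht, subset_closure hx⟩).hasFDerivWithinAt
  set L := fderivWithin ℝ (fun q : ℝ × Space3 => v q.1 q.2) D (t, x)
  have hcurve : HasDerivWithinAt (fun s => v s (X s y)) (L (1, v t x)) I t :=
    hL.comp_hasDerivWithinAt (f := fun s => (s, X s y)) t
      ((hasDerivWithinAt_id t I).prodMk (h.hasDerivWithinAt_flow ht hyc))
      fun s hs => ⟨hs, h.mapsTo_closedBall hs hyc⟩
  -- The regularity of `v` is known only over the closed body. As `x` remains in the body for times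
  -- near `t`, differentiating within those times is the same as differentiating within `I`.
  have htime : HasDerivWithinAt (fun s => v s x) (L (1, 0)) I t := by
    have hmem : {s | s ∈ I ∧ x ∈ closure (B s)} ∈ 𝓝[I] t := by
      filter_upwards [h.eventually_mem_body ht hx, self_mem_nhdsWithin] with s hs hsI
      exact ⟨hsI, subset_closure hs⟩
    refine HasDerivWithinAt.mono_of_mem_nhdsWithin ?_ hmem
    exact hL.comp_hasDerivWithinAt (f := fun s => (s, x)) t
      ((hasDerivWithinAt_id t _).prodMk (hasDerivWithinAt_const t _ x)) fun s hs => hs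
  have hspace : HasFDerivAt (v t) (L.comp (ContinuousLinearMap.inr ℝ ℝ Space3)) x := by
    have h2 : HasFDerivWithinAt (fun z : Space3 => (t, z)) (ContinuousLinearMap.inr ℝ ℝ Space3)
      (B t) x := (hasFDerivAt_prodMk_right t x).hasFDerivWithinAt
    exact (hL.comp x h2 fun z hz => ⟨ht, subset_closure hz⟩).hasFDerivAt
      ((h.isOpen_body t ht).mem_nhds hx)
  have hu := h.uniqueDiffOn t ht
  have e := hu.eq_deriv _ hcurve (hasDerivWithinAt_slice h.contDiffOn_lagrangianVelocity ht hyc)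
  rw [htime.derivWithin hu, hspace.fderiv, ← e]
  simp only [ContinuousLinearMap.comp_apply, ContinuousLinearMap.inr_apply]
  rw [← map_add]
  simp

lemma hasDerivWithinAt_integral_body (h : IsTransportedBall I T₀ B v X c R) {t : ℝ} (ht : t ∈ I) :
    HasDerivWithinAt (fun s => ∫ x in B s, x) (∫ y in ball c R, v t (X t y)) I t := by
  have := hasDerivWithinAt_setIntegral_ball h.ordConnected h.isLeast (f := X)
    (f' := fun s y => v s (X s y)) (fun s hs => (h.contDiffOn_flow_apply hs).continuousOn)
    h.contDiffOn_lagrangianVelocity.continuousOn (fun s hs y hy => h.hasDerivWithinAt_flow hs hy) ht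
  exact this.congr (fun s hs => h.setIntegral_body hs id) (h.setIntegral_body ht id)

lemma hasDerivWithinAt_integral_velocity (h : IsTransportedBall I T₀ B v X c R) {t : ℝ}
    (ht : t ∈ I) : HasDerivWithinAt (fun s => ∫ y in ball c R, v s (X s y))
      (∫ x in B t, (derivWithin (fun s => v s x) I t + fderiv ℝ (v t) x (v t x))) I t := by
  have hw := h.contDiffOn_lagrangianVelocity
  have := hasDerivWithinAt_setIntegral_ball h.ordConnected h.isLeast
    (f := fun s y => v s (X s y))
    (f' := fun s y => fderivWithin ℝ (fun q : ℝ × Space3 => v q.1 (X q.1 q.2))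
      (I ×ˢ closedBall c R) (s, y) (1, 0))
    (fun s hs => hw.continuousOn.comp (f := fun y => (s, y)) (by fun_prop) fun y hy => ⟨hs, hy⟩)
    ((hw.continuousOn_fderivWithin h.uniqueDiffOn_prod le_rfl).clm_apply continuousOn_const)
    (fun s hs y hy => hasDerivWithinAt_slice hw hs hy) ht
  convert this using 1
  rw [h.setIntegral_body ht]
  exact setIntegral_congr_fun measurableSet_ball fun y hy => h.derivWithin_add_fderiv_eq ht hy

/-- In Lagrangian coordinates the material derivative extends continuously to the closed ball, hence
the bound is uniform up to the boundary. It is used to bound the pressure gradient. -/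
lemma exists_norm_materialDerivative_le (h : IsTransportedBall I T₀ B v X c R) {t : ℝ}
    (ht : t ∈ I) : ∃ C, ∀ x ∈ B t,
      ‖derivWithin (fun s => v s x) I t + fderiv ℝ (v t) x (v t x)‖ ≤ C := by
  have hw := h.contDiffOn_lagrangianVelocity
  have hc := ((hw.continuousOn_fderivWithin h.uniqueDiffOn_prod le_rfl).clm_apply
    (continuousOn_const (c := ((1 : ℝ), (0 : Space3))))).comp (f := fun y => (t, y))
    (s := closedBall c R) (by fun_prop) fun y hy => ⟨ht, hy⟩
  obtain ⟨C, hC⟩ := (isCompact_closedBall c R).exists_bound_of_continuousOn hc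
  refine ⟨C, fun x hx => ?_⟩
  obtain ⟨y, hy, rfl⟩ := (h.image_ball ht).symm ▸ hx
  rw [h.derivWithin_add_fderiv_eq ht hy]
  exact hC y (ball_subset_closedBall hy)

lemma integrableOn_materialDerivative (h : IsTransportedBall I T₀ B v X c R) {t : ℝ}
    (ht : t ∈ I) : IntegrableOn
      (fun x => derivWithin (fun s => v s x) I t + fderiv ℝ (v t) x (v t x)) (B t) := by
  rw [h.integrableOn_body_iff ht]
  have hw := h.contDiffOn_lagrangianVelocity
  have hc := ((hw.continuousOn_fderivWithin h.uniqueDiffOn_prod le_rfl).clm_apply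
    (continuousOn_const (c := ((1 : ℝ), (0 : Space3))))).comp (f := fun y => (t, y))
    (s := closedBall c R) (by fun_prop) fun y hy => ⟨ht, hy⟩
  refine ((hc.integrableOn_compact (isCompact_closedBall c R)).mono_set
    ball_subset_closedBall).congr_fun (fun y hy => ?_) measurableSet_ball
  exact (h.derivWithin_add_fderiv_eq ht hy).symm

end IsTransportedBall

/-! ### The pressure exerts no net force -/

/-- A function that vanishes on the boundary of an open set, and whose gradient is bounded inside,
is bounded at a point of the set by the distance to the complement. -/
lemma abs_le_mul_dist_of_frontier_eq_zero {U : Set Space3} (hU : IsOpen U)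
    {p : Space3 → ℝ} (hc : ContinuousOn p (closure U)) (hd : ∀ x ∈ U, DifferentiableAt ℝ p x)
    (h0 : ∀ x ∈ frontier U, p x = 0) {C : NNReal} (hC : ∀ x ∈ U, ‖fderiv ℝ p x‖ ≤ C)
    {a b : Space3} (ha : a ∈ U) (hb : b ∉ U) : |p a| ≤ C * dist a b := by
  -- For a nearest point `z` of the complement, the open ball about `a` reaching to `z` lies in `U`.
  -- The Lipschitz bound on this convex ball extends by continuity to `z`, where `p` vanishes.
  obtain ⟨z, hz, hza⟩ := hU.isClosed_compl.exists_infDist_eq_dist ⟨b, hb⟩ a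
  have hpos : 0 < dist a z := dist_pos.2 fun e => hz (e ▸ ha)
  have hsub : ball a (dist a z) ⊆ U := by
    intro y hy
    by_contra hyU
    have := infDist_le_dist_of_mem (x := a) (s := Uᶜ) hyU
    rw [hza, dist_comm a y] at this
    exact not_lt.2 this hy
  have hclos : closedBall a (dist a z) ⊆ closure U := by
    rw [← closure_ball a hpos.ne']
    exact closure_mono hsub
  have hlip : LipschitzOnWith C p (ball a (dist a z)) :=
    (convex_ball _ _).lipschitzOnWith_of_nnnorm_fderiv_le (𝕜 := ℝ) (fun y hy => hd y (hsub hy))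
      fun y hy => hC y (hsub hy)
  have hlip' := LipschitzOnWith.closure
    (by rw [closure_ball a hpos.ne']; exact hc.mono hclos) hlip
  rw [closure_ball a hpos.ne'] at hlip'
  have hzm : z ∈ closedBall a (dist a z) := by rw [mem_closedBall, dist_comm]
  have hzf : z ∈ frontier U := ⟨hclos hzm, by rw [hU.interior_eq]; exact hz⟩
  have := hlip'.dist_le_mul a (mem_closedBall_self hpos.le) z hzm
  rw [h0 z hzf, Real.dist_0_eq_abs] at this
  refine this.trans ?_
  gcongr
  rw [← hza]
  exact infDist_le_dist_of_mem hb

/-- If the segment between two points of `U` leaves `U`, each value is bounded by the distance to a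
point where it is outside, and the two distances add up to the length of the segment. No regularity
of the boundary enters. -/
lemma lipschitzWith_indicator {U : Set Space3} (hU : IsOpen U)
    {p : Space3 → ℝ} (hc : ContinuousOn p (closure U)) (hd : ∀ x ∈ U, DifferentiableAt ℝ p x)
    (h0 : ∀ x ∈ frontier U, p x = 0) {C : NNReal} (hC : ∀ x ∈ U, ‖fderiv ℝ p x‖ ≤ C) :
    LipschitzWith C (U.indicator p) := by
  refine LipschitzWith.of_dist_le_mul fun a b => ?_
  rw [Real.dist_eq]
  have key := @abs_le_mul_dist_of_frontier_eq_zero U hU p hc hd h0 C hC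
  by_cases ha : a ∈ U <;> by_cases hb : b ∈ U
  · rw [indicator_of_mem ha, indicator_of_mem hb]
    by_cases hs : segment ℝ a b ⊆ U
    · have := (convex_segment a b).norm_image_sub_le_of_norm_fderiv_le (𝕜 := ℝ)
        (fun y hy => hd y (hs hy)) (fun y hy => hC y (hs hy)) (right_mem_segment ℝ a b)
        (left_mem_segment ℝ a b)
      rwa [← dist_eq_norm, ← dist_eq_norm, dist_eq_norm (p a)] at this
    · obtain ⟨z, hz, hzU⟩ := not_subset.1 hs
      have h1 := key ha hzU
      have h2 := key hb hzU
      rw [← dist_add_dist_of_mem_segment hz, mul_add]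
      rw [dist_comm b z] at h2
      linarith [abs_sub (p a) (p b)]
  · rw [indicator_of_mem ha, indicator_of_notMem hb, sub_zero]
    exact key ha hb
  · rw [indicator_of_notMem ha, indicator_of_mem hb, zero_sub, abs_neg, dist_comm]
    exact key hb ha
  · rw [indicator_of_notMem ha, indicator_of_notMem hb]
    simp only [sub_self, abs_zero]
    positivity

/-- The gradient of a function that vanishes on the boundary has integral zero. -/
theorem setIntegral_gradient_eq_zero {U : Set Space3} (hU : IsOpen U) (hb : Bornology.IsBounded U)
    (hfr : volume (frontier U) = 0) {p : Space3 → ℝ} (hc : ContinuousOn p (closure U))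
    (hd : ∀ x ∈ U, DifferentiableAt ℝ p x) (h0 : ∀ x ∈ frontier U, p x = 0) {C : ℝ}
    (hC : ∀ x ∈ U, ‖gradient p x‖ ≤ C) (hint : IntegrableOn (gradient p) U) :
    ∫ x in U, gradient p x = 0 := by
  have hCf : ∀ x ∈ U, ‖fderiv ℝ p x‖ ≤ C.toNNReal := by
    intro x hx
    refine le_trans ?_ ((hC x hx).trans (Real.le_coe_toNNReal C))
    rw [gradient, LinearIsometryEquiv.norm_map]
  have hlip := lipschitzWith_indicator hU hc hd h0 hCf
  have hcs : HasCompactSupport (U.indicator p) :=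
    HasCompactSupport.of_support_subset_isCompact hb.isCompact_closure
      ((support_indicator_subset).trans subset_closure)
  have hline : ∀ e : Space3, ∫ x, lineDeriv ℝ (U.indicator p) x e = 0 := by
    intro e
    -- Integration by parts against the constant 1, valid for a Lipschitz function of compact
    -- support.
    have := LipschitzWith.integral_lineDeriv_mul_eq (μ := (volume : Measure Space3))
      (LipschitzWith.const (1 : ℝ)) hlip hcs (-e)
    simpa [lineDeriv] using this.symm
  refine ext_inner_left ℝ fun e => ?_
  rw [inner_zero_right]
  have e1 : inner ℝ e (∫ x in U, gradient p x) = ∫ x in U, inner ℝ e (gradient p x) :=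
    ((innerSL ℝ e).integral_comp_comm hint).symm
  rw [e1, ← hline e, ← integral_indicator hU.measurableSet]
  refine integral_congr_ae ?_
  have hae : ∀ᵐ x, x ∉ frontier U := measure_eq_zero_iff_ae_notMem.1 hfr
  filter_upwards [hae] with x hx
  by_cases hxU : x ∈ U
  · rw [indicator_of_mem hxU]
    have heq : U.indicator p =ᶠ[𝓝 x] p := by
      filter_upwards [hU.mem_nhds hxU] with z hz using indicator_of_mem hz _
    rw [heq.lineDeriv_eq, (hd x hxU).lineDeriv_eq_fderiv, real_inner_comm, gradient]
    exact InnerProductSpace.toDual_symm_apply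
  · rw [indicator_of_notMem hxU]
    have hxc : x ∉ closure U := fun h => hx ⟨h, by rwa [hU.interior_eq]⟩
    have heq : U.indicator p =ᶠ[𝓝 x] fun _ => 0 := by
      filter_upwards [isClosed_closure.isOpen_compl.mem_nhds hxc] with z hz
      exact indicator_of_notMem (fun h => hz (subset_closure h)) _
    rw [heq.lineDeriv_eq]
    simp [lineDeriv]

/-! ### The equation of motion of the center of mass -/

/-- The acceleration of the center of mass of the first body is due to the second body only. -/
theorem setIntegral_materialDerivative {G ρ : ℝ} {I : Set ℝ} {T₀ : ℝ} {B : Fin 2 → ℝ → Set Space3}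
    {v : ℝ → Space3 → Space3} {p : ℝ → Space3 → ℝ} (hsol : IsTwoBodySolution G ρ I T₀ B v p)
    {X Y : ℝ → Space3 → Space3} {c d : Space3} {R : ℝ}
    (h : IsTransportedBall I T₀ (B 0) v X c R) (h' : IsTransportedBall I T₀ (B 1) v Y d R)
    {t : ℝ} (ht : t ∈ I) :
    ∫ x in B 0 t, (derivWithin (fun s => v s x) I t + fderiv ℝ (v t) x (v t x))
      = -(G * ρ) • ∫ x in B 0 t, ∫ y in B 1 t, newtonKernel (x - y) := by
  have hm0 := (hsol.isOpen_body 0 t ht).measurableSet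
  have hm1 := (hsol.isOpen_body 1 t ht).measurableSet
  have hb0 := h.isBounded ht
  have hb1 := h'.isBounded ht
  set N : Fin 2 → Space3 → Space3 := fun j x => ∫ y in B j t, newtonKernel (x - y) with hN
  have hgrad : ∀ x, gradient
      (fun z => newtonPotential G ρ (B 0 t) z + newtonPotential G ρ (B 1 t) z) x
      = (G * ρ) • N 0 x + (G * ρ) • N 1 x := by
    intro x
    refine HasGradientAt.gradient ?_
    have h1 := (hasGradientAt_newtonPotential hm0 hb0 G ρ x).hasFDerivAt
    have h2 := (hasGradientAt_newtonPotential hm1 hb1 G ρ x).hasFDerivAt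
    rw [hasGradientAt_iff_hasFDerivAt, map_add]
    exact h1.add h2
  set Q : Space3 → Space3 := fun x =>
    derivWithin (fun s => v s x) I t + fderiv ℝ (v t) x (v t x) with hQ
  have hp : ∀ x ∈ B 0 t, gradient (p t) x = -Q x - ((G * ρ) • N 0 x + (G * ρ) • N 1 x) := by
    intro x hx
    rw [hQ, ← hgrad]
    simp only
    rw [hsol.momentum 0 t ht x hx]
    abel
  have i0 : IntegrableOn (fun x => (G * ρ) • N 0 x) (B 0 t) :=
    (integrableOn_integral_newtonKernel hb0 hm0 hb0).smul (G * ρ)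
  have i1 : IntegrableOn (fun x => (G * ρ) • N 1 x) (B 0 t) :=
    (integrableOn_integral_newtonKernel hb1 hm0 hb0).smul (G * ρ)
  have iQ : IntegrableOn Q (B 0 t) := h.integrableOn_materialDerivative ht
  have i01 : IntegrableOn (fun x => (G * ρ) • N 0 x + (G * ρ) • N 1 x) (B 0 t) := i0.add i1
  have iQ' : IntegrableOn (fun x => -Q x) (B 0 t) := iQ.neg
  have ip : IntegrableOn (gradient (p t)) (B 0 t) :=
    (iQ'.sub i01).congr_fun (fun x hx => (hp x hx).symm) hm0
  obtain ⟨C0, hC0⟩ := exists_norm_integral_newtonKernel_le hb0 hb0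
  obtain ⟨C1, hC1⟩ := exists_norm_integral_newtonKernel_le hb1 hb0
  obtain ⟨CQ, hCQ⟩ := h.exists_norm_materialDerivative_le ht
  -- The momentum equation expresses the pressure gradient through the material derivative and the
  -- two attractions, all bounded on the body.
  have hz := setIntegral_gradient_eq_zero (hsol.isOpen_body 0 t ht) hb0 (h.volume_frontier ht)
    (hsol.pressure_continuousOn 0 t ht) (hsol.pressure_differentiableAt 0 t ht)
    (hsol.pressure_boundary 0 t ht) (C := CQ + (|G * ρ| * C0 + |G * ρ| * C1)) (fun x hx => by
      rw [hp x hx]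
      refine (norm_sub_le _ _).trans ?_
      rw [norm_neg]
      refine add_le_add (hCQ x hx) ((norm_add_le _ _).trans ?_)
      rw [norm_smul, norm_smul, Real.norm_eq_abs]
      have := hC0 x hx
      have := hC1 x hx
      gcongr) ip
  rw [setIntegral_congr_fun hm0 hp, integral_sub iQ' i01, integral_neg, integral_add i0 i1,
    integral_smul, integral_smul, integral_integral_newtonKernel_self hm0 hb0] at hz
  rw [smul_zero, zero_add, sub_eq_zero, neg_eq_iff_eq_neg] at hz
  rw [hz, neg_smul]

lemma newtonKernel_two_smul (x : Space3) :
    newtonKernel ((2 : ℝ) • x) = (4 * ‖x‖ ^ 3)⁻¹ • x := by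
  rw [newtonKernel, norm_smul, smul_smul]
  congr 1
  rcases eq_or_ne ‖x‖ 0 with h | h
  · simp [h]
  · norm_num; field_simp; norm_num

/-- The mutual attraction of a body and its mirror image is close to that of two point masses. -/
theorem norm_integral_newtonKernel_sub_le {Ω : Set Space3} (hm : MeasurableSet Ω)
    (hb : Bornology.IsBounded Ω) (hV : 0 < volume.real Ω) {x₁ : Space3}
    (hx₁ : x₁ = (volume.real Ω)⁻¹ • ∫ x in Ω, x) {R : ℝ} (hR : 0 < R) (hdiam : diam Ω ≤ 10 * R)
    (hfar : 20 * R ≤ ‖x₁‖) :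
    ‖(∫ x in Ω, ∫ y in (fun x => -x) '' Ω, newtonKernel (x - y))
      - (volume.real Ω ^ 2 * (4 * ‖x₁‖ ^ 3)⁻¹) • x₁‖
      ≤ volume.real Ω ^ 2 * (80 * R / ‖x₁‖ ^ 3) := by
  have hr : 0 < ‖x₁‖ := by linarith
  have hfin : volume Ω < ⊤ := hb.measure_lt_top
  have hid : IntegrableOn (fun z : Space3 => z) Ω := by
    obtain ⟨C, -, hC⟩ := exists_subset_ball hb 0
    refine Measure.integrableOn_of_bounded (M := C) hfin.ne (by fun_prop) ?_
    refine (ae_restrict_iff' hm).2 (Eventually.of_forall fun x hx => ?_)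
    exact (mem_ball_zero_iff.1 (hC hx)).le
  have hconst : ∀ a : Space3, IntegrableOn (fun _ => a) Ω := fun a => integrableOn_const hfin.ne
  -- `x - x₁` is the average of `x - z` over the body, so the bound on the diameter applies.
  have hclose : ∀ x ∈ Ω, ‖x - x₁‖ ≤ 10 * R := by
    intro x hx
    have e : x - x₁ = (volume.real Ω)⁻¹ • ∫ z in Ω, (x - z) := by
      rw [integral_sub (hconst x) hid, smul_sub, ← hx₁, setIntegral_const,
        smul_smul, inv_mul_cancel₀ hV.ne', one_smul]
    have h1 : ‖∫ z in Ω, (x - z)‖ ≤ 10 * R * volume.real Ω :=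
      norm_setIntegral_le_of_norm_le_const hfin fun z hz => by
        rw [← dist_eq_norm]; exact (dist_le_diam_of_mem hb hx hz).trans hdiam
    rw [e, norm_smul, norm_inv, Real.norm_of_nonneg hV.le, inv_mul_le_iff₀ hV, mul_comm]
    exact h1
  set Ω' := (fun x : Space3 => -x) '' Ω with hΩ'
  have hΩ'n : Ω' = -Ω := by simp [hΩ']
  have hm' : MeasurableSet Ω' := by rw [hΩ'n]; exact hm.neg
  have hb' : Bornology.IsBounded Ω' := by rw [hΩ'n]; exact hb.neg
  have hV' : volume.real Ω' = volume.real Ω := by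
    rw [hΩ'n, measureReal_def, Measure.measure_neg, measureReal_def]
  set k := newtonKernel ((2 : ℝ) • x₁) with hk
  -- The difference of the two points is within `20 R` of `2 x₁`, and by `hfar` its norm is at least
  -- `‖x₁‖`. The Lipschitz constant `4 / ‖x₁‖³` of the kernel then gives `80 R / ‖x₁‖³`.
  have hpt : ∀ x ∈ Ω, ∀ y ∈ Ω', ‖newtonKernel (x - y) - k‖ ≤ 80 * R / ‖x₁‖ ^ 3 := by
    rintro x hx _ ⟨y, hy, rfl⟩
    have e : x - -y - (2 : ℝ) • x₁ = (x - x₁) + (y - x₁) := by rw [two_smul]; abel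
    have h1 : ‖x - -y - (2 : ℝ) • x₁‖ ≤ 20 * R := by
      rw [e]
      linarith [norm_add_le (x - x₁) (y - x₁), hclose x hx, hclose y hy]
    have h2 : ‖(2 : ℝ) • x₁‖ = 2 * ‖x₁‖ := by rw [norm_smul]; norm_num
    have h3 : ‖x₁‖ ≤ ‖x - -y‖ := by
      have := norm_sub_norm_le ((2 : ℝ) • x₁) (x - -y)
      rw [norm_sub_rev ((2 : ℝ) • x₁) (x - -y)] at this
      linarith
    refine (norm_newtonKernel_sub_le hr h3 (by linarith)).trans ?_
    calc 4 / ‖x₁‖ ^ 3 * ‖x - -y - (2 : ℝ) • x₁‖ ≤ 4 / ‖x₁‖ ^ 3 * (20 * R) := by gcongr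
      _ = 80 * R / ‖x₁‖ ^ 3 := by ring
  have hinner : ∀ x ∈ Ω, ‖(∫ y in Ω', newtonKernel (x - y)) - volume.real Ω • k‖
      ≤ 80 * R / ‖x₁‖ ^ 3 * volume.real Ω := by
    intro x hx
    have e : (∫ y in Ω', newtonKernel (x - y)) - volume.real Ω • k
        = ∫ y in Ω', (newtonKernel (x - y) - k) := by
      rw [integral_sub (integrableOn_newtonKernel_sub hb' x)
        (integrableOn_const hb'.measure_lt_top.ne), setIntegral_const, hV']
    rw [e, ← hV']
    exact norm_setIntegral_le_of_norm_le_const hb'.measure_lt_top (hpt x hx)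
  have e : (∫ x in Ω, ∫ y in Ω', newtonKernel (x - y))
      - (volume.real Ω ^ 2 * (4 * ‖x₁‖ ^ 3)⁻¹) • x₁
      = ∫ x in Ω, ((∫ y in Ω', newtonKernel (x - y)) - volume.real Ω • k) := by
    rw [integral_sub (integrableOn_integral_newtonKernel hb' hm hb) (hconst _), setIntegral_const, hk, newtonKernel_two_smul, smul_smul,
      smul_smul]
    congr 2
    ring
  rw [e]
  refine (norm_setIntegral_le_of_norm_le_const hfin hinner).trans (le_of_eq ?_)
  ring

/-- After translation the integrand is odd on a ball centered at the origin. -/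
lemma setIntegral_ball_id (c : Space3) (R : ℝ) :
    ∫ x in ball c R, x = volume.real (ball c R) • c := by
  have h0 : ∫ x in ball c R, (x - c) = 0 := by
    rw [← integral_indicator measurableSet_ball]
    have e : (ball c R).indicator (fun x : Space3 => x - c)
        = fun x => (ball (0 : Space3) R).indicator (fun x => x) (x - c) := by
      ext1 x
      simp [indicator, dist_eq_norm]
    rw [e, integral_sub_right_eq_self (fun x => (ball (0 : Space3) R).indicator (fun x => x) x) c]
    have h := integral_neg_eq_self (fun x => (ball (0 : Space3) R).indicator (fun x => x) x) volume
    have e2 : ∀ x : Space3, (ball (0 : Space3) R).indicator (fun x => x) (-x)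
        = -(ball (0 : Space3) R).indicator (fun x => x) x := by
      intro x
      by_cases hx : ‖x‖ < R <;> simp [indicator, hx]
    simp only [e2, integral_neg] at h
    rw [eq_comm, eq_neg_iff_add_eq_zero, ← two_smul ℝ] at h
    exact (smul_eq_zero.1 h).resolve_left two_ne_zero
  have hid : IntegrableOn (fun z : Space3 => z) (ball c R) :=
    (continuous_id.continuousOn.integrableOn_compact (isCompact_closedBall c R)).mono_set
      ball_subset_closedBall
  rw [integral_sub hid (integrableOn_const measure_ball_lt_top.ne), setIntegral_const,
    sub_eq_zero] at h0
  exact h0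

/-- The equation of motion of the center of mass of the first body. -/
theorem exists_hasDerivWithinAt_centerOfMass {G ρ M R T₀ : ℝ} {I : Set ℝ}
    {B : Fin 2 → ℝ → Set Space3} {v : ℝ → Space3 → Space3} {p : ℝ → Space3 → ℝ} {c d : Space3}
    (hG : 0 < G) (hρ : 0 < ρ) (hR : 0 < R) (hM : M = ρ * (4 / 3 * Real.pi * R ^ 3))
    (hI : I.OrdConnected) (hIn : I.Nontrivial) (hT : IsLeast I T₀)
    (hsol : IsTwoBodySolution G ρ I T₀ B v p)
    (hB0 : B 0 T₀ = ball c R) (hB1 : B 1 T₀ = ball d R)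
    (hsym : ∀ t ∈ I, B 1 t = (fun x => -x) '' B 0 t)
    (hdiam : ∀ t ∈ I, diam (B 1 t) ≤ 10 * R) :
    centerOfMass ρ M (B 0 T₀) = c ∧ ∃ V A : ℝ → Space3,
      (∀ t ∈ I, HasDerivWithinAt (fun t => centerOfMass ρ M (B 0 t)) (V t) I t) ∧
      (∀ t ∈ I, HasDerivWithinAt V (A t) I t) ∧
      ∀ t ∈ I, 20 * R ≤ ‖centerOfMass ρ M (B 0 t)‖ →
        ‖A t + (G * M * (4 * ‖centerOfMass ρ M (B 0 t)‖ ^ 3)⁻¹) • centerOfMass ρ M (B 0 t)‖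
          ≤ G * M * (80 * R / ‖centerOfMass ρ M (B 0 t)‖ ^ 3) := by
  obtain ⟨X, hX⟩ := hsol.kinematic 0
  obtain ⟨Y, hY⟩ := hsol.kinematic 1
  have h : IsTransportedBall I T₀ (B 0) v X c R := ⟨hI, hIn, hT, hR, hB0, hsol.isOpen_body 0,
    hsol.velocity_contDiffOn 0, hsol.incompressible 0, hX⟩
  have h' : IsTransportedBall I T₀ (B 1) v Y d R := ⟨hI, hIn, hT, hR, hB1, hsol.isOpen_body 1,
    hsol.velocity_contDiffOn 1, hsol.incompressible 1, hY⟩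
  set V₀ : ℝ := 4 / 3 * Real.pi * R ^ 3 with hV₀
  have hV₀pos : 0 < V₀ := by positivity
  have hρM : ρ / M = V₀⁻¹ := by rw [hM]; field_simp
  have hvol : ∀ t ∈ I, volume.real (B 0 t) = V₀ := fun t ht => h.volume_real_body ht
  refine ⟨?_, fun t => (ρ / M) • ∫ y in ball c R, v t (X t y), fun t => (ρ / M) •
    ∫ x in B 0 t, (derivWithin (fun s => v s x) I t + fderiv ℝ (v t) x (v t x)), ?_, ?_, ?_⟩
  · rw [centerOfMass, hρM, ← hvol T₀ hT.1, hB0, setIntegral_ball_id, smul_smul, inv_mul_cancel₀,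
      one_smul]
    rw [← hB0, hvol T₀ hT.1]
    exact hV₀pos.ne'
  · intro t ht
    exact (h.hasDerivWithinAt_integral_body ht).const_smul (ρ / M)
  · intro t ht
    exact (h.hasDerivWithinAt_integral_velocity ht).const_smul (ρ / M)
  · intro t ht hfar
    set x₁ := centerOfMass ρ M (B 0 t) with hx₁
    have hdiam0 : diam (B 0 t) ≤ 10 * R := by
      have := hdiam t ht
      rwa [hsym t ht, Isometry.diam_image (isometry_iff_dist_eq.2 fun x y => dist_neg_neg x y)] at this
    have key := norm_integral_newtonKernel_sub_le (hsol.isOpen_body 0 t ht).measurableSet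
      (h.isBounded ht) (by rw [hvol t ht]; exact hV₀pos) (x₁ := x₁)
      (by rw [hx₁, centerOfMass, hρM, hvol t ht]) hR hdiam0 hfar
    rw [← hsym t ht, hvol t ht] at key
    simp only
    rw [setIntegral_materialDerivative hsol h h' ht, hρM, smul_smul]
    set F := ∫ x in B 0 t, ∫ y in B 1 t, newtonKernel (x - y)
    have e : (V₀⁻¹ * -(G * ρ)) • F + (G * M * (4 * ‖x₁‖ ^ 3)⁻¹) • x₁
        = -(V₀⁻¹ * (G * ρ)) • (F - (V₀ ^ 2 * (4 * ‖x₁‖ ^ 3)⁻¹) • x₁) := by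
      rw [smul_sub, smul_smul, hM, sub_eq_add_neg, ← neg_smul]
      congr 2
      · ring
      · field_simp
    rw [e, norm_smul, norm_neg, Real.norm_of_nonneg (by positivity)]
    calc V₀⁻¹ * (G * ρ) * ‖F - (V₀ ^ 2 * (4 * ‖x₁‖ ^ 3)⁻¹) • x₁‖
        ≤ V₀⁻¹ * (G * ρ) * (V₀ ^ 2 * (80 * R / ‖x₁‖ ^ 3)) := by gcongr
      _ = G * M * (80 * R / ‖x₁‖ ^ 3) := by rw [hM]; field_simp

/-! ### Comparison of derivatives and the continuity method -/

/-- Takes the place of integrating `f' ≤ g'`: no integrability is required, and `g` can be any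
function of the motion whose growth dominates the drift to be estimated. -/
lemma sub_le_sub_of_hasDerivWithinAt_le {I : Set ℝ} {f g f' g' : ℝ → ℝ} {a b : ℝ} (hab : a ≤ b)
    (hI : Icc a b ⊆ I) (hf : ∀ t ∈ Icc a b, HasDerivWithinAt f (f' t) I t)
    (hg : ∀ t ∈ Icc a b, HasDerivWithinAt g (g' t) I t) (h : ∀ t ∈ Icc a b, f' t ≤ g' t) :
    f b - f a ≤ g b - g a := by
  have hd : ∀ t ∈ Icc a b, HasDerivWithinAt (fun t => g t - f t) (g' t - f' t) (Icc a b) t :=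
    fun t ht => ((hg t ht).sub (hf t ht)).mono hI
  have hm : MonotoneOn (fun t => g t - f t) (Icc a b) := by
    refine monotoneOn_of_hasDerivWithinAt_nonneg (convex_Icc a b)
      (fun t ht => (hd t ht).continuousWithinAt)
      (fun t ht => (hd t (interior_subset ht)).mono interior_subset)
      fun t ht => sub_nonneg.2 (h t (interior_subset ht))
  have := hm (left_mem_Icc.2 hab) (right_mem_Icc.2 hab) hab
  simp only at this
  linarith

lemma abs_sub_le_sub_of_hasDerivWithinAt_le {I : Set ℝ} {f g f' g' : ℝ → ℝ} {a b : ℝ} (hab : a ≤ b)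
    (hI : Icc a b ⊆ I) (hf : ∀ t ∈ Icc a b, HasDerivWithinAt f (f' t) I t)
    (hg : ∀ t ∈ Icc a b, HasDerivWithinAt g (g' t) I t) (h : ∀ t ∈ Icc a b, |f' t| ≤ g' t) :
    |f b - f a| ≤ g b - g a := by
  have h1 := sub_le_sub_of_hasDerivWithinAt_le hab hI hf hg fun t ht => (abs_le.1 (h t ht)).2
  have h2 := sub_le_sub_of_hasDerivWithinAt_le hab hI (fun t ht => (hf t ht).neg) hg
    fun t ht => by linarith [(abs_le.1 (h t ht)).1]
  rw [abs_le]
  constructor <;> simp only [Pi.neg_apply] at h2 <;> linarith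

/-- The continuity method. -/
lemma forall_neg_of_forall_nonpos {φ : ℝ → ℝ} {a b : ℝ} (hφ : ContinuousOn φ (Icc a b))
    (hstep : ∀ t ∈ Icc a b, (∀ s ∈ Ico a t, φ s < 0) → φ t ≤ 0 → φ t < 0)
    (ha : φ a < 0) : ∀ t ∈ Icc a b, φ t < 0 := by
  by_contra! hcon
  obtain ⟨t, ht, htn⟩ := hcon
  have hclosed : IsClosed (Icc a b ∩ φ ⁻¹' Ici 0) :=
    hφ.preimage_isClosed_of_isClosed isClosed_Icc isClosed_Ici
  obtain ⟨τ, ⟨hτ, hτ0⟩, hmin⟩ := (isCompact_Icc.of_isClosed_subset hclosed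
    inter_subset_left).exists_isLeast ⟨t, ht, htn⟩
  have hbefore : ∀ s ∈ Ico a τ, φ s < 0 := by
    intro s hs
    by_contra! h
    exact not_lt.2 (hmin ⟨⟨hs.1, hs.2.le.trans hτ.2⟩, h⟩) hs.2
  have haτ : a < τ := lt_of_le_of_ne hτ.1 fun e => by
    rw [← e] at hτ0
    exact not_lt.2 hτ0 ha
  have hle : φ τ ≤ 0 := by
    have hc : Tendsto φ (𝓝[Ico a τ] τ) (𝓝 (φ τ)) :=
      (hφ τ hτ).mono fun s hs => ⟨hs.1, hs.2.le.trans hτ.2⟩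
    have : (𝓝[Ico a τ] τ).NeBot := by
      rw [← mem_closure_iff_nhdsWithin_neBot, closure_Ico haτ.ne]
      exact right_mem_Icc.2 haτ.le
    exact le_of_tendsto hc (by filter_upwards [self_mem_nhdsWithin] with s hs using (hbefore s hs).le)
  exact not_lt.2 hτ0 (hstep τ hτ hbefore hle)

/-! ### The perturbed Kepler motion in normalized units -/

section Algebra

variable {s n σ w : ℝ}

/-- Here `s` is the distance, `n` the squared speed and `σ` the inner product of position and
velocity. The energy keeps `n * s` near `1 / 2`, so `s ≤ 3 / 2` would leave `s² n` below the `39 /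
40` that the angular momentum demands. -/
lemma three_halves_lt (hs : 0 ≤ s) (hw' : w ≤ 1 / 10000)
    (hP : |n * s - 1 / 2 - w * s| ≤ 1 / 40) (hΛ : |s ^ 2 * n - σ ^ 2 - 1| ≤ 1 / 40) :
    3 / 2 < s := by
  by_contra! h
  rw [abs_le] at hP hΛ
  have h1 : s ^ 2 * n = s * (n * s) := by ring
  have h2 : s * (n * s) ≤ 3 / 2 * (21 / 40 + 1 / 10000 * (3 / 2)) := by
    have : n * s ≤ 21 / 40 + 1 / 10000 * (3 / 2) := by nlinarith
    nlinarith
  nlinarith [sq_nonneg σ]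

/-- The exact relation is `σ² = w s² + s/2 - 1`. The two errors reduce the right side to `w s² + 19
s/40 - 41/40`, and `s ≥ 3` just suffices to retain `s/8`. -/
lemma sq_ge_of_three_le (hs : 3 ≤ s)
    (hP : |n * s - 1 / 2 - w * s| ≤ 1 / 40) (hΛ : |s ^ 2 * n - σ ^ 2 - 1| ≤ 1 / 40) :
    w * s ^ 2 + s / 8 ≤ σ ^ 2 := by
  rw [abs_le] at hP hΛ
  have h1 : s ^ 2 * n = s * (n * s) := by ring
  have h2 : s * (19 / 40 + w * s) ≤ s * (n * s) := by
    apply mul_le_mul_of_nonneg_left _ (by linarith)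
    linarith
  nlinarith

/-- Closeness is stated for the energy defect multiplied by the distance, so far away the defect
itself must be shown to decay. -/
lemma energy_error (hs : 0 < s) :
    n * s - 1 / 2 - w * s = (n - (2 * s)⁻¹ - w) * s := by
  field_simp

end Algebra

/-- A motion in a perturbed inverse square field, in units in which the initial angular momentum
is `1`, on the time interval `I`. -/
structure IsPerturbedKeplerMotion {E : Type*} [NormedAddCommGroup E] [InnerProductSpace ℝ E]
    (I : Set ℝ) (T₀ m w : ℝ) (ξ u e : ℝ → E) : Prop where
  ordConnected : I.OrdConnected
  isLeast : IsLeast I T₀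
  rate_pos : 0 < m
  position : ∀ t ∈ I, HasDerivWithinAt ξ (m • u t) I t
  velocity : ∀ t ∈ I, HasDerivWithinAt u (-m • ((4 * ‖ξ t‖ ^ 3)⁻¹ • ξ t + e t)) I t
  perturbation : ∀ t ∈ I, 1 ≤ ‖ξ t‖ → ‖e t‖ ≤ 1 / 10000 / ‖ξ t‖ ^ 3
  angularMomentum : ‖ξ T₀‖ ^ 2 * ‖u T₀‖ ^ 2 - inner ℝ (ξ T₀) (u T₀) ^ 2 = 1
  energy : w = ‖u T₀‖ ^ 2 - (2 * ‖ξ T₀‖)⁻¹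
  energy_pos : 0 < w
  speed_le : ‖u T₀‖ ^ 2 ≤ 1 / 10000
  inward : inner ℝ (ξ T₀) (u T₀) < 0

namespace IsPerturbedKeplerMotion

variable {E : Type*} [NormedAddCommGroup E] [InnerProductSpace ℝ E] {I : Set ℝ} {T₀ m w : ℝ}
  {ξ u e : ℝ → E}

lemma Icc_subset (h : IsPerturbedKeplerMotion I T₀ m w ξ u e) {a b : ℝ} (ha : a ∈ I) (hb : b ∈ I) :
    Icc a b ⊆ I := h.ordConnected.out ha hb

lemma norm_ne_zero_initial (h : IsPerturbedKeplerMotion I T₀ m w ξ u e) : 0 < ‖ξ T₀‖ := by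
  refine lt_of_le_of_ne (norm_nonneg _) fun hz => ?_
  have := norm_eq_zero.1 hz.symm
  have h2 := h.inward
  rw [this, inner_zero_left] at h2
  exact lt_irrefl _ h2

lemma energy_le (h : IsPerturbedKeplerMotion I T₀ m w ξ u e) : w ≤ 1 / 10000 := by
  rw [h.energy]
  have : 0 < (2 * ‖ξ T₀‖)⁻¹ := by have := h.norm_ne_zero_initial; positivity
  linarith [h.speed_le]

lemma hasDerivWithinAt_dist (h : IsPerturbedKeplerMotion I T₀ m w ξ u e) {t : ℝ} (ht : t ∈ I)
    (hs : 0 < ‖ξ t‖) :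
    HasDerivWithinAt (fun t => ‖ξ t‖) (m * (inner ℝ (ξ t) (u t) / ‖ξ t‖)) I t := by
  have h1 := ((h.position t ht).norm_sq).sqrt (by positivity)
  simp only [Real.sqrt_sq (norm_nonneg _)] at h1
  refine h1.congr_deriv ?_
  rw [real_inner_smul_right]
  field_simp

lemma hasDerivWithinAt_sq_speed (h : IsPerturbedKeplerMotion I T₀ m w ξ u e) {t : ℝ} (ht : t ∈ I) :
    HasDerivWithinAt (fun t => ‖u t‖ ^ 2)
      (-2 * m * ((4 * ‖ξ t‖ ^ 3)⁻¹ * inner ℝ (ξ t) (u t) + inner ℝ (u t) (e t))) I t := by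
  refine (h.velocity t ht).norm_sq.congr_deriv ?_
  rw [real_inner_smul_right, inner_add_right, real_inner_smul_right, real_inner_comm (u t)]
  ring

lemma hasDerivWithinAt_inner (h : IsPerturbedKeplerMotion I T₀ m w ξ u e) {t : ℝ} (ht : t ∈ I)
    (hs : 0 < ‖ξ t‖) : HasDerivWithinAt (fun t => inner ℝ (ξ t) (u t))
      (m * (‖u t‖ ^ 2 - (4 * ‖ξ t‖)⁻¹ - inner ℝ (ξ t) (e t))) I t := by
  refine ((h.position t ht).inner ℝ (h.velocity t ht)).congr_deriv ?_
  rw [real_inner_smul_right, inner_add_right, real_inner_smul_right, real_inner_smul_left,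
    real_inner_self_eq_norm_sq, real_inner_self_eq_norm_sq]
  field_simp
  ring

lemma hasDerivWithinAt_energy (h : IsPerturbedKeplerMotion I T₀ m w ξ u e) {t : ℝ} (ht : t ∈ I)
    (hs : 0 < ‖ξ t‖) : HasDerivWithinAt (fun t => ‖u t‖ ^ 2 - (2 * ‖ξ t‖)⁻¹)
      (-2 * m * inner ℝ (u t) (e t)) I t := by
  have h1 := ((h.hasDerivWithinAt_dist ht hs).const_mul 2).fun_inv (by positivity)
  refine ((h.hasDerivWithinAt_sq_speed ht).sub h1).congr_deriv ?_
  field_simp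
  ring

/-- The vector paired with `e t` is `‖ξ t‖²` times the component of `u t` orthogonal to `ξ t`: a
radial force does not change the angular momentum. -/
lemma hasDerivWithinAt_angularMomentum (h : IsPerturbedKeplerMotion I T₀ m w ξ u e) {t : ℝ}
    (ht : t ∈ I) (hs : 0 < ‖ξ t‖) :
    HasDerivWithinAt (fun t => ‖ξ t‖ ^ 2 * ‖u t‖ ^ 2 - inner ℝ (ξ t) (u t) ^ 2)
      (-2 * m * inner ℝ (‖ξ t‖ ^ 2 • u t - inner ℝ (ξ t) (u t) • ξ t) (e t)) I t := by
  refine (((h.position t ht).norm_sq.mul (h.hasDerivWithinAt_sq_speed ht)).sub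
    ((h.hasDerivWithinAt_inner ht hs).fun_pow 2)).congr_deriv ?_
  rw [inner_sub_left, real_inner_smul_left, real_inner_smul_left, real_inner_smul_right]
  field_simp
  ring

lemma hasDerivWithinAt_radialVelocity (h : IsPerturbedKeplerMotion I T₀ m w ξ u e) {t : ℝ}
    (ht : t ∈ I) (hs : 0 < ‖ξ t‖) :
    HasDerivWithinAt (fun t => inner ℝ (ξ t) (u t) / ‖ξ t‖)
      (m * ((‖ξ t‖ ^ 2 * ‖u t‖ ^ 2 - inner ℝ (ξ t) (u t) ^ 2) / ‖ξ t‖ ^ 3 - (4 * ‖ξ t‖ ^ 2)⁻¹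
        - inner ℝ (ξ t) (e t) / ‖ξ t‖)) I t := by
  refine ((h.hasDerivWithinAt_inner ht hs).div (h.hasDerivWithinAt_dist ht hs) hs.ne').congr_deriv ?_
  field_simp
  ring

lemma abs_inner_perturbation_le (h : IsPerturbedKeplerMotion I T₀ m w ξ u e) {t : ℝ}
    (ht : t ∈ I) (hs : 1 ≤ ‖ξ t‖) (a : E) :
    |inner ℝ a (e t)| ≤ ‖a‖ * (1 / 10000 / ‖ξ t‖ ^ 3) :=
  (abs_real_inner_le_norm _ _).trans (by gcongr; exact h.perturbation t ht hs)

/-- The state at time `t` is close to that of the unperturbed motion. -/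
def IsClose (w : ℝ) (ξ u : ℝ → E) (t : ℝ) : Prop :=
  |‖ξ t‖ ^ 2 * ‖u t‖ ^ 2 - inner ℝ (ξ t) (u t) ^ 2 - 1| ≤ 1 / 40 ∧
    |‖u t‖ ^ 2 * ‖ξ t‖ - 1 / 2 - w * ‖ξ t‖| ≤ 1 / 40

lemma IsClose.lt (h : IsPerturbedKeplerMotion I T₀ m w ξ u e) {t : ℝ} (hc : IsClose w ξ u t) :
    3 / 2 < ‖ξ t‖ := three_halves_lt (norm_nonneg _) h.energy_le hc.2 hc.1

lemma IsClose.speed_le_one (h : IsPerturbedKeplerMotion I T₀ m w ξ u e) {t : ℝ}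
    (hc : IsClose w ξ u t) : ‖u t‖ ≤ 1 := by
  have h1 := hc.lt h
  have h2 := (abs_le.1 hc.2).2
  have h3 := h.energy_le
  by_contra! h4
  have : 1 < ‖u t‖ ^ 2 := by nlinarith
  nlinarith

lemma IsClose.abs_deriv_angularMomentum_le (h : IsPerturbedKeplerMotion I T₀ m w ξ u e) {t : ℝ}
    (ht : t ∈ I) (hc : IsClose w ξ u t) :
    |-2 * m * inner ℝ (‖ξ t‖ ^ 2 • u t - inner ℝ (ξ t) (u t) • ξ t) (e t)|
      ≤ m * (3 / 10000 / ‖ξ t‖ ^ 2) := by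
  have hm := h.rate_pos
  have hs := hc.lt h
  have h1 := h.abs_inner_perturbation_le ht (by linarith)
    (‖ξ t‖ ^ 2 • u t - inner ℝ (ξ t) (u t) • ξ t)
  have h2 : ‖‖ξ t‖ ^ 2 • u t - inner ℝ (ξ t) (u t) • ξ t‖ ≤ 3 / 2 * ‖ξ t‖ := by
    refine abs_le_of_sq_le_sq' ?_ (by positivity) |>.2
    have e : ‖‖ξ t‖ ^ 2 • u t - inner ℝ (ξ t) (u t) • ξ t‖ ^ 2
        = ‖ξ t‖ ^ 2 * (‖ξ t‖ ^ 2 * ‖u t‖ ^ 2 - inner ℝ (ξ t) (u t) ^ 2) := by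
      rw [norm_sub_sq_real, norm_smul, norm_smul, real_inner_smul_left, real_inner_smul_right,
        real_inner_comm (ξ t) (u t), Real.norm_eq_abs, Real.norm_eq_abs, mul_pow, mul_pow, sq_abs,
        sq_abs]
      ring
    rw [e, mul_pow]
    nlinarith [(abs_le.1 hc.1).2, sq_nonneg ‖ξ t‖]
  rw [abs_mul, abs_mul, abs_of_pos hm, abs_neg, abs_two]
  calc 2 * m * |inner ℝ (‖ξ t‖ ^ 2 • u t - inner ℝ (ξ t) (u t) • ξ t) (e t)|
      ≤ 2 * m * (3 / 2 * ‖ξ t‖ * (1 / 10000 / ‖ξ t‖ ^ 3)) := by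
        gcongr
        exact h1.trans (by gcongr)
    _ = m * (3 / 10000 / ‖ξ t‖ ^ 2) := by field_simp

lemma IsClose.abs_deriv_energy_le (h : IsPerturbedKeplerMotion I T₀ m w ξ u e) {t : ℝ}
    (ht : t ∈ I) (hc : IsClose w ξ u t) :
    |-2 * m * inner ℝ (u t) (e t)| ≤ m * (2 / 10000 * ‖u t‖ / ‖ξ t‖ ^ 3) := by
  have hm := h.rate_pos
  have hs := hc.lt h
  have h1 := h.abs_inner_perturbation_le ht (by linarith) (u t)
  rw [abs_mul, abs_mul, abs_of_pos hm, abs_neg, abs_two]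
  calc 2 * m * |inner ℝ (u t) (e t)| ≤ 2 * m * (‖u t‖ * (1 / 10000 / ‖ξ t‖ ^ 3)) := by gcongr
    _ = _ := by ring

/-- Up to distance 3 the centrifugal term, at least `(39/40) / s³`, beats the attraction `1 / (4
s²)`, which is at most `(3/4) / s³`. The radial velocity therefore grows at a definite rate even
where it vanishes. -/
lemma IsClose.le_deriv_radialVelocity (h : IsPerturbedKeplerMotion I T₀ m w ξ u e) {t : ℝ}
    (ht : t ∈ I) (hc : IsClose w ξ u t) (hs3 : ‖ξ t‖ ≤ 3) :
    m * (1 / 24 / ‖ξ t‖ ^ 2) ≤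
      m * ((‖ξ t‖ ^ 2 * ‖u t‖ ^ 2 - inner ℝ (ξ t) (u t) ^ 2) / ‖ξ t‖ ^ 3 - (4 * ‖ξ t‖ ^ 2)⁻¹
        - inner ℝ (ξ t) (e t) / ‖ξ t‖) := by
  have hm := h.rate_pos
  have hs := hc.lt h
  have h1 := (abs_le.1 (h.abs_inner_perturbation_le ht (by linarith) (ξ t))).2
  have hpos : 0 < ‖ξ t‖ := by linarith
  refine mul_le_mul_of_nonneg_left ?_ hm.le
  have h2 : inner ℝ (ξ t) (e t) / ‖ξ t‖ ≤ 1 / 10000 / ‖ξ t‖ ^ 3 := by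
    rw [div_le_iff₀ hpos, mul_comm]; exact h1
  have h3 : (39 / 40) / ‖ξ t‖ ^ 3
      ≤ (‖ξ t‖ ^ 2 * ‖u t‖ ^ 2 - inner ℝ (ξ t) (u t) ^ 2) / ‖ξ t‖ ^ 3 := by
    gcongr; linarith [(abs_le.1 hc.1).1]
  have h4 : 1 / 24 / ‖ξ t‖ ^ 2 + (4 * ‖ξ t‖ ^ 2)⁻¹ ≤ (39 / 40 - 1 / 10000) / ‖ξ t‖ ^ 3 := by
    rw [le_div_iff₀ (by positivity)]
    have : (1 / 24 / ‖ξ t‖ ^ 2 + (4 * ‖ξ t‖ ^ 2)⁻¹) * ‖ξ t‖ ^ 3 = 7 / 24 * ‖ξ t‖ := by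
      field_simp; norm_num
    rw [this]; linarith
  rw [sub_div] at h4
  linarith

lemma IsClose.deriv_radialVelocity_le (h : IsPerturbedKeplerMotion I T₀ m w ξ u e) {t : ℝ}
    (ht : t ∈ I) (hc : IsClose w ξ u t) :
    m * ((‖ξ t‖ ^ 2 * ‖u t‖ ^ 2 - inner ℝ (ξ t) (u t) ^ 2) / ‖ξ t‖ ^ 3 - (4 * ‖ξ t‖ ^ 2)⁻¹
        - inner ℝ (ξ t) (e t) / ‖ξ t‖) ≤ m / 3 := by
  have hm := h.rate_pos
  have hs := hc.lt h
  have h1 := (abs_le.1 (h.abs_inner_perturbation_le ht (by linarith) (ξ t))).1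
  have hpos : 0 < ‖ξ t‖ := by linarith
  rw [div_eq_mul_one_div m]
  refine mul_le_mul_of_nonneg_left ?_ hm.le
  have h2 : -(1 / 10000 / ‖ξ t‖ ^ 3) ≤ inner ℝ (ξ t) (e t) / ‖ξ t‖ := by
    rw [le_div_iff₀ hpos]; linarith
  have h3 : (‖ξ t‖ ^ 2 * ‖u t‖ ^ 2 - inner ℝ (ξ t) (u t) ^ 2) / ‖ξ t‖ ^ 3
      ≤ (41 / 40) / ‖ξ t‖ ^ 3 := by
    gcongr; linarith [(abs_le.1 hc.1).2]
  have h4 : (41 / 40 + 1 / 10000) / ‖ξ t‖ ^ 3 ≤ 1 / 3 := by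
    rw [div_le_iff₀ (by positivity)]
    have : (3 / 2) ^ 3 ≤ ‖ξ t‖ ^ 3 := by gcongr
    linarith
  have h5 : 0 ≤ (4 * ‖ξ t‖ ^ 2)⁻¹ := by positivity
  rw [add_div] at h4
  linarith

lemma antitoneOn_dist (h : IsPerturbedKeplerMotion I T₀ m w ξ u e) {a b : ℝ} (ha : a ∈ I)
    (hb : b ∈ I) (hc : ∀ τ ∈ Icc a b, IsClose w ξ u τ)
    (hσ : ∀ τ ∈ Icc a b, inner ℝ (ξ τ) (u τ) ≤ 0) : AntitoneOn (fun t => ‖ξ t‖) (Icc a b) := by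
  have hsub := h.Icc_subset ha hb
  intro x hx y hy hxy
  have hxy' : Icc x y ⊆ Icc a b := Icc_subset_Icc hx.1 hy.2
  have := sub_le_sub_of_hasDerivWithinAt_le (I := I) (f := fun t => ‖ξ t‖) (g := fun _ => 0)
    (g' := fun _ => 0) hxy (hxy'.trans hsub)
    (fun t ht => h.hasDerivWithinAt_dist (hsub (hxy' ht))
      (by linarith [(hc t (hxy' ht)).lt h]))
    (fun t _ => hasDerivWithinAt_const _ _ _) fun t ht => by
      have h1 := hσ t (hxy' ht)
      have h2 := h.rate_pos
      exact mul_nonpos_of_nonneg_of_nonpos h2.le (div_nonpos_of_nonpos_of_nonneg h1 (norm_nonneg _))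
  simp only at this ⊢
  linarith

/-- The conserved quantities vary little while the motion is inward and the distance is large. -/
lemma estimate_far (h : IsPerturbedKeplerMotion I T₀ m w ξ u e) {t : ℝ} (ht : t ∈ I)
    (hc : ∀ τ ∈ Icc T₀ t, IsClose w ξ u τ) (hσ : ∀ τ ∈ Icc T₀ t, inner ℝ (ξ τ) (u τ) ≤ 0)
    (hs : 3 ≤ ‖ξ t‖) :
    |‖ξ t‖ ^ 2 * ‖u t‖ ^ 2 - inner ℝ (ξ t) (u t) ^ 2 - 1| ≤ 18 / 10000 ∧
      |‖u t‖ ^ 2 - (2 * ‖ξ t‖)⁻¹ - w| ≤ 3 / 10000 / ‖ξ t‖ ^ 2 := by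
  have hm := h.rate_pos
  have hle := h.isLeast.2 ht
  have hsub := h.Icc_subset h.isLeast.1 ht
  have hanti := h.antitoneOn_dist h.isLeast.1 ht hc hσ
  have hs3 : ∀ τ ∈ Icc T₀ t, 3 ≤ ‖ξ τ‖ := fun τ hτ =>
    hs.trans (hanti hτ (right_mem_Icc.2 hle) hτ.2)
  have hσ2 : ∀ τ ∈ Icc T₀ t, w * ‖ξ τ‖ ^ 2 + ‖ξ τ‖ / 8 ≤ inner ℝ (ξ τ) (u τ) ^ 2 := fun τ hτ =>
    sq_ge_of_three_le (hs3 τ hτ) (hc τ hτ).2 (hc τ hτ).1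
  have hw := h.energy_pos
  constructor
  · have key := abs_sub_le_sub_of_hasDerivWithinAt_le hle hsub
      (fun τ hτ => h.hasDerivWithinAt_angularMomentum (hsub hτ) (by linarith [hs3 τ hτ]))
      -- Since `-σ ≥ √s / 3`, the derivative of `s^(-1/2)` is at least `m / (6 s²)`; the factor `18
      -- = 6 * 3` matches the drift bound `m * (3 / 10000) / s²`.
      (g := fun t => 18 / 10000 * (√‖ξ t‖)⁻¹)
      (fun τ hτ => (((h.hasDerivWithinAt_dist (hsub hτ) (by linarith [hs3 τ hτ])).sqrt
        (by linarith [hs3 τ hτ])).fun_inv (by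
          have := hs3 τ hτ
          have : 0 < ‖ξ τ‖ := by linarith
          positivity)).const_mul _) fun τ hτ => by
        refine ((hc τ hτ).abs_deriv_angularMomentum_le h (hsub hτ)).trans ?_
        have h0 : 0 < ‖ξ τ‖ := by linarith [hs3 τ hτ]
        have hq : 0 < √‖ξ τ‖ := Real.sqrt_pos.2 h0
        have hqq : √‖ξ τ‖ ^ 2 = ‖ξ τ‖ := Real.sq_sqrt h0.le
        have h1 : √‖ξ τ‖ / 3 ≤ -inner ℝ (ξ τ) (u τ) := by
          refine abs_le_of_sq_le_sq' ?_ (by linarith [hσ τ hτ]) |>.2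
          have := hσ2 τ hτ
          rw [div_pow, hqq, neg_sq]
          nlinarith [mul_nonneg hw.le (sq_nonneg ‖ξ τ‖)]
        have e : 18 / 10000 * (-(m * (inner ℝ (ξ τ) (u τ) / ‖ξ τ‖) / (2 * √‖ξ τ‖)) / √‖ξ τ‖ ^ 2)
            = m * (9 / 10000 * (-inner ℝ (ξ τ) (u τ) / √‖ξ τ‖) / ‖ξ τ‖ ^ 2) := by
          rw [hqq]; field_simp; ring
        rw [e]
        have h2 : 1 / 3 ≤ -inner ℝ (ξ τ) (u τ) / √‖ξ τ‖ := by
          rw [le_div_iff₀ hq]; linarith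
        gcongr
        linarith
    simp only [h.angularMomentum] at key
    refine key.trans ?_
    have h1 : (√‖ξ t‖)⁻¹ ≤ 1 := by
      refine inv_le_one_of_one_le₀ ?_
      rw [Real.one_le_sqrt]; linarith
    have h2 : 0 ≤ (√‖ξ T₀‖)⁻¹ := by positivity
    linarith
  · have key := abs_sub_le_sub_of_hasDerivWithinAt_le hle hsub
      (fun τ hτ => h.hasDerivWithinAt_energy (hsub hτ) (by linarith [hs3 τ hτ]))
      -- An inverse square of the distance is available because `‖u‖ s ≤ -3σ`; its decay survives
      -- the later multiplication by `s`.
      (g := fun t => 3 / 10000 * (‖ξ t‖ ^ 2)⁻¹)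
      (fun τ hτ => (((h.hasDerivWithinAt_dist (hsub hτ) (by linarith [hs3 τ hτ])).fun_pow
        2).fun_inv (by
          have := hs3 τ hτ
          have : 0 < ‖ξ τ‖ := by linarith
          positivity)).const_mul _) fun τ hτ => by
        refine ((hc τ hτ).abs_deriv_energy_le h (hsub hτ)).trans ?_
        have h0 : 0 < ‖ξ τ‖ := by linarith [hs3 τ hτ]
        have h1 : ‖u τ‖ * ‖ξ τ‖ ≤ 3 * -inner ℝ (ξ τ) (u τ) := by
          refine abs_le_of_sq_le_sq' ?_ (by linarith [hσ τ hτ]) |>.2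
          have h3 := hσ2 τ hτ
          have h4 := (abs_le.1 (hc τ hτ).2).2
          have h5 : (‖u τ‖ * ‖ξ τ‖) ^ 2 = (‖u τ‖ ^ 2 * ‖ξ τ‖) * ‖ξ τ‖ := by ring
          have h6 : (‖u τ‖ ^ 2 * ‖ξ τ‖) * ‖ξ τ‖ ≤ (21 / 40 + w * ‖ξ τ‖) * ‖ξ τ‖ := by
            gcongr; linarith
          rw [h5]
          nlinarith [mul_nonneg hw.le (sq_nonneg ‖ξ τ‖)]
        have e : 3 / 10000 * (-(2 * ‖ξ τ‖ ^ (2 - 1) * (m * (inner ℝ (ξ τ) (u τ) / ‖ξ τ‖)))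
            / (‖ξ τ‖ ^ 2) ^ 2) = m * (2 / 10000 * (3 * -inner ℝ (ξ τ) (u τ)) / ‖ξ τ‖ ^ 4) := by
          rw [show 2 - 1 = 1 from rfl, pow_one]; field_simp
        have e' : m * (2 / 10000 * ‖u τ‖ / ‖ξ τ‖ ^ 3)
            = m * (2 / 10000 * (‖u τ‖ * ‖ξ τ‖) / ‖ξ τ‖ ^ 4) := by
          field_simp
        rw [e']
        refine le_of_le_of_eq ?_ e.symm
        gcongr
    simp only [← h.energy] at key
    refine key.trans ?_
    have h2 : 0 ≤ (‖ξ T₀‖ ^ 2)⁻¹ := by positivity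
    rw [div_eq_mul_inv (3 / 10000)]
    linarith

/-- The conserved quantities vary little while the motion is inward. -/
lemma estimate (h : IsPerturbedKeplerMotion I T₀ m w ξ u e) {t : ℝ} (ht : t ∈ I)
    (hc : ∀ τ ∈ Icc T₀ t, IsClose w ξ u τ) (hσ : ∀ τ ∈ Icc T₀ t, inner ℝ (ξ τ) (u τ) ≤ 0) :
    |‖ξ t‖ ^ 2 * ‖u t‖ ^ 2 - inner ℝ (ξ t) (u t) ^ 2 - 1| < 1 / 40 ∧
      |‖u t‖ ^ 2 * ‖ξ t‖ - 1 / 2 - w * ‖ξ t‖| < 1 / 40 := by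
  have hm := h.rate_pos
  have hle := h.isLeast.2 ht
  have hct := hc t (right_mem_Icc.2 hle)
  have hpos : 0 < ‖ξ t‖ := by linarith [hct.lt h]
  rw [energy_error hpos, abs_mul, abs_of_pos hpos]
  rcases le_total 3 ‖ξ t‖ with h3 | h3
  · obtain ⟨h1, h2⟩ := h.estimate_far ht hc hσ h3
    refine ⟨by linarith, ?_⟩
    calc _ ≤ 3 / 10000 / ‖ξ t‖ ^ 2 * ‖ξ t‖ := by gcongr
      _ = 3 / 10000 / ‖ξ t‖ := by field_simp
      _ ≤ 3 / 10000 / 3 := by gcongr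
      _ < 1 / 40 := by norm_num
  · have hsub := h.Icc_subset h.isLeast.1 ht
    have hcont : ContinuousOn (fun t => ‖ξ t‖) (Icc T₀ t) := fun τ hτ =>
      ((h.position τ (hsub hτ)).continuousWithinAt.norm).mono hsub
    -- Angular momentum 1 and speed at most `1 / 100` in fact force an initial distance of at least
    -- 100.
    have hinit : 3 ≤ ‖ξ T₀‖ := by
      have h1 := h.angularMomentum
      have h2 := h.speed_le
      by_contra! h4
      nlinarith [sq_nonneg (inner ℝ (ξ T₀) (u T₀)), norm_nonneg (ξ T₀), norm_nonneg (u T₀),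
        sq_nonneg ‖ξ T₀‖, sq_nonneg ‖u T₀‖]
    -- At `t₁` the distance is 3. Up to then the distance is the clock, afterwards the radial
    -- velocity, which varies by at most 1.
    obtain ⟨t₁, ht₁, he₁⟩ := intermediate_value_Icc' hle hcont ⟨h3, hinit⟩
    have hsub₁ : Icc t₁ t ⊆ Icc T₀ t := Icc_subset_Icc_left ht₁.1
    have hsub₀ : Icc T₀ t₁ ⊆ Icc T₀ t := Icc_subset_Icc_right ht₁.2
    obtain ⟨h1, h2⟩ := h.estimate_far (hsub ht₁) (fun τ hτ => hc τ (hsub₀ hτ))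
      (fun τ hτ => hσ τ (hsub₀ hτ)) (le_of_eq he₁.symm)
    have hanti := h.antitoneOn_dist h.isLeast.1 ht hc hσ
    have hs3 : ∀ τ ∈ Icc t₁ t, ‖ξ τ‖ ≤ 3 := fun τ hτ => by
      rw [← he₁]; exact hanti ht₁ (hsub₁ hτ) hτ.1
    have hspos : ∀ τ ∈ Icc t₁ t, 0 < ‖ξ τ‖ := fun τ hτ => by
      linarith [(hc τ (hsub₁ hτ)).lt h]
    have hρ : ∀ τ ∈ Icc t₁ t, HasDerivWithinAt _ _ I τ := fun τ hτ =>
      h.hasDerivWithinAt_radialVelocity (hsub (hsub₁ hτ)) (hspos τ hτ)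
    have hρ' := fun τ (hτ : τ ∈ Icc t₁ t) =>
      (hc τ (hsub₁ hτ)).le_deriv_radialVelocity h (hsub (hsub₁ hτ)) (hs3 τ hτ)
    have hvar : inner ℝ (ξ t) (u t) / ‖ξ t‖ - inner ℝ (ξ t₁) (u t₁) / ‖ξ t₁‖ ≤ 1 := by
      have a1 : inner ℝ (ξ t) (u t) / ‖ξ t‖ ≤ 0 :=
        div_nonpos_of_nonpos_of_nonneg (hσ t (right_mem_Icc.2 hle)) hpos.le
      have a2 : -1 ≤ inner ℝ (ξ t₁) (u t₁) / ‖ξ t₁‖ := by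
        have hp1 := hspos t₁ (left_mem_Icc.2 ht₁.2)
        rw [le_div_iff₀ hp1]
        have b1 := (abs_le.1 (abs_real_inner_le_norm (ξ t₁) (u t₁))).1
        have b2 := (hc t₁ ht₁).speed_le_one h
        nlinarith
      linarith
    -- `72 = 3 * 24`: the drift `3 / 10000 / s²` is measured against the growth `1 / 24 / s²` of the
    -- radial velocity. Likewise `48 = 2 * 24` for the energy, where `‖u‖ ≤ s` is also used.
    have k1 := abs_sub_le_sub_of_hasDerivWithinAt_le ht₁.2 (hsub₁.trans hsub)
      (fun τ hτ => h.hasDerivWithinAt_angularMomentum (hsub (hsub₁ hτ)) (hspos τ hτ))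
      (fun τ hτ => (hρ τ hτ).const_mul (72 / 10000)) fun τ hτ => by
        refine ((hc τ (hsub₁ hτ)).abs_deriv_angularMomentum_le h (hsub (hsub₁ hτ))).trans ?_
        have e : m * (3 / 10000 / ‖ξ τ‖ ^ 2) = 72 / 10000 * (m * (1 / 24 / ‖ξ τ‖ ^ 2)) := by ring
        rw [e]
        exact mul_le_mul_of_nonneg_left (hρ' τ hτ) (by norm_num)
    have k2 := abs_sub_le_sub_of_hasDerivWithinAt_le ht₁.2 (hsub₁.trans hsub)
      (fun τ hτ => h.hasDerivWithinAt_energy (hsub (hsub₁ hτ)) (hspos τ hτ))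
      (fun τ hτ => (hρ τ hτ).const_mul (48 / 10000)) fun τ hτ => by
        refine ((hc τ (hsub₁ hτ)).abs_deriv_energy_le h (hsub (hsub₁ hτ))).trans ?_
        refine le_trans ?_ (mul_le_mul_of_nonneg_left (hρ' τ hτ) (by norm_num))
        have e : 48 / 10000 * (m * (1 / 24 / ‖ξ τ‖ ^ 2)) = m * (2 / 10000 / ‖ξ τ‖ ^ 2) := by ring
        have e' : m * (2 / 10000 * ‖u τ‖ / ‖ξ τ‖ ^ 3)
            = m * (2 / 10000 / ‖ξ τ‖ ^ 2) * (‖u τ‖ / ‖ξ τ‖) := by ring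
        rw [e, e']
        have b1 := (hc τ (hsub₁ hτ)).speed_le_one h
        have b2 := (hc τ (hsub₁ hτ)).lt h
        refine mul_le_of_le_one_right (by positivity) ?_
        rw [div_le_one (hspos τ hτ)]
        linarith
    rw [← mul_sub] at k1 k2
    simp only [he₁] at k1 k2 h1 h2
    simp only [he₁] at hvar
    rw [abs_le] at k1 k2 h1 h2
    have c1 : |‖u t‖ ^ 2 - (2 * ‖ξ t‖)⁻¹ - w| ≤ 51 / 10000 := by
      rw [abs_le]; constructor <;> linarith
    refine ⟨?_, ?_⟩
    · rw [abs_lt]; constructor <;> linarith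
    · nlinarith [abs_nonneg (‖u t‖ ^ 2 - (2 * ‖ξ t‖)⁻¹ - w)]

/-- Before the first turning point the motion stays close to the unperturbed motion. -/
theorem isClose (h : IsPerturbedKeplerMotion I T₀ m w ξ u e) {t : ℝ} (ht : t ∈ I)
    (hσ : ∀ τ ∈ I, τ < t → inner ℝ (ξ τ) (u τ) < 0) :
    IsClose w ξ u t ∧ inner ℝ (ξ t) (u t) ≤ 0 := by
  have hle := h.isLeast.2 ht
  have hsub := h.Icc_subset h.isLeast.1 ht
  have hξ : ContinuousOn ξ (Icc T₀ t) := fun τ hτ =>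
    (h.position τ (hsub hτ)).continuousWithinAt.mono hsub
  have hu : ContinuousOn u (Icc T₀ t) := fun τ hτ =>
    (h.velocity τ (hsub hτ)).continuousWithinAt.mono hsub
  have hσt : inner ℝ (ξ t) (u t) ≤ 0 := by
    rcases hle.eq_or_lt with heq | hlt
    · rw [← heq]; exact h.inward.le
    · have hc : Tendsto (fun τ => inner ℝ (ξ τ) (u τ)) (𝓝[Ico T₀ t] t) (𝓝 (inner ℝ (ξ t) (u t))) :=
        ((hξ.inner hu) t (right_mem_Icc.2 hle)).mono Ico_subset_Icc_self
      have : (𝓝[Ico T₀ t] t).NeBot := by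
        rw [← mem_closure_iff_nhdsWithin_neBot, closure_Ico hlt.ne]
        exact right_mem_Icc.2 hle
      refine le_of_tendsto hc ?_
      filter_upwards [self_mem_nhdsWithin] with s hs
      exact (hσ s (hsub (Ico_subset_Icc_self hs)) hs.2).le
  refine ⟨?_, hσt⟩
  have hσ' : ∀ τ ∈ Icc T₀ t, inner ℝ (ξ τ) (u τ) ≤ 0 := by
    intro τ hτ
    rcases hτ.2.eq_or_lt with heq | hlt
    · rw [heq]; exact hσt
    · exact (hσ τ (hsub hτ) hlt).le
  have key := forall_neg_of_forall_nonpos (a := T₀) (b := t) (φ := fun τ =>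
    max |‖ξ τ‖ ^ 2 * ‖u τ‖ ^ 2 - inner ℝ (ξ τ) (u τ) ^ 2 - 1|
      |‖u τ‖ ^ 2 * ‖ξ τ‖ - 1 / 2 - w * ‖ξ τ‖| - 1 / 40) ?_ ?_ ?_ t (right_mem_Icc.2 hle)
  · rw [sub_neg, max_lt_iff] at key
    exact ⟨key.1.le, key.2.le⟩
  · have c1 : ContinuousOn (fun τ => |‖ξ τ‖ ^ 2 * ‖u τ‖ ^ 2 - inner ℝ (ξ τ) (u τ) ^ 2 - 1|)
        (Icc T₀ t) :=
      ((((hξ.norm.pow 2).mul (hu.norm.pow 2)).sub ((hξ.inner hu).pow 2)).sub continuousOn_const).abs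
    have c2 : ContinuousOn (fun τ => |‖u τ‖ ^ 2 * ‖ξ τ‖ - 1 / 2 - w * ‖ξ τ‖|) (Icc T₀ t) :=
      ((((hu.norm.pow 2).mul hξ.norm).sub continuousOn_const).sub
        (continuousOn_const.mul hξ.norm)).abs
    exact (c1.sup c2).sub continuousOn_const
  · intro τ hτ hbefore hτ0
    rw [sub_neg, max_lt_iff]
    have hclose : ∀ a ∈ Icc T₀ τ, IsClose w ξ u a := by
      intro a ha
      have : max |‖ξ a‖ ^ 2 * ‖u a‖ ^ 2 - inner ℝ (ξ a) (u a) ^ 2 - 1|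
        |‖u a‖ ^ 2 * ‖ξ a‖ - 1 / 2 - w * ‖ξ a‖| ≤ 1 / 40 := by
        rw [← sub_nonpos]
        rcases ha.2.eq_or_lt with heq | hlt
        · rw [heq]; exact hτ0
        · exact (hbefore a ⟨ha.1, hlt⟩).le
      exact ⟨(max_le_iff.1 this).1, (max_le_iff.1 this).2⟩
    exact h.estimate (hsub hτ) hclose fun a ha => hσ' a ⟨ha.1, ha.2.trans hτ.2⟩
  · have hp := h.norm_ne_zero_initial
    rw [h.angularMomentum, energy_error hp, ← h.energy]
    norm_num

end IsPerturbedKeplerMotion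

/-! ### The first turning point -/

namespace IsPerturbedKeplerMotion

variable {E : Type*} [NormedAddCommGroup E] [InnerProductSpace ℝ E] {I : Set ℝ} {T₀ m w : ℝ}
  {ξ u e : ℝ → E}

lemma exists_first_turning (h : IsPerturbedKeplerMotion I T₀ m w ξ u e)
    (hex : ∃ t ∈ I, 0 ≤ inner ℝ (ξ t) (u t)) :
    ∃ t₀ ∈ I, inner ℝ (ξ t₀) (u t₀) = 0 ∧ ∀ τ ∈ I, τ < t₀ → inner ℝ (ξ τ) (u τ) < 0 := by
  obtain ⟨t, ht, htn⟩ := hex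
  have hle := h.isLeast.2 ht
  have hsub := h.Icc_subset h.isLeast.1 ht
  have hcont : ContinuousOn (fun τ => inner ℝ (ξ τ) (u τ)) (Icc T₀ t) := fun τ hτ =>
    ((h.position τ (hsub hτ)).continuousWithinAt.inner
      (h.velocity τ (hsub hτ)).continuousWithinAt).mono hsub
  have hclosed : IsClosed (Icc T₀ t ∩ (fun τ => inner ℝ (ξ τ) (u τ)) ⁻¹' Ici 0) :=
    hcont.preimage_isClosed_of_isClosed isClosed_Icc isClosed_Ici
  obtain ⟨τ, ⟨hτ, hτ0⟩, hmin⟩ := (isCompact_Icc.of_isClosed_subset hclosed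
    inter_subset_left).exists_isLeast ⟨t, ⟨hle, le_rfl⟩, htn⟩
  have hbefore : ∀ s ∈ I, s < τ → inner ℝ (ξ s) (u s) < 0 := by
    intro s hs hsτ
    by_contra! hn
    exact not_lt.2 (hmin ⟨⟨h.isLeast.2 hs, hsτ.le.trans hτ.2⟩, hn⟩) hsτ
  exact ⟨τ, hsub hτ, le_antisymm (h.isClose (hsub hτ) hbefore).2 hτ0, hbefore⟩

/-- A virial argument. Closeness gives `‖u‖² ≥ w + (19/40) / s`, and the excess of `19/40` over the
`1/4` of the attraction absorbs the perturbation. The inner product of position and velocity thus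
grows at least linearly, which forces a turning. -/
lemma IsClose.le_deriv_inner (h : IsPerturbedKeplerMotion I T₀ m w ξ u e) {t : ℝ}
    (ht : t ∈ I) (hc : IsClose w ξ u t) :
    m * w ≤ m * (‖u t‖ ^ 2 - (4 * ‖ξ t‖)⁻¹ - inner ℝ (ξ t) (e t)) := by
  have hs := hc.lt h
  have hpos : 0 < ‖ξ t‖ := by linarith
  refine mul_le_mul_of_nonneg_left ?_ h.rate_pos.le
  have h1 := (abs_le.1 (h.abs_inner_perturbation_le ht (by linarith) (ξ t))).2
  have h2 := (abs_le.1 hc.2).1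
  have h3 : ‖ξ t‖ * (1 / 10000 / ‖ξ t‖ ^ 3) ≤ 1 / 10000 / ‖ξ t‖ := by
    have e1 : ‖ξ t‖ * (1 / 10000 / ‖ξ t‖ ^ 3) = 1 / 10000 / ‖ξ t‖ / ‖ξ t‖ := by field_simp
    rw [e1]
    exact div_le_self (by positivity) (by linarith)
  have h4 : w + 19 / 40 / ‖ξ t‖ ≤ ‖u t‖ ^ 2 := by
    rw [← sub_nonneg]
    have : ‖u t‖ ^ 2 - (w + 19 / 40 / ‖ξ t‖) = (‖u t‖ ^ 2 * ‖ξ t‖ - 19 / 40 - w * ‖ξ t‖) / ‖ξ t‖ := by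
      field_simp; ring
    rw [this]
    apply div_nonneg _ hpos.le
    linarith
  have h5 : 1 / 10000 / ‖ξ t‖ + (4 * ‖ξ t‖)⁻¹ ≤ 19 / 40 / ‖ξ t‖ := by
    have : 1 / 10000 / ‖ξ t‖ + (4 * ‖ξ t‖)⁻¹ = 2501 / 10000 / ‖ξ t‖ := by field_simp; norm_num
    rw [this, div_le_div_iff_of_pos_right hpos]
    norm_num
  linarith

/-- The motion turns after a time controlled by the energy. -/
lemma exists_nonneg_inner (h : IsPerturbedKeplerMotion I T₀ m w ξ u e) {τ : ℝ} (hτ : 0 ≤ τ)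
    (hτI : T₀ + τ ∈ I) (hlong : -inner ℝ (ξ T₀) (u T₀) ≤ m * w * τ) :
    ∃ t ∈ I, 0 ≤ inner ℝ (ξ t) (u t) := by
  by_contra! hcon
  have hle : T₀ ≤ T₀ + τ := by linarith
  have hsub := h.Icc_subset h.isLeast.1 hτI
  have hclose : ∀ s ∈ Icc T₀ (T₀ + τ), IsClose w ξ u s := fun s hs =>
    (h.isClose (hsub hs) fun a ha _ => hcon a ha).1
  have key := sub_le_sub_of_hasDerivWithinAt_le hle hsub
    (f := fun s => m * w * s) (f' := fun _ => m * w)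
    (fun s _ => by simpa using (hasDerivWithinAt_id s I).const_mul (m * w))
    (fun s hs => h.hasDerivWithinAt_inner (hsub hs) (by linarith [(hclose s hs).lt h]))
    fun s hs => (hclose s hs).le_deriv_inner h (hsub hs)
  have := hcon _ hτI
  nlinarith

lemma norm_acceleration_bounds (h : IsPerturbedKeplerMotion I T₀ m w ξ u e) {t : ℝ} (ht : t ∈ I)
    (hs : 3 / 2 ≤ ‖ξ t‖) : 1 / 8 / ‖ξ t‖ ^ 2 ≤ ‖(4 * ‖ξ t‖ ^ 3)⁻¹ • ξ t + e t‖ ∧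
      ‖(4 * ‖ξ t‖ ^ 3)⁻¹ • ξ t + e t‖ ≤ 1 / 2 / ‖ξ t‖ ^ 2 := by
  have hpos : 0 < ‖ξ t‖ := by linarith
  have h1 : ‖(4 * ‖ξ t‖ ^ 3)⁻¹ • ξ t‖ = 1 / 4 / ‖ξ t‖ ^ 2 := by
    rw [norm_smul, Real.norm_of_nonneg (by positivity)]; field_simp
  have h2 := h.perturbation t ht (by linarith)
  have h3 : 1 / 10000 / ‖ξ t‖ ^ 3 ≤ 1 / 8 / ‖ξ t‖ ^ 2 := by
    rw [div_le_div_iff₀ (by positivity) (by positivity)]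
    nlinarith [pow_pos hpos 2]
  have h4 := norm_add_le ((4 * ‖ξ t‖ ^ 3)⁻¹ • ξ t) (e t)
  have h5 := norm_sub_le_norm_add ((4 * ‖ξ t‖ ^ 3)⁻¹ • ξ t) (e t)
  have e1 : 1 / 4 / ‖ξ t‖ ^ 2 = 1 / 8 / ‖ξ t‖ ^ 2 + 1 / 8 / ‖ξ t‖ ^ 2 := by ring
  have e2 : 1 / 2 / ‖ξ t‖ ^ 2 = 1 / 8 / ‖ξ t‖ ^ 2 + 1 / 8 / ‖ξ t‖ ^ 2 + (1 / 8 / ‖ξ t‖ ^ 2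
    + 1 / 8 / ‖ξ t‖ ^ 2) := by ring
  have : 0 < 1 / 8 / ‖ξ t‖ ^ 2 := by positivity
  constructor <;> linarith

lemma sq_radialVelocity_le (t : ℝ) : (inner ℝ (ξ t) (u t) / ‖ξ t‖) ^ 2 ≤ ‖u t‖ ^ 2 := by
  rcases (norm_nonneg (ξ t)).eq_or_lt with h0 | h0
  · rw [← h0]; simp
  · rw [div_pow, div_le_iff₀ (by positivity), ← sq_abs, ← mul_pow, mul_comm]
    gcongr
    exact abs_real_inner_le_norm _ _

lemma IsClose.energy_add_le {t : ℝ}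
    (hc : IsClose w ξ u t) (hs : 3 ≤ ‖ξ t‖) :
    w + 1 / 8 / ‖ξ t‖ ≤ (inner ℝ (ξ t) (u t) / ‖ξ t‖) ^ 2 := by
  have hpos : 0 < ‖ξ t‖ := by linarith
  have := sq_ge_of_three_le hs hc.2 hc.1
  rw [div_pow, le_div_iff₀ (by positivity)]
  refine le_of_eq_of_le ?_ this
  field_simp

lemma IsClose.sq_speed_le (h : IsPerturbedKeplerMotion I T₀ m w ξ u e) {t : ℝ}
    (hc : IsClose w ξ u t) : ‖u t‖ ^ 2 ≤ w + 21 / 40 / ‖ξ t‖ := by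
  have hpos : 0 < ‖ξ t‖ := by linarith [hc.lt h]
  have h2 := (abs_le.1 hc.2).2
  rw [← sub_nonneg]
  have : w + 21 / 40 / ‖ξ t‖ - ‖u t‖ ^ 2 = (21 / 40 + w * ‖ξ t‖ - ‖u t‖ ^ 2 * ‖ξ t‖) / ‖ξ t‖ := by
    field_simp
    ring
  rw [this]
  apply div_nonneg _ hpos.le
  linarith

lemma IsClose.one_tenth_le (h : IsPerturbedKeplerMotion I T₀ m w ξ u e) {t : ℝ}
    (hc : IsClose w ξ u t) (hs : ‖ξ t‖ ≤ 4) : 1 / 10 ≤ ‖u t‖ ^ 2 := by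
  have hpos : 0 < ‖ξ t‖ := by linarith [hc.lt h]
  have h2 := (abs_le.1 hc.2).1
  have h3 := mul_pos h.energy_pos hpos
  by_contra! hcon
  nlinarith

/-- At a turning point `s² n ≤ 41/40`, while the energy gives `s n ≥ 19/40`; hence `s ≤ 41/19`. -/
lemma IsClose.dist_le_of_turning (h : IsPerturbedKeplerMotion I T₀ m w ξ u e) {t : ℝ}
    (hc : IsClose w ξ u t) (hσ : inner ℝ (ξ t) (u t) = 0) : ‖ξ t‖ ≤ 5 / 2 := by
  have hpos : 0 < ‖ξ t‖ := by linarith [hc.lt h]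
  have h1 := (abs_le.1 hc.1).2
  have h2 := (abs_le.1 hc.2).1
  have h3 := mul_pos h.energy_pos hpos
  rw [hσ] at h1
  by_contra! hcon
  nlinarith

/-- Near the first turning point, the squared radial velocity is comparable with the distance to
the turning point. -/
lemma sq_radialVelocity_bounds (h : IsPerturbedKeplerMotion I T₀ m w ξ u e) {t₀ : ℝ} (ht₀ : t₀ ∈ I)
    (h0 : inner ℝ (ξ t₀) (u t₀) = 0) (hpre : ∀ τ ∈ I, τ < t₀ → inner ℝ (ξ τ) (u τ) < 0)
    {t : ℝ} (ht : t ∈ I) (htt : t < t₀) (hs : ‖ξ t‖ ≤ 4) :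
    ‖ξ t₀‖ < ‖ξ t‖ ∧ (‖ξ t‖ - ‖ξ t₀‖) / 108 ≤ (inner ℝ (ξ t) (u t) / ‖ξ t‖) ^ 2 ∧
      (inner ℝ (ξ t) (u t) / ‖ξ t‖) ^ 2 ≤ 2 / 3 * (‖ξ t‖ - ‖ξ t₀‖) := by
  have hm := h.rate_pos
  have hsub := h.Icc_subset ht ht₀
  have hclose : ∀ τ ∈ Icc t t₀, IsClose w ξ u τ ∧ inner ℝ (ξ τ) (u τ) ≤ 0 := fun τ hτ =>
    h.isClose (hsub hτ) fun a ha haτ => hpre a ha (haτ.trans_le hτ.2)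
  have hpos : ∀ τ ∈ Icc t t₀, 0 < ‖ξ τ‖ := fun τ hτ => by linarith [(hclose τ hτ).1.lt h]
  have hρ0 : ∀ τ ∈ Icc t t₀, inner ℝ (ξ τ) (u τ) / ‖ξ τ‖ ≤ 0 := fun τ hτ =>
    div_nonpos_of_nonpos_of_nonneg (hclose τ hτ).2 (norm_nonneg _)
  have hsd := fun τ (hτ : τ ∈ Icc t t₀) => h.hasDerivWithinAt_dist (hsub hτ) (hpos τ hτ)
  have hρd := fun τ (hτ : τ ∈ Icc t t₀) =>
    (h.hasDerivWithinAt_radialVelocity (hsub hτ) (hpos τ hτ)).fun_pow 2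
  -- With `ρ` the radial velocity, `ρ²` and `s` have derivatives `2ρρ'` and `mρ`. Bounds on `ρ'`
  -- thus compare `ρ²` with `s` without dividing by `ρ`, which vanishes at `t₀`.
  have upper : (inner ℝ (ξ t) (u t) / ‖ξ t‖) ^ 2 ≤ 2 / 3 * (‖ξ t‖ - ‖ξ t₀‖) := by
    have key := sub_le_sub_of_hasDerivWithinAt_le htt.le hsub
      (fun τ hτ => (hsd τ hτ).const_mul (2 / 3)) hρd fun τ hτ => by
        have h1 := (hclose τ hτ).1.deriv_radialVelocity_le h (hsub hτ)
        have h2 := mul_le_mul_of_nonneg_left h1 (neg_nonneg.2 (hρ0 τ hτ))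
        rw [show 2 - 1 = 1 from rfl, pow_one]
        push_cast
        linarith
    simp only [h0] at key
    norm_num at key
    linarith
  have hlt : ‖ξ t₀‖ < ‖ξ t‖ := by
    have h1 : 0 < (inner ℝ (ξ t) (u t) / ‖ξ t‖) ^ 2 := by
      have := hpre t ht htt
      have h2 : inner ℝ (ξ t) (u t) / ‖ξ t‖ < 0 :=
        div_neg_of_neg_of_pos this (hpos t (left_mem_Icc.2 htt.le))
      exact (sq_pos_of_neg h2)
    linarith
  refine ⟨hlt, ?_, upper⟩
  -- For distances in `[3, 4]` the energy already bounds the radial velocity from below by a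
  -- constant; only below 3 is the growth of `ρ` needed.
  rcases le_total 3 ‖ξ t‖ with h3 | h3
  · have h4 := (hclose t (left_mem_Icc.2 htt.le)).1.energy_add_le h3
    have h5 : 1 / 8 / 4 ≤ 1 / 8 / ‖ξ t‖ := by
      have := hpos t (left_mem_Icc.2 htt.le)
      gcongr
    have h6 := (hclose t₀ (right_mem_Icc.2 htt.le)).1.lt h
    linarith [h.energy_pos]
  · have hanti := h.antitoneOn_dist ht ht₀ (fun τ hτ => (hclose τ hτ).1)
      fun τ hτ => (hclose τ hτ).2
    have key := sub_le_sub_of_hasDerivWithinAt_le htt.le hsub hρd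
      (fun τ hτ => (hsd τ hτ).const_mul (1 / 108)) fun τ hτ => by
        have hs3 : ‖ξ τ‖ ≤ 3 := (hanti (left_mem_Icc.2 htt.le) hτ hτ.1).trans h3
        have h1 := (hclose τ hτ).1.le_deriv_radialVelocity h (hsub hτ) hs3
        have h1' : m * (1 / 216) ≤ m * (1 / 24 / ‖ξ τ‖ ^ 2) := by
          have := hpos τ hτ
          refine mul_le_mul_of_nonneg_left ?_ hm.le
          rw [le_div_iff₀ (by positivity)]
          nlinarith
        have h2 := mul_le_mul_of_nonneg_left (h1'.trans h1) (neg_nonneg.2 (hρ0 τ hτ))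
        rw [show 2 - 1 = 1 from rfl, pow_one]
        push_cast
        linarith
    simp only [h0] at key
    norm_num at key
    linarith

end IsPerturbedKeplerMotion

/-! ### Return to dimensional units -/

/-- Comparisons are made between squares in normalized units, `k` being the factor that undoes the
scaling; `400 = 20²`. -/
lemma comparableWith_of_sq {x a y b k : ℝ} (hx : 0 ≤ x) (ha : 0 ≤ a) (hk : 0 ≤ k)
    (hxk : x ^ 2 = k * y) (hak : a ^ 2 = k * b) (h1 : b ≤ 400 * y) (h2 : y ≤ 400 * b) :
    ComparableWith 20 x a := by
  have h1' := mul_le_mul_of_nonneg_left h1 hk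
  have h2' := mul_le_mul_of_nonneg_left h2 hk
  refine ⟨?_, ?_⟩
  · rw [div_le_iff₀ (by norm_num)]
    exact abs_le_of_sq_le_sq' (by rw [mul_pow, hxk, hak]; linarith) (by positivity) |>.2
  · exact abs_le_of_sq_le_sq' (by rw [mul_pow, hxk, hak]; linarith) (by positivity) |>.2

/-- The closest approach of a motion in a perturbed inverse square field that moves inward
initially. Here `ℓ` is the square of the initial angular momentum, divided by `μ`. -/
structure IsInwardMotion {E : Type*} [NormedAddCommGroup E] [InnerProductSpace ℝ E]
    (I : Set ℝ) (T₀ μ ℓ : ℝ) (x V A : ℝ → E) : Prop where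
  ordConnected : I.OrdConnected
  nontrivial : I.Nontrivial
  isLeast : IsLeast I T₀
  strength_pos : 0 < μ
  length_pos : 0 < ℓ
  position : ∀ t ∈ I, HasDerivWithinAt x (V t) I t
  velocity : ∀ t ∈ I, HasDerivWithinAt V (A t) I t
  force : ∀ t ∈ I, ℓ ≤ ‖x t‖ →
    ‖A t + (μ * (4 * ‖x t‖ ^ 3)⁻¹) • x t‖ ≤ μ * (ℓ / 10000 / ‖x t‖ ^ 3)
  angularMomentum : ‖x T₀‖ ^ 2 * ‖V T₀‖ ^ 2 - inner ℝ (x T₀) (V T₀) ^ 2 = μ * ℓ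
  far : μ ≤ ‖V T₀‖ ^ 2 * ‖x T₀‖
  speed_le : ‖V T₀‖ ^ 2 * ℓ ≤ μ / 10000
  inward : inner ℝ (x T₀) (V T₀) < 0

namespace IsInwardMotion

variable {E : Type*} [NormedAddCommGroup E] [InnerProductSpace ℝ E] {I : Set ℝ} {T₀ μ ℓ : ℝ}
  {x V A : ℝ → E}

lemma speed_sq (h : IsInwardMotion I T₀ μ ℓ x V A) : √(μ / ℓ) ^ 2 = μ / ℓ := by
  have := h.strength_pos
  have := h.length_pos
  exact Real.sq_sqrt (by positivity)

lemma speed_pos (h : IsInwardMotion I T₀ μ ℓ x V A) : 0 < √(μ / ℓ) := by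
  have := h.strength_pos
  have := h.length_pos
  positivity

lemma initial_pos (h : IsInwardMotion I T₀ μ ℓ x V A) : 0 < ‖x T₀‖ ∧ 0 < ‖V T₀‖ := by
  have := h.far
  have h2 := h.strength_pos
  constructor
  · refine lt_of_le_of_ne (norm_nonneg _) fun hz => ?_
    rw [← hz, mul_zero] at this
    linarith
  · refine lt_of_le_of_ne (norm_nonneg _) fun hz => ?_
    rw [← hz] at this
    norm_num at this
    linarith

lemma scaled_dist (h : IsInwardMotion I T₀ μ ℓ x V A) (t : ℝ) : ‖ℓ⁻¹ • x t‖ = ‖x t‖ / ℓ := by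
  rw [norm_smul, norm_inv, Real.norm_of_nonneg h.length_pos.le]
  ring

lemma scaled_speed (h : IsInwardMotion I T₀ μ ℓ x V A) (t : ℝ) :
    ‖(√(μ / ℓ))⁻¹ • V t‖ = ‖V t‖ / √(μ / ℓ) := by
  rw [norm_smul, norm_inv, Real.norm_of_nonneg h.speed_pos.le]
  ring

lemma scaled_force (h : IsInwardMotion I T₀ μ ℓ x V A) (t : ℝ) :
    (4 * ‖ℓ⁻¹ • x t‖ ^ 3)⁻¹ • ℓ⁻¹ • x t
      + -((ℓ ^ 2 / μ) • (A t + (μ * (4 * ‖x t‖ ^ 3)⁻¹) • x t)) = -((ℓ ^ 2 / μ) • A t) := by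
  have hμ := h.strength_pos
  have hℓ := h.length_pos
  rw [h.scaled_dist, smul_smul, smul_add, smul_smul, ← sub_eq_add_neg]
  have e1 : ((4 * (‖x t‖ / ℓ) ^ 3)⁻¹ * ℓ⁻¹) = ℓ ^ 2 / μ * (μ * (4 * ‖x t‖ ^ 3)⁻¹) := by
    rcases eq_or_ne ‖x t‖ 0 with h0 | h0
    · simp [h0]
    · field_simp
  rw [e1, sub_add_cancel_right]

/-- The motion in rescaled variables. -/
theorem isPerturbedKeplerMotion (h : IsInwardMotion I T₀ μ ℓ x V A) :
    IsPerturbedKeplerMotion I T₀ (√(μ / ℓ) / ℓ) (ℓ / μ * (‖V T₀‖ ^ 2 - μ / (2 * ‖x T₀‖)))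
      (fun t => ℓ⁻¹ • x t) (fun t => (√(μ / ℓ))⁻¹ • V t)
      (fun t => -((ℓ ^ 2 / μ) • (A t + (μ * (4 * ‖x t‖ ^ 3)⁻¹) • x t))) := by
  have hμ := h.strength_pos
  have hℓ := h.length_pos
  have hk := h.speed_pos
  have hkk := h.speed_sq
  obtain ⟨hx0, hV0⟩ := h.initial_pos
  set k := √(μ / ℓ) with hkdef
  -- Lengths are measured in `ℓ` and velocities in `k`. This relation gives both equations of motion
  -- the same rate `k / ℓ`.
  have hkμ : k ^ 2 * ℓ = μ := by rw [hkk]; field_simp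
  refine ⟨h.ordConnected, h.isLeast, by positivity, fun t ht => ?_, fun t ht => ?_,
    fun t ht hs => ?_, ?_, ?_, ?_, ?_, ?_⟩
  · refine ((h.position t ht).const_smul ℓ⁻¹).congr_deriv ?_
    rw [smul_smul]
    congr 1
    field_simp
  · refine ((h.velocity t ht).const_smul k⁻¹).congr_deriv ?_
    rw [h.scaled_force, smul_neg, neg_smul, neg_neg, smul_smul]
    congr 1
    rw [← hkμ]
    field_simp
  · rw [h.scaled_dist] at hs ⊢
    rw [le_div_iff₀ hℓ, one_mul] at hs
    rw [norm_neg, norm_smul, Real.norm_of_nonneg (by positivity)]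
    have hpos : 0 < ‖x t‖ := hℓ.trans_le hs
    calc ℓ ^ 2 / μ * ‖A t + (μ * (4 * ‖x t‖ ^ 3)⁻¹) • x t‖
        ≤ ℓ ^ 2 / μ * (μ * (ℓ / 10000 / ‖x t‖ ^ 3)) := by gcongr; exact h.force t ht hs
      _ = 1 / 10000 / (‖x t‖ / ℓ) ^ 3 := by field_simp
  · rw [h.scaled_dist, h.scaled_speed, real_inner_smul_left, real_inner_smul_right]
    have e : (‖x T₀‖ / ℓ) ^ 2 * (‖V T₀‖ / k) ^ 2 - (ℓ⁻¹ * (k⁻¹ * inner ℝ (x T₀) (V T₀))) ^ 2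
        = (‖x T₀‖ ^ 2 * ‖V T₀‖ ^ 2 - inner ℝ (x T₀) (V T₀) ^ 2) / (ℓ * (k ^ 2 * ℓ)) := by
      field_simp
    rw [e, h.angularMomentum, hkμ]
    field_simp
  · rw [h.scaled_dist, h.scaled_speed, div_pow, hkk]
    field_simp
  · have h1 : μ / (2 * ‖x T₀‖) ≤ ‖V T₀‖ ^ 2 / 2 := by
      rw [div_le_div_iff₀ (by positivity) (by norm_num)]
      linarith [h.far]
    have : 0 < ‖V T₀‖ ^ 2 := by positivity
    have : 0 < ‖V T₀‖ ^ 2 - μ / (2 * ‖x T₀‖) := by linarith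
    positivity
  · rw [h.scaled_speed, div_pow, hkk, div_div_eq_mul_div, div_le_iff₀ hμ]
    linarith [h.speed_le]
  · rw [real_inner_smul_left, real_inner_smul_right]
    have := h.inward
    exact mul_neg_of_pos_of_neg (by positivity) (mul_neg_of_pos_of_neg (by positivity) this)

/-- The rescaled state of the motion is close to that of the unperturbed motion. -/
def IsCloseAt (_ : IsInwardMotion I T₀ μ ℓ x V A) (t : ℝ) : Prop :=
  IsPerturbedKeplerMotion.IsClose (ℓ / μ * (‖V T₀‖ ^ 2 - μ / (2 * ‖x T₀‖)))
    (fun t => ℓ⁻¹ • x t) (fun t => (√(μ / ℓ))⁻¹ • V t) t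

lemma uniqueDiffOn (h : IsInwardMotion I T₀ μ ℓ x V A) : UniqueDiffOn ℝ I :=
  h.ordConnected.uniqueDiffOn_of_nontrivial h.nontrivial

lemma hasDerivWithinAt_norm (h : IsInwardMotion I T₀ μ ℓ x V A) {t : ℝ} (ht : t ∈ I)
    (hx : 0 < ‖x t‖) :
    HasDerivWithinAt (fun t => ‖x t‖) (inner ℝ (x t) (V t) / ‖x t‖) I t := by
  have h1 := ((h.position t ht).norm_sq).sqrt (by positivity)
  simp only [Real.sqrt_sq (norm_nonneg _)] at h1
  refine h1.congr_deriv ?_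
  field_simp

lemma derivWithin_norm (h : IsInwardMotion I T₀ μ ℓ x V A) {t : ℝ} (ht : t ∈ I)
    (hx : 0 < ‖x t‖) : derivWithin (fun t => ‖x t‖) I t = inner ℝ (x t) (V t) / ‖x t‖ :=
  (h.hasDerivWithinAt_norm ht hx).derivWithin (h.uniqueDiffOn t ht)

lemma inner_neg_iff (h : IsInwardMotion I T₀ μ ℓ x V A) (t : ℝ) :
    inner ℝ (ℓ⁻¹ • x t) ((√(μ / ℓ))⁻¹ • V t) < 0 ↔ inner ℝ (x t) (V t) < 0 := by
  have hℓ := h.length_pos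
  have hk := h.speed_pos
  rw [real_inner_smul_left, real_inner_smul_right, ← mul_assoc]
  have hpos : 0 < ℓ⁻¹ * (√(μ / ℓ))⁻¹ := by positivity
  refine ⟨fun hn => ?_, fun hn => mul_neg_of_pos_of_neg hpos hn⟩
  by_contra! h0
  exact not_lt.2 (mul_nonneg hpos.le h0) hn

lemma inner_eq_zero_iff (h : IsInwardMotion I T₀ μ ℓ x V A) (t : ℝ) :
    inner ℝ (ℓ⁻¹ • x t) ((√(μ / ℓ))⁻¹ • V t) = 0 ↔ inner ℝ (x t) (V t) = 0 := by
  have hℓ := h.length_pos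
  have hk := h.speed_pos
  rw [real_inner_smul_left, real_inner_smul_right, mul_eq_zero_iff_left (by positivity),
    mul_eq_zero_iff_left (by positivity)]

lemma radialVelocity_sq (h : IsInwardMotion I T₀ μ ℓ x V A) {t : ℝ} (ht : t ∈ I)
    (hx : 0 < ‖x t‖) : derivWithin (fun t => ‖x t‖) I t ^ 2
      = μ / ℓ * (inner ℝ (ℓ⁻¹ • x t) ((√(μ / ℓ))⁻¹ • V t) / ‖ℓ⁻¹ • x t‖) ^ 2 := by
  have hℓ := h.length_pos
  have hk := h.speed_pos
  have hkk := h.speed_sq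
  rw [h.derivWithin_norm ht hx, h.scaled_dist, real_inner_smul_left, real_inner_smul_right]
  set k := √(μ / ℓ)
  rw [← hkk]
  field_simp

lemma speed_sq_eq (h : IsInwardMotion I T₀ μ ℓ x V A) (t : ℝ) :
    ‖V t‖ ^ 2 = μ / ℓ * ‖(√(μ / ℓ))⁻¹ • V t‖ ^ 2 := by
  have hk := h.speed_pos
  have hkk := h.speed_sq
  rw [h.scaled_speed]
  set k := √(μ / ℓ)
  rw [← hkk]
  field_simp

lemma isCloseAt (h : IsInwardMotion I T₀ μ ℓ x V A) {t : ℝ} (ht : t ∈ I)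
    (hσ : ∀ τ ∈ I, τ < t → inner ℝ (x τ) (V τ) < 0) : h.IsCloseAt t :=
  (h.isPerturbedKeplerMotion.isClose ht fun τ hτ hlt => (h.inner_neg_iff τ).2 (hσ τ hτ hlt)).1

lemma IsCloseAt.lt {h : IsInwardMotion I T₀ μ ℓ x V A} {t : ℝ} (hc : h.IsCloseAt t) :
    3 / 2 * ℓ < ‖x t‖ := by
  have := IsPerturbedKeplerMotion.IsClose.lt h.isPerturbedKeplerMotion hc
  rw [h.scaled_dist, lt_div_iff₀ h.length_pos] at this
  exact this

lemma IsCloseAt.pos {h : IsInwardMotion I T₀ μ ℓ x V A} {t : ℝ} (hc : h.IsCloseAt t) :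
    0 < ‖x t‖ := by
  have := hc.lt
  have := h.length_pos
  linarith

lemma exists_first_turning (h : IsInwardMotion I T₀ μ ℓ x V A)
    (hex : ∃ t ∈ I, 0 ≤ inner ℝ (x t) (V t)) :
    ∃ t₀ ∈ I, inner ℝ (x t₀) (V t₀) = 0 ∧ ∀ τ ∈ I, τ < t₀ → inner ℝ (x τ) (V τ) < 0 := by
  obtain ⟨t, ht, htn⟩ := hex
  obtain ⟨t₀, ht₀, h0, hpre⟩ := h.isPerturbedKeplerMotion.exists_first_turning
    ⟨t, ht, not_lt.1 fun hn => not_lt.2 htn ((h.inner_neg_iff t).1 hn)⟩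
  exact ⟨t₀, ht₀, (h.inner_eq_zero_iff t₀).1 h0, fun τ hτ hlt =>
    (h.inner_neg_iff τ).1 (hpre τ hτ hlt)⟩

/-- At the first time when the inner product is no longer negative, the distance is still positive,
so the norm is differentiable there with derivative zero. This excludes any trouble at the origin.
-/
lemma inner_neg_of_derivWithin_neg (h : IsInwardMotion I T₀ μ ℓ x V A) {t : ℝ}
    (hpre : ∀ s ∈ I, s < t → derivWithin (fun t => ‖x t‖) I s < 0) :
    ∀ s ∈ I, s < t → inner ℝ (x s) (V s) < 0 := by
  intro s hs hst
  by_contra! hn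
  obtain ⟨t₀, ht₀, h0, hpre₀⟩ := h.exists_first_turning ⟨s, hs, hn⟩
  have hle : t₀ ≤ s := by
    by_contra! hlt
    exact not_lt.2 hn (hpre₀ s hs hlt)
  have hd := hpre t₀ ht₀ (hle.trans_lt hst)
  rw [h.derivWithin_norm ht₀ (h.isCloseAt ht₀ hpre₀).pos, h0, zero_div] at hd
  exact lt_irrefl _ hd

lemma derivWithin_neg_of_inner_neg (h : IsInwardMotion I T₀ μ ℓ x V A) {t : ℝ} (ht : t ∈ I)
    (hσ : inner ℝ (x t) (V t) < 0) : derivWithin (fun t => ‖x t‖) I t < 0 := by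
  have hx : 0 < ‖x t‖ := by
    rw [norm_pos_iff]
    rintro h0
    rw [h0, inner_zero_left] at hσ
    exact lt_irrefl _ hσ
  rw [h.derivWithin_norm ht hx]
  exact div_neg_of_neg_of_pos hσ hx

lemma isFirstClosestApproach (h : IsInwardMotion I T₀ μ ℓ x V A) {t₀ : ℝ} (ht₀ : t₀ ∈ I)
    (h0 : inner ℝ (x t₀) (V t₀) = 0) (hpre : ∀ τ ∈ I, τ < t₀ → inner ℝ (x τ) (V τ) < 0) :
    IsFirstClosestApproach I (fun t => ‖x t‖) ‖x t₀‖ := by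
  have hsub : Icc T₀ t₀ ⊆ I := h.ordConnected.out h.isLeast.1 ht₀
  have hanti : ∀ t ∈ I, t ≤ t₀ → ‖x t₀‖ ≤ ‖x t‖ := by
    intro t ht htt
    have hK := h.isPerturbedKeplerMotion
    have hc := fun τ (hτ : τ ∈ Icc T₀ t₀) => hK.isClose (hsub hτ) fun a ha haτ =>
      (h.inner_neg_iff a).2 (hpre a ha (haτ.trans_le hτ.2))
    have := hK.antitoneOn_dist h.isLeast.1 ht₀ (fun τ hτ => (hc τ hτ).1) (fun τ hτ => (hc τ hτ).2)
      ⟨h.isLeast.2 ht, htt⟩ (right_mem_Icc.2 (h.isLeast.2 ht₀)) htt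
    simp only [h.scaled_dist] at this
    exact (div_le_div_iff_of_pos_right h.length_pos).1 this
  -- A threshold above `‖x t₀‖` stops the time interval before `t₀`; any other threshold admits `T =
  -- t₀`, where the derivative is zero.
  have hS : {r' : ℝ | ∀ T ∈ I, (∀ t ∈ I, t ≤ T → r' ≤ ‖x t‖) →
      ∀ t ∈ I, t ≤ T → derivWithin (fun t => ‖x t‖) I t < 0} = Ioi ‖x t₀‖ := by
    ext r'
    simp only [mem_ofPred_eq, mem_Ioi]
    constructor
    · intro hr
      by_contra! hle
      have := hr t₀ ht₀ (fun t ht htt => hle.trans (hanti t ht htt)) t₀ ht₀ le_rfl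
      rw [h.derivWithin_norm ht₀ (h.isCloseAt ht₀ hpre).pos, h0, zero_div] at this
      exact lt_irrefl _ this
    · intro hr T _ hrT t ht htT
      have hTt : T < t₀ := by
        by_contra! hle
        exact not_lt.2 (hrT t₀ ht₀ hle) hr
      exact h.derivWithin_neg_of_inner_neg ht (hpre t ht (htT.trans_lt hTt))
  rw [IsFirstClosestApproach, hS]
  exact isGLB_Ioi

lemma exists_turning_of_isFirstClosestApproach (h : IsInwardMotion I T₀ μ ℓ x V A) {r₀ : ℝ}
    (hr₀ : IsFirstClosestApproach I (fun t => ‖x t‖) r₀) :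
    ∃ t₀ ∈ I, ‖x t₀‖ = r₀ ∧ inner ℝ (x t₀) (V t₀) = 0 ∧
      ∀ τ ∈ I, τ < t₀ → inner ℝ (x τ) (V τ) < 0 := by
  by_cases hex : ∃ t ∈ I, 0 ≤ inner ℝ (x t) (V t)
  · obtain ⟨t₀, ht₀, h0, hpre⟩ := h.exists_first_turning hex
    exact ⟨t₀, ht₀, (h.isFirstClosestApproach ht₀ h0 hpre).unique hr₀, h0, hpre⟩
  · push Not at hex
    -- Without a turning every real number is admissible, so the set has no lower bound.
    have := hr₀.1 (show r₀ - 1 ∈ _ from fun T _ _ t ht _ =>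
      h.derivWithin_neg_of_inner_neg ht (hex t ht))
    linarith

/-- The first closest approach occurs within a time comparable with the initial distance divided
by the initial speed. -/
theorem exists_isFirstClosestApproach (h : IsInwardMotion I T₀ μ ℓ x V A)
    (hT : T₀ + 20 * (‖x T₀‖ / ‖V T₀‖) ∈ I) :
    ∃ r₀, IsFirstClosestApproach I (fun t => ‖x t‖) r₀ := by
  have hμ := h.strength_pos
  have hℓ := h.length_pos
  have hk := h.speed_pos
  have hkk := h.speed_sq
  obtain ⟨hx0, hV0⟩ := h.initial_pos
  -- The inner product starts at or above `-‖x T₀‖ ‖V T₀‖` and grows at rate at least `‖V T₀‖² / 2`,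
  -- so a factor 2 would do; 20 is the common constant.
  obtain ⟨t, ht, htn⟩ := h.isPerturbedKeplerMotion.exists_nonneg_inner
    (τ := 20 * (‖x T₀‖ / ‖V T₀‖)) (by positivity) hT (by
      rw [real_inner_smul_left, real_inner_smul_right]
      have h1 : μ / (2 * ‖x T₀‖) ≤ ‖V T₀‖ ^ 2 / 2 := by
        rw [div_le_div_iff₀ (by positivity) (by norm_num)]
        linarith [h.far]
      have h2 := (abs_le.1 (abs_real_inner_le_norm (x T₀) (V T₀))).1
      set k := √(μ / ℓ)
      have e : k / ℓ * (ℓ / μ * (‖V T₀‖ ^ 2 - μ / (2 * ‖x T₀‖))) * (20 * (‖x T₀‖ / ‖V T₀‖))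
          = ℓ⁻¹ * (k⁻¹ * ((‖V T₀‖ ^ 2 - μ / (2 * ‖x T₀‖)) * (20 * (‖x T₀‖ / ‖V T₀‖)))) := by
        have : μ = k ^ 2 * ℓ := by rw [hkk]; field_simp
        have h3 : k / ℓ * (ℓ / μ) = ℓ⁻¹ * k⁻¹ := by rw [this]; field_simp
        linear_combination
          ((‖V T₀‖ ^ 2 - μ / (2 * ‖x T₀‖)) * (20 * (‖x T₀‖ / ‖V T₀‖))) * h3
      rw [e, ← mul_neg, ← mul_neg]
      gcongr
      calc -inner ℝ (x T₀) (V T₀) ≤ ‖x T₀‖ * ‖V T₀‖ := by linarith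
        _ ≤ (‖V T₀‖ ^ 2 / 2) * (20 * (‖x T₀‖ / ‖V T₀‖)) := by
          have : (‖V T₀‖ ^ 2 / 2) * (20 * (‖x T₀‖ / ‖V T₀‖)) = 10 * (‖x T₀‖ * ‖V T₀‖) := by
            field_simp; norm_num
          rw [this]
          have : 0 < ‖x T₀‖ * ‖V T₀‖ := by positivity
          linarith
        _ ≤ _ := by
          gcongr
          linarith)
  have htn' : 0 ≤ inner ℝ (x t) (V t) := not_lt.1 fun hn =>
    not_lt.2 htn ((h.inner_neg_iff t).2 hn)
  obtain ⟨t₀, ht₀, h0, hpre⟩ := h.exists_first_turning ⟨t, ht, htn'⟩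
  exact ⟨_, h.isFirstClosestApproach ht₀ h0 hpre⟩

lemma comparableWith_acceleration (h : IsInwardMotion I T₀ μ ℓ x V A) {t : ℝ} (ht : t ∈ I)
    (hs : 3 / 2 * ℓ ≤ ‖x t‖) : ComparableWith 20 ‖A t‖ (μ / ‖x t‖ ^ 2) := by
  have hμ := h.strength_pos
  have hℓ := h.length_pos
  have hx : 0 < ‖x t‖ := by linarith
  have key := h.isPerturbedKeplerMotion.norm_acceleration_bounds ht (by
    rw [h.scaled_dist, le_div_iff₀ hℓ]; exact hs)
  rw [h.scaled_force, h.scaled_dist, norm_neg, norm_smul,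
    Real.norm_of_nonneg (by positivity)] at key
  have e2 : ∀ c : ℝ, c / (‖x t‖ / ℓ) ^ 2 = ℓ ^ 2 / μ * (c * (μ / ‖x t‖ ^ 2)) := by
    intro c; field_simp
  rw [e2, e2, mul_le_mul_iff_right₀ (by positivity), mul_le_mul_iff_right₀ (by positivity)] at key
  have : 0 < μ / ‖x t‖ ^ 2 := by positivity
  exact ⟨by linarith [key.1], by linarith [key.2]⟩

lemma energy_ge (h : IsInwardMotion I T₀ μ ℓ x V A) :
    ℓ / μ * ‖V T₀‖ ^ 2 / 2 ≤ ℓ / μ * (‖V T₀‖ ^ 2 - μ / (2 * ‖x T₀‖)) := by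
  have hμ := h.strength_pos
  have hℓ := h.length_pos
  obtain ⟨hx0, hV0⟩ := h.initial_pos
  rw [mul_div_assoc]
  gcongr
  have h1 : μ / (2 * ‖x T₀‖) ≤ ‖V T₀‖ ^ 2 / 2 := by
    rw [div_le_div_iff₀ (by positivity) (by norm_num)]
    linarith [h.far]
  linarith

lemma energy_le (h : IsInwardMotion I T₀ μ ℓ x V A) :
    ℓ / μ * (‖V T₀‖ ^ 2 - μ / (2 * ‖x T₀‖)) ≤ ℓ / μ * ‖V T₀‖ ^ 2 := by
  have hμ := h.strength_pos
  have hℓ := h.length_pos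
  obtain ⟨hx0, hV0⟩ := h.initial_pos
  gcongr
  have : 0 < μ / (2 * ‖x T₀‖) := by positivity
  linarith

/-- Beyond `μ / ‖V T₀‖²` the energy dominates the squared radial velocity. Smallness of the initial
speed places this radius far outside `3ℓ`. -/
lemma IsCloseAt.comparableWith_far {h : IsInwardMotion I T₀ μ ℓ x V A} {t : ℝ} (ht : t ∈ I)
    (hc : h.IsCloseAt t) (hr : μ / ‖V T₀‖ ^ 2 ≤ ‖x t‖) :
    ComparableWith 20 |derivWithin (fun t => ‖x t‖) I t| ‖V T₀‖ ∧
      ComparableWith 20 ‖V t‖ ‖V T₀‖ := by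
  have hμ := h.strength_pos
  have hℓ := h.length_pos
  obtain ⟨hx0, hV0⟩ := h.initial_pos
  have hK := h.isPerturbedKeplerMotion
  rw [div_le_iff₀ (by positivity)] at hr
  have hs3 : 3 ≤ ‖ℓ⁻¹ • x t‖ := by
    rw [h.scaled_dist, le_div_iff₀ hℓ]
    have := h.speed_le
    have hV2 : 0 < ‖V T₀‖ ^ 2 := by positivity
    have : ‖V T₀‖ ^ 2 * (10000 * ℓ) ≤ ‖V T₀‖ ^ 2 * ‖x t‖ := by linarith
    linarith [le_of_mul_le_mul_left this hV2]
  have hqs : 1 / ‖ℓ⁻¹ • x t‖ ≤ ℓ / μ * ‖V T₀‖ ^ 2 := by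
    rw [h.scaled_dist, one_div_div, div_le_iff₀ hc.pos]
    have : ℓ / μ * ‖V T₀‖ ^ 2 * ‖x t‖ = ℓ * (‖x t‖ * ‖V T₀‖ ^ 2 / μ) := by ring
    rw [this]
    refine le_mul_of_one_le_right hℓ.le ?_
    rwa [one_le_div hμ]
  have a1 := IsPerturbedKeplerMotion.IsClose.energy_add_le hc hs3
  have a2 := IsPerturbedKeplerMotion.sq_radialVelocity_le (ξ := fun t => ℓ⁻¹ • x t)
    (u := fun t => (√(μ / ℓ))⁻¹ • V t) t
  have a3 := IsPerturbedKeplerMotion.IsClose.sq_speed_le hK hc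
  have a4 := h.energy_ge
  have a5 := h.energy_le
  have hspos : 0 < ‖ℓ⁻¹ • x t‖ := by linarith
  have a6 : 0 < 1 / 8 / ‖ℓ⁻¹ • x t‖ := by positivity
  have a7 : 21 / 40 / ‖ℓ⁻¹ • x t‖ = 21 / 40 * (1 / ‖ℓ⁻¹ • x t‖) := by ring
  have e0 : ‖V T₀‖ ^ 2 = μ / ℓ * (ℓ / μ * ‖V T₀‖ ^ 2) := by field_simp
  have hq : 0 < ℓ / μ * ‖V T₀‖ ^ 2 := by positivity
  constructor
  · refine comparableWith_of_sq (abs_nonneg _) hV0.le (k := μ / ℓ) (by positivity)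
      (by rw [sq_abs]; exact h.radialVelocity_sq ht hc.pos) e0 ?_ ?_ <;> linarith
  · refine comparableWith_of_sq (norm_nonneg _) hV0.le (k := μ / ℓ) (by positivity)
      (h.speed_sq_eq t) e0 ?_ ?_ <;> linarith

/-- Here the potential term dominates and the motion is comparable to a free fall; staying above
`3ℓ` keeps the radial part from degenerating. -/
lemma IsCloseAt.comparableWith_middle {h : IsInwardMotion I T₀ μ ℓ x V A} {t : ℝ} (ht : t ∈ I)
    (hc : h.IsCloseAt t) (hr3 : 3 * ℓ ≤ ‖x t‖) (hr : ‖x t‖ ≤ μ / ‖V T₀‖ ^ 2) :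
    ComparableWith 20 |derivWithin (fun t => ‖x t‖) I t| √(μ / ‖x t‖) ∧
      ComparableWith 20 ‖V t‖ √(μ / ‖x t‖) := by
  have hμ := h.strength_pos
  have hℓ := h.length_pos
  obtain ⟨hx0, hV0⟩ := h.initial_pos
  have hK := h.isPerturbedKeplerMotion
  rw [le_div_iff₀ (by positivity)] at hr
  have hs3 : 3 ≤ ‖ℓ⁻¹ • x t‖ := by rwa [h.scaled_dist, le_div_iff₀ hℓ]
  have hqs : ℓ / μ * ‖V T₀‖ ^ 2 ≤ 1 / ‖ℓ⁻¹ • x t‖ := by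
    rw [h.scaled_dist, one_div_div, le_div_iff₀ hc.pos]
    have : ℓ / μ * ‖V T₀‖ ^ 2 * ‖x t‖ = ℓ * (‖x t‖ * ‖V T₀‖ ^ 2 / μ) := by ring
    rw [this]
    refine mul_le_of_le_one_right hℓ.le ?_
    rwa [div_le_one hμ]
  have a1 := IsPerturbedKeplerMotion.IsClose.energy_add_le hc hs3
  have a2 := IsPerturbedKeplerMotion.sq_radialVelocity_le (ξ := fun t => ℓ⁻¹ • x t)
    (u := fun t => (√(μ / ℓ))⁻¹ • V t) t
  have a3 := IsPerturbedKeplerMotion.IsClose.sq_speed_le hK hc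
  have a4 := hK.energy_pos
  have a5 := h.energy_le
  have hspos : 0 < ‖ℓ⁻¹ • x t‖ := by linarith
  have a6 : 1 / 8 / ‖ℓ⁻¹ • x t‖ = 1 / 8 * (1 / ‖ℓ⁻¹ • x t‖) := by ring
  have a7 : 21 / 40 / ‖ℓ⁻¹ • x t‖ = 21 / 40 * (1 / ‖ℓ⁻¹ • x t‖) := by ring
  have a8 : 0 < 1 / ‖ℓ⁻¹ • x t‖ := by positivity
  have hx := hc.pos
  have e0 : √(μ / ‖x t‖) ^ 2 = μ / ℓ * (1 / ‖ℓ⁻¹ • x t‖) := by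
    rw [Real.sq_sqrt (by positivity), h.scaled_dist]
    field_simp
  constructor
  · refine comparableWith_of_sq (abs_nonneg _) (Real.sqrt_nonneg _) (k := μ / ℓ) (by positivity)
      (by rw [sq_abs]; exact h.radialVelocity_sq ht hc.pos) e0 ?_ ?_ <;> linarith
  · refine comparableWith_of_sq (norm_nonneg _) (Real.sqrt_nonneg _) (k := μ / ℓ) (by positivity)
      (h.speed_sq_eq t) e0 ?_ ?_ <;> linarith

lemma IsCloseAt.comparableWith_near {h : IsInwardMotion I T₀ μ ℓ x V A} {t : ℝ}
    (hc : h.IsCloseAt t) (hr : ‖x t‖ ≤ 4 * ℓ) : ComparableWith 20 ‖V t‖ √(μ / ℓ) := by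
  have hμ := h.strength_pos
  have hℓ := h.length_pos
  have hK := h.isPerturbedKeplerMotion
  have a1 := IsPerturbedKeplerMotion.IsClose.one_tenth_le hK hc (by
    rwa [h.scaled_dist, div_le_iff₀ hℓ])
  have a2 := IsPerturbedKeplerMotion.IsClose.speed_le_one hK hc
  refine comparableWith_of_sq (norm_nonneg _) (Real.sqrt_nonneg _) (k := μ / ℓ) (by positivity)
    (h.speed_sq_eq t) (by rw [h.speed_sq, mul_one]) (by linarith) ?_
  nlinarith [norm_nonneg ((√(μ / ℓ))⁻¹ • V t)]

lemma IsCloseAt.le_of_turning {h : IsInwardMotion I T₀ μ ℓ x V A} {t : ℝ}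
    (hc : h.IsCloseAt t) (h0 : inner ℝ (x t) (V t) = 0) : ‖x t‖ ≤ 5 / 2 * ℓ := by
  have := IsPerturbedKeplerMotion.IsClose.dist_le_of_turning h.isPerturbedKeplerMotion hc
    ((h.inner_eq_zero_iff t).2 h0)
  rwa [h.scaled_dist, div_le_iff₀ h.length_pos] at this

lemma comparableWith_turning (h : IsInwardMotion I T₀ μ ℓ x V A) {t₀ : ℝ} (ht₀ : t₀ ∈ I)
    (h0 : inner ℝ (x t₀) (V t₀) = 0) (hpre : ∀ τ ∈ I, τ < t₀ → inner ℝ (x τ) (V τ) < 0)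
    {t : ℝ} (ht : t ∈ I) (htt : t < t₀) (hr : ‖x t‖ ≤ 4 * ℓ) : ‖x t₀‖ < ‖x t‖ ∧
      ComparableWith 20 |derivWithin (fun t => ‖x t‖) I t| (√μ / ℓ * √(‖x t‖ - ‖x t₀‖)) := by
  have hμ := h.strength_pos
  have hℓ := h.length_pos
  have hc := h.isCloseAt ht fun τ hτ hlt => hpre τ hτ (hlt.trans htt)
  obtain ⟨a1, a2, a3⟩ := h.isPerturbedKeplerMotion.sq_radialVelocity_bounds ht₀
    ((h.inner_eq_zero_iff t₀).2 h0) (fun τ hτ hlt => (h.inner_neg_iff τ).2 (hpre τ hτ hlt)) ht htt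
    (by rwa [h.scaled_dist, div_le_iff₀ hℓ])
  simp only [h.scaled_dist t₀] at a1 a2 a3
  have hlt : ‖x t₀‖ < ‖x t‖ := by
    rw [h.scaled_dist, div_lt_div_iff_of_pos_right hℓ] at a1; exact a1
  have hd : 0 < ‖ℓ⁻¹ • x t‖ - ‖x t₀‖ / ℓ := by linarith
  refine ⟨hlt, comparableWith_of_sq (abs_nonneg _) (by positivity) (k := μ / ℓ) (by positivity)
    (by rw [sq_abs]; exact h.radialVelocity_sq ht hc.pos)
    (b := ‖ℓ⁻¹ • x t‖ - ‖x t₀‖ / ℓ) ?_ (by linarith) (by linarith)⟩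
  rw [mul_pow, div_pow, Real.sq_sqrt hμ.le, Real.sq_sqrt (by linarith), h.scaled_dist]
  field_simp

end IsInwardMotion

/-! ### The parameters, and the conclusion -/

section Parameters

variable {β α κ c₀ : ℝ}

/-- Once `κ` is replaced by `c₀`, every power of `β` is an integer power of its seventh root, and
the remaining identities are between monomials. -/
lemma rpow_one_div_seven_pow (hβ : 0 < β) (n : ℕ) : (β ^ (1 / 7 : ℝ)) ^ n = β ^ (n / 7 : ℝ) := by
  rw [← Real.rpow_natCast, ← Real.rpow_mul hβ.le]
  congr 1
  ring

lemma sq_kappa_mul_rpow (hβ : 0 < β) (hc₀ : c₀ = κ * β ^ (6 / 7 - α)) :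
    κ ^ 2 * β ^ (2 - 2 * α) = c₀ ^ 2 * (β ^ (1 / 7 : ℝ)) ^ 2 := by
  rw [hc₀, mul_pow, mul_assoc, rpow_one_div_seven_pow hβ, ← Real.rpow_natCast (β ^ (6 / 7 - α)),
    ← Real.rpow_mul hβ.le, ← Real.rpow_add hβ]
  congr 2
  push_cast
  ring

lemma rpow_kappa_mul_rpow (hβ : 0 < β) (hκ : 0 < κ) (hc₀ : c₀ = κ * β ^ (6 / 7 - α)) :
    κ ^ (-14 : ℝ) * β ^ (14 * α - 12) = (c₀ ^ 14)⁻¹ := by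
  rw [hc₀, mul_pow, mul_inv, ← Real.rpow_natCast κ, ← Real.rpow_neg hκ.le,
    ← Real.rpow_natCast (β ^ (6 / 7 - α)), ← Real.rpow_mul hβ.le, ← Real.rpow_neg hβ.le]
  congr 2
  push_cast
  ring

lemma kappa_mul_rpow_neg (hβ : 0 < β) (hc₀ : c₀ = κ * β ^ (6 / 7 - α)) :
    κ * β ^ (-α) = c₀ * ((β ^ (1 / 7 : ℝ)) ^ 6)⁻¹ := by
  rw [hc₀, rpow_one_div_seven_pow hβ, mul_assoc, ← Real.rpow_neg hβ.le, ← Real.rpow_add hβ]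
  congr 2
  push_cast
  ring

end Parameters

theorem mainTheorem5 :
    ∃ C K : ℝ, 0 < C ∧ 0 < K ∧
    ∀ (G ρ M R b β R₀ R₁ α κ c₀ v₀ T₀ : ℝ) (I : Set ℝ) (B : Fin 2 → ℝ → Set Space3)
      (v : ℝ → Space3 → Space3) (p : ℝ → Space3 → ℝ)
      (x₁ v₁ : ℝ → Space3) (r₁ : ℝ → ℝ),
    -- parameters
    0 < G → 0 < ρ → 0 < R → 0 < b → 0 < R₀ → 0 < κ →
    M = ρ * (4 / 3 * Real.pi * R ^ 3) →
    β = b / R →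
    R₁ = √(b ^ 2 + R₀ ^ 2) →
    6 / 7 ≤ α → α ≤ 1 →
    v₀ = κ * β ^ (-α) * √(G * M / R) →
    c₀ = κ * β ^ (6 / 7 - α) →
    -- smallness and largeness conditions, and large initial separation
    K ≤ κ ^ 2 * β ^ (2 - 2 * α) →
    K ≤ κ ^ (-14 : ℝ) * β ^ (14 * α - 12) →
    K ≤ β →
    K * (G * M / v₀ ^ 2) ≤ R₁ →
    -- the solution, with its initial data, its symmetry, and the bound on the diameter
    I.OrdConnected → I.Nontrivial → IsLeast I T₀ →
    IsTwoBodySolution G ρ I T₀ B v p →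
    B 0 T₀ = Metric.ball !₂[-b, R₀, 0] R →
    B 1 T₀ = Metric.ball !₂[b, -R₀, 0] R →
    (∀ t ∈ I, B 1 t = (fun x => -x) '' B 0 t) →
    (∀ t ∈ I, Metric.diam (B 1 t) ≤ 10 * R) →
    -- center of mass of the first body, its velocity, and its distance to the origin
    (x₁ = fun t => centerOfMass ρ M (B 0 t)) →
    v₁ = derivWithin x₁ I →
    (r₁ = fun t => ‖x₁ t‖) →
    v₁ T₀ = !₂[0, -v₀, 0] →
    -- conclusions
    DifferentiableOn ℝ x₁ I ∧ DifferentiableOn ℝ v₁ I ∧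
    -- the first closest approach exists if the solution lives long enough
    (T₀ + C * (R₁ / v₀) ∈ I → ∃ r₀, IsFirstClosestApproach I r₁ r₀) ∧
    -- bounds as long as the first closest approach has not been passed
    (∀ t ∈ I, (∀ s ∈ I, s < t → derivWithin r₁ I s < 0) →
      DifferentiableWithinAt ℝ r₁ I t ∧
      ComparableWith C ‖derivWithin v₁ I t‖ (G * M / r₁ t ^ 2) ∧
      (R * c₀ ^ (-2 : ℝ) * β ^ (12 / 7 : ℝ) ≤ r₁ t →
        ComparableWith C |derivWithin r₁ I t| (√(G * M / R) * c₀ * β ^ (-(6 / 7) : ℝ)) ∧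
        ComparableWith C ‖v₁ t‖ (√(G * M / R) * c₀ * β ^ (-(6 / 7) : ℝ))) ∧
      (3 * R * c₀ ^ 2 * β ^ (2 / 7 : ℝ) ≤ r₁ t →
        r₁ t ≤ R * c₀ ^ (-2 : ℝ) * β ^ (12 / 7 : ℝ) →
        ComparableWith C |derivWithin r₁ I t| (√(G * M / R) * √(R / r₁ t)) ∧
        ComparableWith C ‖v₁ t‖ (√(G * M / R) * √(R / r₁ t))) ∧
      (r₁ t ≤ 4 * c₀ ^ 2 * R * β ^ (2 / 7 : ℝ) →
        ComparableWith C ‖v₁ t‖ (c₀⁻¹ * √(G * M / R) * β ^ (-(1 / 7) : ℝ)))) ∧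
    -- location of the first closest approach, and the bounds that involve it
    (∀ r₀, IsFirstClosestApproach I r₁ r₀ →
      3 / 2 * c₀ ^ 2 * R * β ^ (2 / 7 : ℝ) ≤ r₀ ∧
      r₀ ≤ 5 / 2 * c₀ ^ 2 * R * β ^ (2 / 7 : ℝ) ∧
      (∀ t ∈ I, r₀ ≤ r₁ t →
        ComparableWith C ‖derivWithin v₁ I t‖ (G * M / r₁ t ^ 2)) ∧
      ∃ t₀ ∈ I, r₁ t₀ = r₀ ∧ derivWithin r₁ I t₀ = 0 ∧
        ∀ t ∈ I, t < t₀ → r₀ < r₁ t ∧ derivWithin r₁ I t < 0 ∧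
          (r₁ t ≤ 4 * c₀ ^ 2 * R * β ^ (2 / 7 : ℝ) →
            ComparableWith C |derivWithin r₁ I t|
              (√(G * M) / (c₀ ^ 2 * R) * β ^ (-(2 / 7) : ℝ) * √(r₁ t - r₀)))) := by
  -- The value of `K` is dictated by `80 R ≤ ℓ / 10000`, that is `ℓ ≥ 800000 R`, and by the
  -- smallness of `v₀² ℓ / μ`. For the conditions on `c₀` and `R₁` any `K > 1` would do.
  refine ⟨20, 1000000, by norm_num, by norm_num, ?_⟩
  intro G ρ M R b β R₀ R₁ α κ c₀ v₀ T₀ I B v p x₁ v₁ r₁ hG hρ hR hb hR₀ hκ hM hβ hR₁ _ _ hv₀ hc₀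
    hK1 hK2 hK3 hK4 hI hIn hT hsol hB0 hB1 hsym hdiam hx₁ hv₁ hr₁ hv₁0
  have hMpos : 0 < M := by rw [hM]; positivity
  have hβpos : 0 < β := by rw [hβ]; positivity
  have hμ : 0 < G * M := by positivity
  set μ := G * M with hμdef
  rw [sq_kappa_mul_rpow hβpos hc₀] at hK1
  rw [rpow_kappa_mul_rpow hβpos hκ hc₀] at hK2
  rw [kappa_mul_rpow_neg hβpos hc₀] at hv₀
  have hc₀pos : 0 < c₀ := by rw [hc₀]; positivity
  have hZ2 : β ^ (2 / 7 : ℝ) = (β ^ (1 / 7 : ℝ)) ^ 2 := by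
    rw [rpow_one_div_seven_pow hβpos]; norm_num
  have hZ12 : β ^ (12 / 7 : ℝ) = (β ^ (1 / 7 : ℝ)) ^ 12 := by
    rw [rpow_one_div_seven_pow hβpos]; norm_num
  have hZ7 : β = (β ^ (1 / 7 : ℝ)) ^ 7 := by
    rw [rpow_one_div_seven_pow hβpos]; norm_num
  have hZ6 : β ^ (-(6 / 7) : ℝ) = ((β ^ (1 / 7 : ℝ)) ^ 6)⁻¹ := by
    rw [rpow_one_div_seven_pow hβpos, Real.rpow_neg hβpos.le]; norm_num
  have hZ2' : β ^ (-(2 / 7) : ℝ) = ((β ^ (1 / 7 : ℝ)) ^ 2)⁻¹ := by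
    rw [rpow_one_div_seven_pow hβpos, Real.rpow_neg hβpos.le]; norm_num
  have hZ1 : β ^ (-(1 / 7) : ℝ) = (β ^ (1 / 7 : ℝ))⁻¹ := Real.rpow_neg hβpos.le _
  have hc₀2 : c₀ ^ (-2 : ℝ) = (c₀ ^ 2)⁻¹ := by
    rw [Real.rpow_neg hc₀pos.le]; norm_num
  rw [hZ2, hZ12, hZ6, hZ2', hZ1, hc₀2]
  have hZpos : 0 < β ^ (1 / 7 : ℝ) := by positivity
  set Z := β ^ (1 / 7 : ℝ)
  set S := √(μ / R) with hS
  have hS2 : S ^ 2 * R = μ := by rw [hS, Real.sq_sqrt (by positivity)]; field_simp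
  have hSpos : 0 < S := by positivity
  have hbZ : b = Z ^ 7 * R := by rw [← hZ7, hβ]; field_simp
  have hv₀pos : 0 < v₀ := by rw [hv₀]; positivity
  have hR₁pos : 0 < R₁ := by rw [hR₁]; positivity
  have hR₁sq : R₁ ^ 2 = b ^ 2 + R₀ ^ 2 := by rw [hR₁, Real.sq_sqrt (by positivity)]
  -- The squared initial angular momentum `b² v₀²` divided by `μ`, as `hang` confirms; the condition
  -- on `κ² β^(2 - 2α)` says exactly `ℓ ≥ K R`.
  set ℓ := c₀ ^ 2 * R * Z ^ 2 with hℓ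
  have hℓpos : 0 < ℓ := by positivity
  have hℓR : 1000000 * R ≤ ℓ := by
    rw [hℓ]; linarith [mul_le_mul_of_nonneg_right hK1 hR.le]
  have hc₀1 : c₀ ≤ 1 := by
    by_contra! hlt
    have h1 : 1 ≤ c₀ ^ 14 := one_le_pow₀ hlt.le
    have h2 := inv_le_one_of_one_le₀ h1
    linarith
  have hZ1' : 1 ≤ Z := by
    by_contra! hlt
    have h1 : Z ^ 7 ≤ 1 := pow_le_one₀ hZpos.le hlt.le
    linarith
  have hspeed : v₀ ^ 2 * ℓ ≤ μ / 10000 := by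
    have e : v₀ ^ 2 * ℓ = μ * (c₀ ^ 4 / Z ^ 10) := by
      rw [hv₀, hℓ, ← hS2]; field_simp
    rw [e, div_eq_mul_one_div μ]
    refine mul_le_mul_of_nonneg_left ?_ hμ.le
    have h1 : c₀ ^ 4 ≤ 1 := pow_le_one₀ hc₀pos.le hc₀1
    have h2 : Z ^ 7 ≤ Z ^ 10 := pow_le_pow_right₀ hZ1' (by norm_num)
    rw [div_le_div_iff₀ (by positivity) (by norm_num)]
    linarith
  have hang : b ^ 2 * v₀ ^ 2 = μ * ℓ := by
    rw [hbZ, hv₀, hℓ, ← hS2]; field_simp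
  have hfar : μ ≤ v₀ ^ 2 * R₁ := by
    have h1 : 0 < μ / v₀ ^ 2 := by positivity
    have h2 : μ / v₀ ^ 2 ≤ R₁ := by linarith
    rwa [div_le_iff₀ (by positivity), mul_comm] at h2
  obtain ⟨hinit, V, A, hV, hA, hF⟩ := exists_hasDerivWithinAt_centerOfMass hG hρ hR hM hI hIn hT
    hsol hB0 hB1 hsym hdiam
  have hU := hI.uniqueDiffOn_of_nontrivial hIn
  have hx₁0 : x₁ T₀ = !₂[-b, R₀, 0] := by rw [hx₁]; exact hinit
  have hpos : ∀ t ∈ I, HasDerivWithinAt x₁ (V t) I t := by rw [hx₁]; exact hV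
  have hv₁V : ∀ t ∈ I, v₁ t = V t := fun t ht => by
    rw [hv₁]; exact (hpos t ht).derivWithin (hU t ht)
  have hv₁A : ∀ t ∈ I, HasDerivWithinAt v₁ (A t) I t := fun t ht =>
    (hA t ht).congr hv₁V (hv₁V t ht)
  have hAeq : ∀ t ∈ I, derivWithin v₁ I t = A t := fun t ht => (hv₁A t ht).derivWithin (hU t ht)
  have hnx : ‖x₁ T₀‖ = R₁ := by
    rw [hx₁0, EuclideanSpace.norm_eq, hR₁]
    simp [Fin.sum_univ_three]
  have hnv : ‖v₁ T₀‖ = v₀ := by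
    rw [hv₁0, EuclideanSpace.norm_eq]
    simp [Fin.sum_univ_three, Real.sqrt_sq hv₀pos.le]
  have hin : inner ℝ (x₁ T₀) (v₁ T₀) = -(R₀ * v₀) := by
    rw [hx₁0, hv₁0, PiLp.inner_apply]
    simp [Fin.sum_univ_three, mul_comm]
  have h : IsInwardMotion I T₀ μ ℓ x₁ v₁ (derivWithin v₁ I) := by
    refine ⟨hI, hIn, hT, hμ, hℓpos, fun t ht => ?_, fun t ht => ?_, fun t ht hr => ?_, ?_, ?_, ?_, ?_⟩
    · rw [hv₁V t ht]; exact hpos t ht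
    · rw [hAeq t ht]; exact hv₁A t ht
    · have hrpos : 0 < ‖x₁ t‖ := hℓpos.trans_le hr
      have := hF t ht (by rw [hx₁] at hr; linarith)
      rw [hAeq t ht]
      rw [hx₁] at hrpos ⊢
      refine this.trans ?_
      simp only at hrpos ⊢
      gcongr
      linarith
    · rw [hnx, hnv, hin, hR₁sq, ← hang]; ring
    · rw [hnx, hnv]; exact hfar
    · rw [hnv]; exact hspeed
    · rw [hin]
      have : 0 < R₀ * v₀ := by positivity
      linarith
  have hr₁' : r₁ = fun t => ‖x₁ t‖ := hr₁
  have hτv : S * c₀ * (Z ^ 6)⁻¹ = v₀ := by rw [hv₀]; ring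
  have hτfar : R * (c₀ ^ 2)⁻¹ * Z ^ 12 = μ / v₀ ^ 2 := by
    rw [hv₀, ← hS2]; field_simp
  have hτmid : ∀ r : ℝ, S * √(R / r) = √(μ / r) := fun r => by
    rw [hS, ← Real.sqrt_mul (by positivity)]
    congr 1
    field_simp
  have hτnear : c₀⁻¹ * S * Z⁻¹ = √(μ / ℓ) := by
    rw [eq_comm, Real.sqrt_eq_iff_mul_self_eq_of_pos (by positivity), hℓ, ← hS2]
    field_simp
  have hτturn : √μ / (c₀ ^ 2 * R) * (Z ^ 2)⁻¹ = √μ / ℓ := by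
    rw [hℓ]; field_simp
  have h3 : 3 * R * c₀ ^ 2 * Z ^ 2 = 3 * ℓ := by rw [hℓ]; ring
  have h4 : 4 * c₀ ^ 2 * R * Z ^ 2 = 4 * ℓ := by rw [hℓ]; ring
  have h32 : 3 / 2 * c₀ ^ 2 * R * Z ^ 2 = 3 / 2 * ℓ := by rw [hℓ]; ring
  have h52 : 5 / 2 * c₀ ^ 2 * R * Z ^ 2 = 5 / 2 * ℓ := by rw [hℓ]; ring
  rw [hτv, hτfar, hτnear, hτturn, h3, h4, h32, h52]
  simp only [hτmid]
  subst hr₁'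
  refine ⟨fun t ht => (hpos t ht).differentiableWithinAt,
    fun t ht => (hv₁A t ht).differentiableWithinAt, ?_, ?_, ?_⟩
  · intro hlong
    exact h.exists_isFirstClosestApproach (by rwa [hnx, hnv])
  · intro t ht hpre
    have hc := h.isCloseAt ht (h.inner_neg_of_derivWithin_neg hpre)
    refine ⟨(h.hasDerivWithinAt_norm ht hc.pos).differentiableWithinAt,
      h.comparableWith_acceleration ht hc.lt.le, fun hr => ?_, fun hr hr' => ?_,
      fun hr => hc.comparableWith_near hr⟩
    · have := hc.comparableWith_far ht (by rwa [hnv])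
      rwa [hnv] at this
    · exact hc.comparableWith_middle ht hr (by rwa [hnv])
  · intro r₀ hr₀
    obtain ⟨t₀, ht₀, rfl, h0, hpre⟩ := h.exists_turning_of_isFirstClosestApproach hr₀
    have hc := h.isCloseAt ht₀ hpre
    refine ⟨hc.lt.le, hc.le_of_turning h0, fun t ht hr =>
      h.comparableWith_acceleration ht (hc.lt.le.trans hr), t₀, ht₀, rfl, ?_, fun t ht htt => ?_⟩
    · rw [h.derivWithin_norm ht₀ hc.pos, h0, zero_div]
    · refine ⟨?_, h.derivWithin_neg_of_inner_neg ht (hpre t ht htt), fun hr =>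
        (h.comparableWith_turning ht₀ h0 hpre ht htt hr).2⟩
      by_cases hr : ‖x₁ t‖ ≤ 4 * ℓ
      · exact (h.comparableWith_turning ht₀ h0 hpre ht htt hr).1
      · linarith [hc.le_of_turning h0]
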